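/- All graphs are finite and simple. For a graph $G$ let $\Delta(G)$ be its maximum degree and $\chi'(G)$ its chromatic index, that is, the least integer $m\ge 0$ such that the edges of $G$ can be colored with $m$ colors so that no two distinct edges sharing an endpoint receive the same color. A graph $G$ is called $\Delta$-critical if $\Delta(G)=\Delta$, $\chi'(G)=\Delta+1$, and $\chi'(H)<\chi'(G)$ for every proper subgraph $H$ of $G$. The core $G_\Delta$ of $G$ is the subgraph of $G$ induced by the vertices of maximum degree, and $\delta(G_\Delta)$ is its minimum degree. Theorem. Let $k\ge 2$ be an integer and let $G$ be a $\Delta$-critical graph of order $n=|V(G)|$. If $\Delta\ge \frac{2}{3}n+\frac{3k}{2}$ and $\delta(G_\Delta)\le k$, then $G$ is overfull, i.e. $|E(G)|>\Delta\cdot\lfloor n/2\rfloor$. -/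

import Mathlib

namespace SimpleGraph

/-- The chromatic index `χ'(G)`: the least number of colors in a proper edge coloring of `G`,
i.e. in a coloring of the edges such that edges sharing an endpoint receive different colors
(it is `⊤` if no finite number of colors suffices, which does not happen for finite graphs). -/
noncomputable def chromaticIndex {V : Type*} (G : SimpleGraph V) : ℕ∞ :=
  G.lineGraph.chromaticNumber

/-- `G` is critical if `χ'(H) < χ'(G)` for every proper subgraph `H` of `G`; a proper subgraph
may lack vertices as well as edges. -/
def IsEdgeCritical {V : Type*} (G : SimpleGraph V) : Prop :=
  ∀ H : G.Subgraph, H ≠ ⊤ → H.coe.chromaticIndex < G.chromaticIndex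

/-- `G` is of class 2 if `χ'(G) = Δ(G) + 1`. -/
def IsClassTwo {V : Type*} [Fintype V] (G : SimpleGraph V) [DecidableRel G.Adj] : Prop :=
  G.chromaticIndex = (G.maxDegree : ℕ∞) + 1

/-- `G` is `D`-critical if it is a critical class 2 graph of maximum degree `D`. -/
structure IsDeltaCritical {V : Type*} [Fintype V] (G : SimpleGraph V) [DecidableRel G.Adj]
    (D : ℕ) : Prop where
  critical : G.IsEdgeCritical
  classTwo : G.IsClassTwo
  maxDegree_eq : G.maxDegree = D

/-- The core `G_Δ` of `G`: the subgraph induced by the vertices of maximum degree. -/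
abbrev core {V : Type*} [Fintype V] (G : SimpleGraph V) [DecidableRel G.Adj] :
    SimpleGraph {v : V | G.degree v = G.maxDegree} :=
  G.induce {v : V | G.degree v = G.maxDegree}

/-- `G` is overfull if `|E(G)| > Δ(G) * ⌊n / 2⌋`, where `n` is the number of vertices
(natural number division rounds down). -/
def IsOverfull {V : Type*} [Fintype V] (G : SimpleGraph V) [DecidableRel G.Adj] : Prop :=
  G.maxDegree * (Fintype.card V / 2) < G.edgeFinset.card

end SimpleGraph

/-!
# Critical graphs of large maximum degree are overfull

An edge coloring is encoded as a family of involutions `f a` of the vertices, where `f a` exchanges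
the ends of the edges of color `a`; a vertex misses `a` if it is fixed by `f a`. The center `u` is a
vertex of degree `D` with few neighbors of degree `D`, and one edge `u s` to a vertex of smaller
degree, the hole, is uncolored. Since `G` is of class 2, the multi-fan `Fan f u s` is elementary (no
two of its vertices miss the same color), and its missing colors are linked to the center by Kempe
chains with the missing color `o` of the center.

There are two cases. Suppose first that for some `s` the closed neighborhood of `u` is elementary in
all colorings. Vizing's adjacency lemma shows that a vertex `z` not adjacent to `u` has many common
neighbors with `u`, and a recoloring of an edge from `z` to one of them shows that `z` shares no
missing color with the neighborhood of `u`. Then the whole vertex set is elementary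
(`elementary_of_near`), so that all missing colors are counted by `D`, and `G` is overfull
(`overfull_of_elementary`).

Otherwise every choice of `s` has a coloring with a token: a neighbor of `u` outside the fan which
shares a missing color with the fan or with `u`. Among these colorings choose one whose fan has the
most vertices of degree `D`, and then the most vertices. By this choice, a color of an edge from `s`
to a token is also the color of an edge from `u` to a vertex of degree `D` outside the fan
(`Extremal.big_of_token`). Hence most neighbors of `s` and `u` outside the fan are robust: they cannot
be turned into tokens. Now let a token `v` be the root of a largest tree of arcs outside the fan.
Recolorings along arcs show that the edges from `v` to robust vertices and to vertices of the fan, if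
these have degree less than `D`, have colors leading from `u` to a part of the neighborhood of `u`
which again behaves like a fan (`Maximal.robust_adj_root`, `Maximal.fan_adj_root`). Counting vertices
of degree `D` there bounds the number of common neighbors of `u`, `s` and `v`
(`Maximal.card_common_le`). But the adjacency lemma gives `s` and `v` large degrees, so they have
more common neighbors with `u` than that (`three_mul_degree_le`).
-/

namespace OverfullCore

open Relation
open scoped Classical

/-! ### Edge colorings as families of involutions, and Kempe chains -/

section

variable {V : Type*} {D : ℕ}

/-- A proper edge coloring of `G` with the colors `Fin D`: the map `f a` exchanges the two ends of
each edge of color `a` and fixes the vertices that miss `a`. -/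
structure IsFull (G : SimpleGraph V) (f : Fin D → V → V) : Prop where
  inv : ∀ a x, f a (f a x) = x
  adj : ∀ a x, f a x ≠ x → G.Adj x (f a x)
  inj : ∀ a b x, f a x = f b x → f a x ≠ x → a = b
  surj : ∀ x y, G.Adj x y → ∃ a, f a x = y

/-- A proper edge coloring of `G` without the edge `u s`, encoded as in `IsFull`. The vertex `u` is
the center and `s` is the hole. -/
structure IsCol (G : SimpleGraph V) (u s : V) (f : Fin D → V → V) : Prop where
  hadj : G.Adj u s
  inv : ∀ a x, f a (f a x) = x
  adj : ∀ a x, f a x ≠ x → G.Adj x (f a x)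
  inj : ∀ a b x, f a x = f b x → f a x ≠ x → a = b
  hole : ∀ a, f a u ≠ s
  surj : ∀ x y, G.Adj x y → ¬(x = u ∧ y = s) → ¬(x = s ∧ y = u) → ∃ a, f a x = y

/-- Exchange the colors `a` and `b` at the vertices of `S`. This is used for sets `S` that are closed
under `f a` and `f b`, that is, for unions of Kempe chains. -/
noncomputable def kswap (f : Fin D → V → V) (a b : Fin D) (S : Set V) : Fin D → V → V :=
  fun c x => f (if x ∈ S then Equiv.swap a b c else c) x

section kswap
variable {f : Fin D → V → V} {a b c : Fin D} {S : Set V} {x : V}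

theorem kswap_of_notMem (hx : x ∉ S) : kswap f a b S c x = f c x := by simp [kswap, hx]

theorem kswap_left (hx : x ∈ S) : kswap f a b S a x = f b x := by simp [kswap, hx]

theorem kswap_right (hx : x ∈ S) : kswap f a b S b x = f a x := by simp [kswap, hx]

theorem kswap_of_ne (ha : c ≠ a) (hb : c ≠ b) : kswap f a b S c x = f c x := by
  simp [kswap, Equiv.swap_apply_of_ne_of_ne ha hb]

end kswap

variable {G : SimpleGraph V} {u s : V} {f : Fin D → V → V}

namespace IsCol

theorem eq_iff (h : IsCol G u s f) {a : Fin D} {x y : V} : f a x = y ↔ f a y = x := by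
  constructor <;> (rintro rfl; exact h.inv _ _)

theorem injective (h : IsCol G u s f) (a : Fin D) : Function.Injective (f a) :=
  fun x y e => by rw [← h.inv a x, e, h.inv]

theorem ne (h : IsCol G u s f) : u ≠ s := h.hadj.ne

theorem hole' (h : IsCol G u s f) (a : Fin D) : f a s ≠ u := fun e => h.hole a (h.eq_iff.1 e)

protected theorem kswap (h : IsCol G u s f) {a b : Fin D} {S : Set V}
    (hS : ∀ x ∈ S, f a x ∈ S ∧ f b x ∈ S) : IsCol G u s (kswap f a b S) where
  hadj := h.hadj
  inv := by
    intro c x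
    have key : ∀ d, (d = a ∨ d = b) → (f d x ∈ S ↔ x ∈ S) := by
      rintro d (rfl | rfl)
      · exact ⟨fun hx => by simpa [h.inv] using (hS _ hx).1, fun hx => (hS _ hx).1⟩
      · exact ⟨fun hx => by simpa [h.inv] using (hS _ hx).2, fun hx => (hS _ hx).2⟩
    by_cases hca : c = a
    · subst hca
      by_cases hx : x ∈ S
      · rw [kswap_left hx, kswap_left ((key b (.inr rfl)).2 hx), h.inv]
      · rw [kswap_of_notMem hx, kswap_of_notMem (mt (key c (.inl rfl)).1 hx), h.inv]
    by_cases hcb : c = b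
    · subst hcb
      by_cases hx : x ∈ S
      · rw [kswap_right hx, kswap_right ((key a (.inl rfl)).2 hx), h.inv]
      · rw [kswap_of_notMem hx, kswap_of_notMem (mt (key c (.inr rfl)).1 hx), h.inv]
    rw [kswap_of_ne hca hcb, kswap_of_ne hca hcb, h.inv]
  adj c x hx := h.adj _ _ hx
  inj c d x e hx := by
    have := h.inj _ _ x e hx
    split_ifs at this
    · exact (Equiv.swap a b).injective this
    · exact this
  hole c := h.hole _
  surj x y hxy h1 h2 := by
    obtain ⟨c, hc⟩ := h.surj x y hxy h1 h2
    refine ⟨if x ∈ S then Equiv.swap a b c else c, ?_⟩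
    simp only [kswap]
    split_ifs <;> simp [hc]

end IsCol

/-- The vertex set of the Kempe chain of the colors `a` and `b` through `x`. -/
def comp (f : Fin D → V → V) (a b : Fin D) (x : V) : Set V :=
  {y | ReflTransGen (fun p q => q = f a p ∨ q = f b p) x y}

theorem mem_comp_self (f : Fin D → V → V) (a b : Fin D) (x : V) : x ∈ comp f a b x :=
  ReflTransGen.refl

theorem comp_closed (f : Fin D → V → V) (a b : Fin D) (x : V) :
    ∀ y ∈ comp f a b x, f a y ∈ comp f a b x ∧ f b y ∈ comp f a b x :=
  fun _ hy => ⟨ReflTransGen.tail hy (.inl rfl), ReflTransGen.tail hy (.inr rfl)⟩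

theorem IsCol.comp_symm (h : IsCol G u s f) {a b : Fin D} {x y : V} (hy : y ∈ comp f a b x) :
    x ∈ comp f a b y := by
  have : Std.Symm fun p q => q = f a p ∨ q = f b p := ⟨by
    rintro p q (rfl | rfl)
    · exact .inl (h.inv _ _).symm
    · exact .inr (h.inv _ _).symm⟩
  exact ReflTransGen.stdSymm.symm _ _ hy

theorem IsCol.comp_trans {a b : Fin D} {x y z : V} (hy : y ∈ comp f a b x)
    (hz : z ∈ comp f a b y) : z ∈ comp f a b x := ReflTransGen.trans hy hz

/-- The arithmetic behind `IsCol.two_ends`: modulo `N` there is at most one nonzero residue `i` with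
`2 * i = 0` or `2 * i = -1`, because only one of the two equations has such a solution. -/
theorem int_dvd_sub {N i j : ℤ} (hi : N ∣ 2 * i ∨ N ∣ 2 * i + 1) (hj : N ∣ 2 * j ∨ N ∣ 2 * j + 1)
    (hi' : ¬ N ∣ i) (hj' : ¬ N ∣ j) : N ∣ i - j := by
  have cop : ∀ k, N ∣ 2 * k + 1 → IsCoprime N 2 := by
    rintro k ⟨p, hp⟩
    exact ⟨p, -k, by linarith⟩
  rcases hi with hi | hi <;> rcases hj with hj | hj
  · obtain ⟨p, hp⟩ := hi
    obtain ⟨q, hq⟩ := hj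
    rcases Int.even_or_odd' p with ⟨p', rfl | rfl⟩
    · exact absurd ⟨p', by linarith⟩ hi'
    rcases Int.even_or_odd' q with ⟨q', rfl | rfl⟩
    · exact absurd ⟨q', by linarith⟩ hj'
    exact ⟨p' - q', by linarith⟩
  · exact absurd ((cop j hj).dvd_of_dvd_mul_left hi) hi'
  · exact absurd ((cop i hi).dvd_of_dvd_mul_left hj) hj'
  · refine (cop i hi).dvd_of_dvd_mul_left ?_
    have := dvd_sub hi hj
    rwa [show 2 * i + 1 - (2 * j + 1) = 2 * (i - j) by ring] at this

/-- A Kempe chain has at most two ends: besides an end `r` there is at most one more vertex missing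
one of the two colors. The chain is an orbit of `f a` and `f b`, so its vertices are powers of
`f a * f b` applied to `r`, and the missing colors translate into divisibilities by the period. -/
theorem IsCol.two_ends (h : IsCol G u s f) {a b : Fin D} {r y z : V} (hr : f a r = r)
    (hy : y ∈ comp f a b r) (hz : z ∈ comp f a b r) (hy' : f a y = y ∨ f b y = y)
    (hz' : f a z = z ∨ f b z = z) (hyr : y ≠ r) (hzr : z ≠ r) : y = z := by
  let pa : Equiv.Perm V := Function.Involutive.toPerm (f a) (h.inv a)
  let pb : Equiv.Perm V := Function.Involutive.toPerm (f b) (h.inv b)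
  let g : Equiv.Perm V := pa * pb
  have hpa : ∀ x, pa x = f a x := fun _ => rfl
  have hpb : ∀ x, pb x = f b x := fun _ => rfl
  have hpa2 : pa * pa = 1 := by ext x; simp [hpa, h.inv]
  have hpb2 : pb * pb = 1 := by ext x; simp [hpb, h.inv]
  have hainv : pa⁻¹ = pa := inv_eq_of_mul_eq_one_left hpa2
  have hbinv : pb⁻¹ = pb := inv_eq_of_mul_eq_one_left hpb2
  have conj : pa * g * pa⁻¹ = g⁻¹ := by
    simp only [g, mul_inv_rev, hainv, hbinv, ← mul_assoc, hpa2, one_mul]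
  have ha : ∀ i : ℤ, f a ((g ^ i) r) = (g ^ (-i)) r := by
    intro i
    have h1 : pa * g ^ i * pa⁻¹ = g ^ (-i) := by rw [← conj_zpow, conj, inv_zpow, zpow_neg]
    rw [← h1, hainv]
    simp [hpa, hr]
  have hb : ∀ i : ℤ, f b ((g ^ i) r) = (g ^ (-(i + 1))) r := by
    intro i
    rw [← ha, add_comm, zpow_add, zpow_one]
    simp [g, hpa, hpb, h.inv]
  have hpow : ∀ x ∈ comp f a b r, ∃ i : ℤ, x = (g ^ i) r := by
    intro x hx
    induction hx with
    | refl => exact ⟨0, rfl⟩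
    | tail _ h2 ih =>
      obtain ⟨i, rfl⟩ := ih
      rcases h2 with rfl | rfl
      · exact ⟨_, ha i⟩
      · exact ⟨_, hb i⟩
  obtain ⟨N, hN⟩ : ∃ N : ℤ, ∀ m : ℤ, (g ^ m) r = r ↔ N ∣ m :=
    ⟨_, fun m => MulAction.zpow_smul_eq_iff_minimalPeriod_dvd (a := g) (b := r) (n := m)⟩
  have heq : ∀ i j : ℤ, (g ^ i) r = (g ^ j) r ↔ N ∣ i - j := by
    intro i j
    rw [← hN, sub_eq_neg_add, zpow_add, Equiv.Perm.mul_apply, zpow_neg,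
      Equiv.Perm.inv_eq_iff_eq]
  have hdef : ∀ i : ℤ, (f a ((g ^ i) r) = (g ^ i) r ∨ f b ((g ^ i) r) = (g ^ i) r) →
      N ∣ 2 * i ∨ N ∣ 2 * i + 1 := by
    intro i
    rw [ha, hb, heq, heq]
    rintro (h1 | h1)
    · left; rw [← dvd_neg]; exact (by ring : -i - i = -(2 * i)) ▸ h1
    · right; rw [← dvd_neg]; exact (by ring : -(i + 1) - i = -(2 * i + 1)) ▸ h1
  obtain ⟨i, rfl⟩ := hpow y hy
  obtain ⟨j, rfl⟩ := hpow z hz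
  rw [heq]
  exact int_dvd_sub (hdef i hy') (hdef j hz') (fun e => hyr ((hN i).2 e)) (fun e => hzr ((hN j).2 e))

/-- The colors that are missing at `x`. -/
noncomputable def miss (f : Fin D → V → V) (x : V) : Finset (Fin D) :=
  Finset.univ.filter fun a => f a x = x

@[simp] theorem mem_miss {a : Fin D} {x : V} : a ∈ miss f x ↔ f a x = x := by simp [miss]

theorem card_miss_add_card (x : V) (N : Finset V) (hN : ∀ a, f a x ≠ x → f a x ∈ N)
    (hinj : ∀ a b, f a x = f b x → f a x ≠ x → a = b)
    (hsurj : ∀ y ∈ N, y ≠ x ∧ ∃ a, f a x = y) : (miss f x).card + N.card = D := by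
  have h1 : (Finset.univ.filter fun a => ¬ f a x = x).card = N.card := by
    refine Finset.card_bij (fun a _ => f a x) ?_ ?_ ?_
    · intro a ha; exact hN a (Finset.mem_filter.1 ha).2
    · intro a ha b _ e; exact hinj a b e (Finset.mem_filter.1 ha).2
    · intro y hy
      obtain ⟨hne, a, rfl⟩ := hsurj y hy
      exact ⟨a, by simpa using hne, rfl⟩
  rw [← h1, miss, Finset.card_filter_add_card_filter_not]
  simp

variable [Fintype V] [DecidableRel G.Adj]

theorem IsCol.card_miss (h : IsCol G u s f) {x : V} (hu : x ≠ u) (hs : x ≠ s) :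
    (miss f x).card + G.degree x = D := by
  rw [← G.card_neighborFinset_eq_degree]
  refine card_miss_add_card x _ (fun a ha => ?_) (fun a b => h.inj a b x) ?_
  · simpa using h.adj a x ha
  · intro y hy
    have hy : G.Adj x y := by simpa using hy
    exact ⟨hy.ne', h.surj x y hy (fun e => hu e.1) (fun e => hs e.1)⟩

theorem IsCol.card_miss_hole (h : IsCol G u s f) : (miss f s).card + G.degree s = D + 1 := by
  have : (miss f s).card + ((G.neighborFinset s).erase u).card = D := by
    refine card_miss_add_card s _ (fun a ha => ?_) (fun a b => h.inj a b s) ?_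
    · simpa using ⟨h.hole' a, h.adj a s ha⟩
    · intro y hy
      have hy : y ≠ u ∧ G.Adj s y := by simpa using hy
      exact ⟨hy.2.ne', h.surj s y hy.2 (fun e => h.ne e.1.symm) (fun e => hy.1 e.2)⟩
  have h2 := Finset.card_erase_add_one (s := G.neighborFinset s) (a := u) (by simpa using h.hadj.symm)
  rw [G.card_neighborFinset_eq_degree] at h2
  omega

theorem IsCol.card_miss_center (h : IsCol G u s f) : (miss f u).card + G.degree u = D + 1 := by
  have : (miss f u).card + ((G.neighborFinset u).erase s).card = D := by
    refine card_miss_add_card u _ (fun a ha => ?_) (fun a b => h.inj a b u) ?_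
    · simpa using ⟨h.hole a, h.adj a u ha⟩
    · intro y hy
      have hy : y ≠ s ∧ G.Adj u y := by simpa using hy
      exact ⟨hy.2.ne', h.surj u y hy.2 (fun e => hy.1 e.2) (fun e => h.ne e.1)⟩
  have h2 := Finset.card_erase_add_one (s := G.neighborFinset u) (a := s) (by simpa using h.hadj)
  rw [G.card_neighborFinset_eq_degree] at h2
  omega

end

/-! ### Fans at the center -/

section

section Relation
variable {α : Type*} {r : α → α → Prop}

theorem rtg_mono {r' : α → α → Prop} {x y : α} (hr : ∀ p q, r p q → r' p q)
    (h : ReflTransGen r x y) : ReflTransGen r' x y :=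
  ReflTransGen.mono hr _ _ h

/-- A path into `B` can be cut at its first vertex in `B`; all targets of the steps before are
outside `B`. -/
theorem rtg_first_hit {B : Set α} {w y : α} (h : ReflTransGen r w y) (hy : y ∈ B) :
    w ∈ B ∨ (w ∉ B ∧ ∃ p b, b ∈ B ∧ p ∉ B ∧
      ReflTransGen (fun x z => r x z ∧ z ∉ B) w p ∧ r p b) := by
  by_cases hw : w ∈ B
  · exact .inl hw
  have key : ∀ y, ReflTransGen r w y →
      (y ∉ B ∧ ReflTransGen (fun x z => r x z ∧ z ∉ B) w y) ∨ ∃ p b, b ∈ B ∧ p ∉ B ∧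
        ReflTransGen (fun x z => r x z ∧ z ∉ B) w p ∧ r p b := by
    intro y h
    induction h with
    | refl => exact .inl ⟨hw, .refl⟩
    | @tail b c _ hbc ih =>
      rcases ih with ⟨hb, ih⟩ | ih
      · by_cases hc : c ∈ B
        · exact .inr ⟨b, c, hc, hb, ih, hbc⟩
        · exact .inl ⟨hc, ih.tail ⟨hbc, hc⟩⟩
      · exact .inr ih
  rcases key y h with ⟨h1, _⟩ | h1
  · exact absurd hy h1
  · exact .inr ⟨hw, h1⟩

/-- A path can be cut after its last visit of `x`. -/
theorem rtg_last_departure {x w y : α} (h : ReflTransGen r w y) (hy : y ≠ x) :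
    (w ≠ x ∧ ReflTransGen (fun p q => r p q ∧ q ≠ x) w y) ∨
      ∃ w', r x w' ∧ w' ≠ x ∧ ReflTransGen (fun p q => r p q ∧ q ≠ x) w' y := by
  induction h using ReflTransGen.head_induction_on with
  | refl => exact .inl ⟨hy, .refl⟩
  | @head a c hac _ ih =>
    rcases ih with ⟨hc, ih⟩ | ih
    · by_cases ha : a = x
      · subst ha; exact .inr ⟨c, hac, hc, ih⟩
      · exact .inl ⟨ha, ih.head ⟨hac, hc⟩⟩
    · exact .inr ih

/-- A path into `S` can be cut at its first vertex in `S`; the sources of all steps are then outside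
`S`. -/
theorem rtg_exists_first {S : Set α} {w y : α} (h : ReflTransGen r w y)
    (hy : y ∈ S) : ∃ b ∈ S, ReflTransGen (fun p q => r p q ∧ p ∉ S) w b := by
  induction h using ReflTransGen.head_induction_on with
  | refl => exact ⟨y, hy, .refl⟩
  | @head a c hac _ ih =>
    by_cases ha : a ∈ S
    · exact ⟨a, ha, .refl⟩
    · obtain ⟨b, hb, hr⟩ := ih
      exact ⟨b, hb, hr.head ⟨hac, ha⟩⟩

theorem rtg_drop_loops {w y : α} (h : ReflTransGen r w y) :
    ReflTransGen (fun p q => r p q ∧ q ≠ w) w y := by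
  induction h with
  | refl => exact .refl
  | @tail b c _ hbc ih =>
    by_cases hc : c = w
    · subst hc; exact .refl
    · exact ih.tail ⟨hbc, hc⟩

end Relation

variable {V : Type*} {D : ℕ} {G : SimpleGraph V} {u s : V} {f f' f'' : Fin D → V → V}

/-- There is an arc from `p` to `q` if `p` misses the color of the edge `u q`. -/
def Arc (f : Fin D → V → V) (u p q : V) : Prop := ∃ a, f a p = p ∧ f a u = q ∧ q ≠ u

/-- An arc whose target is in `Z`. -/
def ArcIn (f : Fin D → V → V) (u : V) (Z : Set V) (p q : V) : Prop := Arc f u p q ∧ q ∈ Z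

/-- The fan: the vertices that are reached from the hole along arcs. -/
def Fan (f : Fin D → V → V) (u s : V) : Set V := {y | ReflTransGen (Arc f u) s y}

theorem self_mem_fan (f : Fin D → V → V) (u s : V) : s ∈ Fan f u s := ReflTransGen.refl

theorem fan_step {y z : V} {a : Fin D} (hy : y ∈ Fan f u s) (ha : f a y = y) (hz : f a u = z)
    (hzu : z ≠ u) : z ∈ Fan f u s :=
  ReflTransGen.tail hy ⟨a, ha, hz, hzu⟩

theorem exists_arc_of_mem_fan {y : V} (hy : y ∈ Fan f u s) (hys : y ≠ s) :
    ∃ p ∈ Fan f u s, ∃ a, f a p = p ∧ f a u = y ∧ y ≠ u := by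
  rcases ReflTransGen.cases_tail hy with rfl | ⟨p, hp, a, h⟩
  · exact absurd rfl hys
  · exact ⟨p, hp, a, h⟩

namespace IsCol

theorem arc_ne_hole (h : IsCol G u s f) {p q : V} (hpq : Arc f u p q) : q ≠ s := by
  obtain ⟨a, _, rfl, _⟩ := hpq
  exact h.hole a

theorem adj_of_mem_fan (h : IsCol G u s f) {y : V} (hy : y ∈ Fan f u s) : G.Adj u y := by
  rcases eq_or_ne y s with rfl | hys
  · exact h.hadj
  obtain ⟨p, _, a, _, rfl, hne⟩ := exists_arc_of_mem_fan hy hys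
  exact h.adj a u hne

theorem ne_of_mem_fan (h : IsCol G u s f) {y : V} (hy : y ∈ Fan f u s) : y ≠ u :=
  (h.adj_of_mem_fan hy).ne'

/-- If the center and the hole miss a common color, then the missing edge can be colored. -/
theorem exists_full (h : IsCol G u s f) {a : Fin D} (hu : f a u = u) (hs : f a s = s) :
    ∃ f' : Fin D → V → V, IsFull G f' := by
  have hne := h.ne
  let f' : Fin D → V → V := fun c x =>
    if c = a then (if x = u then s else if x = s then u else f a x) else f c x
  have e1 : f' a u = s := by simp [f']
  have e2 : f' a s = u := by simp [f', hne.symm]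
  have e3 : ∀ x, x ≠ u → x ≠ s → f' a x = f a x := fun x h1 h2 => by simp [f', h1, h2]
  have e4 : ∀ c x, c ≠ a → f' c x = f c x := fun c x hc => by simp [f', hc]
  refine ⟨f', ?_, ?_, ?_, ?_⟩
  · intro c x
    rcases eq_or_ne c a with rfl | hc
    · rcases eq_or_ne x u with rfl | hxu
      · rw [e1, e2]
      rcases eq_or_ne x s with rfl | hxs
      · rw [e2, e1]
      rw [e3 x hxu hxs, e3, h.inv]
      · exact fun e => hxu ((h.injective c) (e.trans hu.symm))
      · exact fun e => hxs ((h.injective c) (e.trans hs.symm))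
    · rw [e4 c _ hc, e4 c _ hc, h.inv]
  · intro c x hx
    rcases eq_or_ne c a with rfl | hc
    · rcases eq_or_ne x u with rfl | hxu
      · rw [e1]; exact h.hadj
      rcases eq_or_ne x s with rfl | hxs
      · rw [e2]; exact h.hadj.symm
      rw [e3 x hxu hxs] at hx ⊢
      exact h.adj c x hx
    · rw [e4 c _ hc] at hx ⊢
      exact h.adj c x hx
  · have key : ∀ c x, c ≠ a → f' c x = f' a x → f' c x ≠ x → False := by
      intro c x hc e hx
      rw [e4 c _ hc] at e hx
      rcases eq_or_ne x u with rfl | hxu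
      · rw [e1] at e; exact h.hole c e
      rcases eq_or_ne x s with rfl | hxs
      · rw [e2] at e; exact h.hole' c e
      rw [e3 x hxu hxs] at e
      exact hc (h.inj c a x e hx)
    intro c d x e hx
    by_cases hc : c = a <;> by_cases hd : d = a
    · rw [hc, hd]
    · subst hc; exact (key d x hd e.symm (e ▸ hx)).elim
    · subst hd; exact (key c x hc e hx).elim
    · rw [e4 c _ hc, e4 d _ hd] at e
      rw [e4 c _ hc] at hx
      exact h.inj c d x e hx
  · intro x y hxy
    by_cases h1 : x = u ∧ y = s
    · obtain ⟨rfl, rfl⟩ := h1; exact ⟨a, e1⟩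
    by_cases h2 : x = s ∧ y = u
    · obtain ⟨rfl, rfl⟩ := h2; exact ⟨a, e2⟩
    obtain ⟨c, rfl⟩ := h.surj x y hxy h1 h2
    refine ⟨c, ?_⟩
    rcases eq_or_ne c a with rfl | hc
    · refine e3 x ?_ ?_
      · rintro rfl; exact hxy.ne hu.symm
      · rintro rfl; exact hxy.ne hs.symm
    · exact e4 c x hc

end IsCol

/-- Give the edge `u s` the color `a` of the edge `u w`, which becomes the uncolored edge. -/
noncomputable def moveHole (f : Fin D → V → V) (u s w : V) (a : Fin D) : Fin D → V → V :=
  fun c x => if c = a then (if x = u then s else if x = s then u else if x = w then w else f a x)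
    else f c x

section moveHole
variable {a c : Fin D} {w x : V}

theorem moveHole_of_ne (hc : c ≠ a) : moveHole f u s w a c x = f c x := by simp [moveHole, hc]

theorem moveHole_center : moveHole f u s w a a u = s := by simp [moveHole]

theorem moveHole_old (hne : s ≠ u) : moveHole f u s w a a s = u := by simp [moveHole, hne]

theorem moveHole_new (hu : w ≠ u) (hs : w ≠ s) : moveHole f u s w a a w = w := by
  simp [moveHole, hu, hs]

theorem moveHole_other (hu : x ≠ u) (hs : x ≠ s) (hw : x ≠ w) :
    moveHole f u s w a c x = f c x := by
  by_cases hc : c = a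
  · simp [moveHole, hu, hs, hw, hc]
  · exact moveHole_of_ne hc

end moveHole

namespace IsCol

protected theorem moveHole (h : IsCol G u s f) {a : Fin D} {w : V} (hs : f a s = s)
    (hw : f a u = w) (hwu : w ≠ u) : IsCol G u w (moveHole f u s w a) := by
  have hne := h.ne
  have hws : w ≠ s := hw ▸ h.hole a
  have hw' : f a w = u := h.eq_iff.1 hw
  set f' := moveHole f u s w a with hf'
  have e1 : f' a u = s := moveHole_center
  have e2 : f' a s = u := moveHole_old hne.symm
  have e2' : f' a w = w := moveHole_new hwu hws
  have e3 : ∀ x, x ≠ u → x ≠ s → x ≠ w → f' a x = f a x := fun x => moveHole_other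
  have e4 : ∀ c x, c ≠ a → f' c x = f c x := fun c x => moveHole_of_ne
  refine ⟨hw ▸ h.adj a u (hw ▸ hwu), ?_, ?_, ?_, ?_, ?_⟩
  · intro c x
    rcases eq_or_ne c a with rfl | hc
    · rcases eq_or_ne x u with rfl | hxu
      · rw [e1, e2]
      rcases eq_or_ne x s with rfl | hxs
      · rw [e2, e1]
      rcases eq_or_ne x w with rfl | hxw
      · rw [e2', e2']
      rw [e3 x hxu hxs hxw, e3, h.inv]
      · exact fun e => hxw ((h.injective c) (e.trans hw'.symm))
      · exact fun e => hxs ((h.injective c) (e.trans hs.symm))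
      · exact fun e => hxu ((h.injective c) (e.trans hw.symm))
    · rw [e4 c _ hc, e4 c _ hc, h.inv]
  · intro c x hx
    rcases eq_or_ne c a with rfl | hc
    · rcases eq_or_ne x u with rfl | hxu
      · rw [e1]; exact h.hadj
      rcases eq_or_ne x s with rfl | hxs
      · rw [e2]; exact h.hadj.symm
      rcases eq_or_ne x w with rfl | hxw
      · exact absurd e2' hx
      rw [e3 x hxu hxs hxw] at hx ⊢
      exact h.adj c x hx
    · rw [e4 c _ hc] at hx ⊢
      exact h.adj c x hx
  · have key : ∀ c x, c ≠ a → f' c x = f' a x → f' c x ≠ x → False := by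
      intro c x hc e hx
      rw [e4 c _ hc] at e hx
      rcases eq_or_ne x u with rfl | hxu
      · rw [e1] at e; exact h.hole c e
      rcases eq_or_ne x s with rfl | hxs
      · rw [e2] at e; exact h.hole' c e
      rcases eq_or_ne x w with rfl | hxw
      · rw [e2'] at e; exact hx e
      rw [e3 x hxu hxs hxw] at e
      exact hc (h.inj c a x e hx)
    intro c d x e hx
    by_cases hc : c = a <;> by_cases hd : d = a
    · rw [hc, hd]
    · subst hc; exact (key d x hd e.symm (e ▸ hx)).elim
    · subst hd; exact (key c x hc e hx).elim
    · rw [e4 c _ hc, e4 d _ hd] at e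
      rw [e4 c _ hc] at hx
      exact h.inj c d x e hx
  · intro c hc
    rcases eq_or_ne c a with rfl | hca
    · rw [e1] at hc; exact hws hc.symm
    · rw [e4 c _ hca] at hc
      exact hca (h.inj c a u (hc.trans hw.symm) (hc ▸ hwu))
  · intro x y hxy n1 n2
    by_cases h1 : x = u ∧ y = s
    · obtain ⟨rfl, rfl⟩ := h1; exact ⟨a, e1⟩
    by_cases h2 : x = s ∧ y = u
    · obtain ⟨rfl, rfl⟩ := h2; exact ⟨a, e2⟩
    obtain ⟨c, rfl⟩ := h.surj x y hxy h1 h2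
    refine ⟨c, ?_⟩
    rcases eq_or_ne c a with rfl | hc
    · refine e3 x ?_ ?_ ?_
      · rintro rfl; exact n1 ⟨rfl, hw⟩
      · rintro rfl; exact hxy.ne hs.symm
      · rintro rfl; exact n2 ⟨rfl, hw'⟩
    · exact e4 c x hc

theorem fan_moveHole (h : IsCol G u s f) {a : Fin D} {w : V} (hs : f a s = s)
    (hw : f a u = w) (hwu : w ≠ u) : Fan (moveHole f u s w a) u w = Fan f u s := by
  have hne := h.ne
  have hws : w ≠ s := hw ▸ h.hole a
  have hwF : w ∈ Fan f u s := fan_step (self_mem_fan f u s) hs hw hwu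
  ext z
  constructor
  · intro hz
    induction hz with
    | refl => exact hwF
    | @tail p q _ hpq ih =>
      obtain ⟨b, hb, hq, hqu⟩ := hpq
      rcases eq_or_ne b a with rfl | hba
      · rw [moveHole_center] at hq
        exact hq ▸ self_mem_fan f u s
      · rw [moveHole_of_ne hba] at hb hq
        exact fan_step ih hb hq hqu
  · intro hz
    induction hz with
    | refl =>
      exact fan_step (self_mem_fan _ u w) (moveHole_new hwu hws) moveHole_center hne.symm
    | @tail p q _ hpq ih =>
      obtain ⟨b, hb, hq, hqu⟩ := hpq
      rcases eq_or_ne b a with rfl | hba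
      · rw [hw] at hq
        exact hq ▸ self_mem_fan _ u w
      · refine fan_step (a := b) ih ?_ ?_ hqu <;> rwa [moveHole_of_ne hba]

/-- The hole can be moved to any vertex of the fan, by shifting colors along a path of the fan. -/
theorem exists_moveHole [Finite V] (h : IsCol G u s f) {y : V} (hy : y ∈ Fan f u s) :
    ∃ f' : Fin D → V → V, IsCol G u y f' ∧ Fan f' u y = Fan f u s ∧
      (∀ a, (∃ x ∈ Fan f u s, f' a x = x) ↔ ∃ x ∈ Fan f u s, f a x = x) ∧
      (∀ a, f' a u = u ↔ f a u = u) ∧ (∀ a, f a y = y → f' a y = y) ∧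
      (∀ x, x ≠ u → x ∉ Fan f u s → ∀ a, f' a x = f a x) ∧
      (∀ x, x ≠ u → x ≠ y → (∀ a, f a x ≠ x) → ∀ a, f' a x = f a x) := by
  have main : ∀ n : ℕ, ∀ (Z : Set V) (s : V) (f : Fin D → V → V), Z.ncard = n → IsCol G u s f →
      ReflTransGen (ArcIn f u Z) s y →
      ∃ f' : Fin D → V → V, IsCol G u y f' ∧ Fan f' u y = Fan f u s ∧
      (∀ a, (∃ x ∈ Fan f u s, f' a x = x) ↔ ∃ x ∈ Fan f u s, f a x = x) ∧
      (∀ a, f' a u = u ↔ f a u = u) ∧ (∀ a, f a y = y → f' a y = y) ∧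
      (∀ x, x ≠ u → x ∉ Fan f u s → ∀ a, f' a x = f a x) ∧
      (∀ x, x ≠ u → x ≠ y → (∀ a, f a x ≠ x) → ∀ a, f' a x = f a x) := by
    intro n
    induction n using Nat.strong_induction_on with
    | _ n ih =>
    intro Z s f hn h hy
    rcases eq_or_ne s y with rfl | hsy
    · exact ⟨f, h, rfl, fun _ => .rfl, fun _ => .rfl, fun _ => id, fun _ _ _ _ => rfl,
        fun _ _ _ _ _ => rfl⟩
    rcases ReflTransGen.cases_head hy with e | ⟨w, ⟨⟨a, hs, hw, hwu⟩, hwZ⟩, hwy⟩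
    · exact absurd e hsy
    have hws : w ≠ s := hw ▸ h.hole a
    have hne := h.ne
    have h1 := h.moveHole hs hw hwu
    have hF := h.fan_moveHole hs hw hwu
    set f1 := moveHole f u s w a with hf1
    have hlt : (Z \ {w}).ncard < n := by
      rw [← hn]
      exact Set.ncard_lt_ncard ⟨Set.sdiff_subset, fun hh => (hh hwZ).2 rfl⟩ (Set.toFinite _)
    have hwy1 : ReflTransGen (ArcIn f1 u (Z \ {w})) w y := by
      refine rtg_mono ?_ (rtg_drop_loops hwy)
      rintro p q ⟨⟨⟨b, hb, hq, hqu⟩, hqZ⟩, hqw⟩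
      have hba : b ≠ a := fun e => hqw (by rw [← hq, e, hw])
      exact ⟨⟨b, by rwa [hf1, moveHole_of_ne hba], by rwa [hf1, moveHole_of_ne hba], hqu⟩, hqZ, hqw⟩
    obtain ⟨f', i1, i2, i3, i4, i5, i6, i7⟩ := ih _ hlt _ w f1 rfl h1 hwy1
    have hwF : w ∈ Fan f u s := fan_step (self_mem_fan f u s) hs hw hwu
    refine ⟨f', i1, i2.trans hF, ?_, ?_, ?_, ?_, ?_⟩
    · intro b
      rw [← hF, i3 b, hF]
      rcases eq_or_ne b a with rfl | hba
      · exact ⟨fun _ => ⟨s, self_mem_fan _ _ _, hs⟩, fun _ => ⟨w, hwF, moveHole_new hwu hws⟩⟩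
      · simp only [hf1, moveHole_of_ne hba]
    · intro b
      rw [i4 b]
      rcases eq_or_ne b a with rfl | hba
      · rw [hf1, moveHole_center, hw]
        exact ⟨fun e => absurd e hne.symm, fun e => absurd e hwu⟩
      · rw [hf1, moveHole_of_ne hba]
    · intro b hb
      refine i5 b ?_
      rcases eq_or_ne b a with rfl | hba
      · rcases eq_or_ne y w with rfl | hyw
        · exact moveHole_new hwu hws
        · have hyu : y ≠ u := by
            have hyF : y ∈ Fan f1 u w := rtg_mono (fun _ _ hh => hh.1) hwy1
            exact h1.ne_of_mem_fan hyF
          rw [hf1, moveHole_other hyu hsy.symm hyw, hb]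
      · rwa [hf1, moveHole_of_ne hba]
    · intro x hxu hx b
      rw [i6 x hxu (by rwa [hF]) b, hf1, moveHole_other hxu]
      · rintro rfl; exact hx (self_mem_fan _ _ _)
      · rintro rfl; exact hx hwF
    · intro x hxu hxy hx b
      have hxs : x ≠ s := by rintro rfl; exact hx a hs
      have hxw : x ≠ w := by
        rintro rfl
        rcases ReflTransGen.cases_head hwy with e | ⟨q, ⟨⟨c, hc, _⟩, _⟩, _⟩
        · exact hxy e
        · exact hx c hc
      have : ∀ b, f1 b x = f b x := fun b => moveHole_other hxu hxs hxw
      rw [i7 x hxu hxy (fun b => by rw [this]; exact hx b) b, this]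
  refine main _ Set.univ s f rfl h (rtg_mono ?_ hy)
  exact fun p q hpq => ⟨hpq, trivial⟩

end IsCol

/-- The colorings `f` and `f'` have the same fan, with the same missing colors and the same arcs
in it. -/
structure FEq (u s : V) (f f' : Fin D → V → V) : Prop where
  miss : ∀ y ∈ Fan f u s, ∀ a, f' a y = y ↔ f a y = y
  arc : ∀ y ∈ Fan f u s, ∀ a, f a y = y → f' a u = f a u

namespace FEq

theorem refl (u s : V) (f : Fin D → V → V) : FEq u s f f := ⟨fun _ _ _ => .rfl, fun _ _ _ _ => rfl⟩

theorem fan_eq (e : FEq u s f f') : Fan f' u s = Fan f u s := by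
  have h1 : Fan f u s ⊆ Fan f' u s := by
    intro z hz
    induction hz with
    | refl => exact self_mem_fan _ _ _
    | tail hp hpq ih =>
      obtain ⟨b, hb, hq, hqu⟩ := hpq
      exact fan_step ih ((e.miss _ hp b).2 hb) ((e.arc _ hp b hb).trans hq) hqu
  refine Set.Subset.antisymm ?_ h1
  intro z hz
  induction hz with
  | refl => exact self_mem_fan _ _ _
  | tail hp hpq ih =>
    obtain ⟨b, hb, hq, hqu⟩ := hpq
    have hb' := (e.miss _ ih b).1 hb
    exact fan_step ih hb' ((e.arc _ ih b hb').symm.trans hq) hqu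

theorem symm (e : FEq u s f f') : FEq u s f' f := by
  constructor
  · intro y hy a
    rw [e.fan_eq] at hy
    exact (e.miss y hy a).symm
  · intro y hy a ha
    rw [e.fan_eq] at hy
    exact (e.arc y hy a ((e.miss y hy a).1 ha)).symm

theorem trans (e : FEq u s f f') (e' : FEq u s f' f'') : FEq u s f f'' := by
  constructor
  · intro y hy a
    rw [e'.miss y (e.fan_eq ▸ hy), e.miss y hy]
  · intro y hy a ha
    rw [e'.arc y (e.fan_eq ▸ hy) a ((e.miss y hy a).2 ha), e.arc y hy a ha]

end FEq

/-- Exchanges along Kempe chains that avoid the center and have no end in the fan do not change the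
fan. -/
theorem feq_kswap {a b : Fin D} {S : Set V} (hu : u ∉ S)
    (hS : ∀ y ∈ S, y ∈ Fan f u s → f a y ≠ y ∧ f b y ≠ y) : FEq u s f (kswap f a b S) := by
  constructor
  · intro y hy c
    by_cases hyS : y ∈ S
    · have := hS y hyS hy
      by_cases hca : c = a
      · subst hca; rw [kswap_left hyS]; exact ⟨fun e => absurd e this.2, fun e => absurd e this.1⟩
      by_cases hcb : c = b
      · subst hcb; rw [kswap_right hyS]; exact ⟨fun e => absurd e this.1, fun e => absurd e this.2⟩
      rw [kswap_of_ne hca hcb]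
    · rw [kswap_of_notMem hyS]
  · intro y _ c _
    rw [kswap_of_notMem hu]

namespace IsCol

/-- Otherwise the hole could be moved to `y`, and the missing edge could be colored. -/
theorem fan_not_center_miss [Finite V] (h : IsCol G u s f) (hno : ∀ f : Fin D → V → V, ¬ IsFull G f)
    {o : Fin D} (ho : f o u = u) {y : V} (hy : y ∈ Fan f u s) : f o y ≠ y := by
  intro hoy
  obtain ⟨f', h1, -, -, h2, h3, -⟩ := h.exists_moveHole hy
  obtain ⟨f'', h4⟩ := h1.exists_full ((h2 o).2 ho) (h3 o hoy)
  exact hno f'' h4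

/-- Otherwise the exchange along the chain of `y` would make `y` miss the color `o`, while `y` would
still be in the fan. -/
theorem fan_linked [Finite V] (h : IsCol G u s f) (hno : ∀ f : Fin D → V → V, ¬ IsFull G f)
    {o c : Fin D} (ho : f o u = u) {y : V} (hy : y ∈ Fan f u s) (hc : f c y = y) :
    y ∈ comp f o c u := by
  by_contra hcon
  have hco : c ≠ o := by rintro rfl; exact h.fan_not_center_miss hno ho hy hc
  set S := comp f o c y with hS
  have huS : u ∉ S := fun hu => hcon (h.comp_symm hu)
  set f1 := kswap f o c S with hf1
  have h1 : IsCol G u s f1 := h.kswap (comp_closed f o c y)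
  have ho1 : f1 o u = u := by rw [hf1, kswap_of_notMem huS, ho]
  have bad : ∀ z ∈ Fan f1 u s, f1 o z ≠ z := fun z hz => h1.fan_not_center_miss hno ho1 hz
  have key : Fan f u s ⊆ Fan f1 u s := by
    intro z hz
    induction hz with
    | refl => exact self_mem_fan _ _ _
    | @tail p q hp hpq ih =>
      obtain ⟨b, hb, hq, hqu⟩ := hpq
      have hbo : b ≠ o := by rintro rfl; exact h.fan_not_center_miss hno ho hp hb
      refine fan_step (a := b) ih ?_ (by rw [hf1, kswap_of_notMem huS, hq]) hqu
      by_cases hpS : p ∈ S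
      · rcases eq_or_ne b c with rfl | hbc
        · exact absurd (by rw [hf1, kswap_left hpS, hb]) (bad p ih)
        · rw [hf1, kswap_of_ne hbo hbc, hb]
      · rw [hf1, kswap_of_notMem hpS, hb]
  exact bad y (key hy) (by rw [hf1, kswap_left (mem_comp_self f o c y), hc])

/-- The missing color sets of the vertices of the fan are disjoint. -/
theorem fan_elementary [Finite V] (h : IsCol G u s f) (hno : ∀ f : Fin D → V → V, ¬ IsFull G f)
    {o c : Fin D} (ho : f o u = u) {y z : V} (hy : y ∈ Fan f u s) (hz : z ∈ Fan f u s)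
    (hcy : f c y = y) (hcz : f c z = z) : y = z :=
  h.two_ends ho (h.fan_linked hno ho hy hcy) (h.fan_linked hno ho hz hcz) (.inr hcy) (.inr hcz)
    (h.ne_of_mem_fan hy) (h.ne_of_mem_fan hz)

variable [Fintype V]

/-- Each vertex of the fan other than the hole is the target of exactly one arc. -/
theorem card_fan (h : IsCol G u s f) (hno : ∀ f : Fin D → V → V, ¬ IsFull G f)
    {o : Fin D} (ho : f o u = u) :
    ∑ y ∈ Finset.univ.filter (· ∈ Fan f u s), (miss f y).card + 1 =
      (Finset.univ.filter (· ∈ Fan f u s)).card := by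
  rw [← Finset.card_erase_add_one (s := Finset.univ.filter (· ∈ Fan f u s)) (a := s)
    (by simpa using self_mem_fan f u s), ← Finset.card_sigma]
  congr 1
  refine Finset.card_bij (fun p _ => f p.2 u) ?_ ?_ ?_
  · rintro ⟨y, a⟩ hp
    simp only [Finset.mem_sigma, Finset.mem_filter, Finset.mem_univ, true_and, mem_miss] at hp
    have hau : f a u ≠ u := fun e => h.fan_not_center_miss hno e hp.1 hp.2
    simp only [Finset.mem_erase, Finset.mem_filter, Finset.mem_univ, true_and]
    exact ⟨h.hole a, fan_step hp.1 hp.2 rfl hau⟩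
  · rintro ⟨y, a⟩ hp ⟨z, b⟩ hq e
    simp only [Finset.mem_sigma, Finset.mem_filter, Finset.mem_univ, true_and, mem_miss] at hp hq e
    have hau : f a u ≠ u := fun e => h.fan_not_center_miss hno e hp.1 hp.2
    obtain rfl := h.inj a b u e hau
    obtain rfl := h.fan_elementary hno ho hp.1 hq.1 hp.2 hq.2
    rfl
  · intro z hz
    simp only [Finset.mem_erase, Finset.mem_filter, Finset.mem_univ, true_and] at hz
    obtain ⟨p, hp, a, ha, hz', -⟩ := exists_arc_of_mem_fan hz.2 hz.1
    exact ⟨⟨p, a⟩, by simp [hp, ha], hz'⟩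

variable [DecidableRel G.Adj]

/-- A fan contains many vertices of degree `D`: this is Vizing's adjacency lemma. -/
theorem fan_big (h : IsCol G u s f) (hno : ∀ f : Fin D → V → V, ¬ IsFull G f)
    {o : Fin D} (ho : f o u = u) :
    D + 1 ≤ G.degree s + ((Finset.univ.filter fun y => y ∈ Fan f u s ∧ y ≠ s ∧ G.degree y = D)).card := by
  have h1 := h.card_fan hno ho
  set F := Finset.univ.filter (· ∈ Fan f u s) with hF
  have hsF : s ∈ F := by simpa [hF] using self_mem_fan f u s
  have h2 := Finset.sum_erase_add F (fun y => (miss f y).card) hsF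
  have h3 : ((F.erase s).filter fun y => ¬ G.degree y = D).card ≤
      ∑ y ∈ F.erase s, (miss f y).card := by
    rw [Finset.card_eq_sum_ones, Finset.sum_filter]
    refine Finset.sum_le_sum fun y hy => ?_
    simp only [hF, Finset.mem_erase, Finset.mem_filter, Finset.mem_univ, true_and] at hy
    have := h.card_miss (h.ne_of_mem_fan hy.2) hy.1
    split_ifs <;> omega
  have h4 := Finset.card_filter_add_card_filter_not (s := F.erase s) (fun y => G.degree y = D)
  have h5 : (F.erase s).filter (fun y => G.degree y = D) =
      Finset.univ.filter fun y => y ∈ Fan f u s ∧ y ≠ s ∧ G.degree y = D := by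
    ext y; simp [hF]; tauto
  have h6 := Finset.card_erase_add_one hsF
  have h7 := h.card_miss_hole
  rw [h5] at h4
  omega

end IsCol

end

/-! ### Vertices outside the fan and rotations -/

section

variable {V : Type*} {D : ℕ} {G : SimpleGraph V} {u s : V} {f f' f'' : Fin D → V → V}

/-- The color `a` is missing at the center or at some vertex of the fan. -/
def ACol (f : Fin D → V → V) (u s : V) (a : Fin D) : Prop :=
  f a u = u ∨ ∃ y ∈ Fan f u s, f a y = y

/-- The neighbors of the center outside the fan. A vertex of `Out G f u s` missing a color `a` with
`ACol f u s a` is called a token. -/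
def Out (G : SimpleGraph V) (f : Fin D → V → V) (u s : V) : Set V :=
  {y | G.Adj u y ∧ y ∉ Fan f u s}

theorem ne_of_mem_out {y : V} (hy : y ∈ Out G f u s) : y ≠ u := hy.1.ne'

theorem ne_fan_of_mem_out {y z : V} (hy : y ∈ Out G f u s) (hz : z ∈ Fan f u s) : y ≠ z :=
  fun e => hy.2 (e ▸ hz)

theorem FEq.out_eq (e : FEq u s f f') : Out G f' u s = Out G f u s := by
  simp only [Out, e.fan_eq]

theorem FEq.acol (e : FEq u s f f') (hu : ∀ a, f' a u = f a u) (a : Fin D) :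
    ACol f' u s a ↔ ACol f u s a := by
  unfold ACol
  rw [hu, e.fan_eq]
  exact or_congr_right (exists_congr fun y => and_congr_right fun hy => e.miss y hy a)

/-- Colors missing in the fan lead from the center into the fan. -/
theorem mem_fan_of_acol {a : Fin D} (ha : ACol f u s a) (hau : f a u ≠ u) : f a u ∈ Fan f u s := by
  rcases ha with h | ⟨y, hy, hay⟩
  · exact absurd h hau
  · exact fan_step hy hay rfl hau

namespace IsCol

theorem acol_of_mem_fan (h : IsCol G u s f) {a : Fin D} (ha : f a u ∈ Fan f u s) :
    ACol f u s a := by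
  obtain ⟨p, hp, b, hb, hq, hqu⟩ := exists_arc_of_mem_fan ha (h.hole a)
  obtain rfl := h.inj b a u hq (hq ▸ hqu)
  exact .inr ⟨p, hp, hb⟩

theorem kswap_pair (h : IsCol G u s f) {a b : Fin D} {x y : V} (hx : f a x = x) (hy : f a y = y)
    (hb : f b x = y) : IsCol G u s (kswap f a b {x, y}) := by
  refine h.kswap ?_
  have hb' := h.eq_iff.1 hb
  rintro z (rfl | rfl) <;> simp [*]

/-- Recolor the edge `u b` from `κ` to the color `o`, which `u` and `b` both miss. -/
theorem rotate_one (h : IsCol G u s f) {o κ : Fin D} {b : V} (ho : f o u = u) (hb : f o b = b)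
    (hκ : f κ u = b) (hbu : b ≠ u) :
    ∃ f' : Fin D → V → V, IsCol G u s f' ∧ f' κ u = u ∧ f' κ b = b ∧ f' o u = b ∧
      (∀ y, y ≠ u → y ≠ b → ∀ a, f' a y = f a y) ∧ (∀ a, a ≠ o → a ≠ κ → ∀ y, f' a y = f a y) := by
  have hκ' : f κ b = u := h.eq_iff.1 hκ
  have hu : u ∈ ({u, b} : Set V) := by simp
  have hb' : b ∈ ({u, b} : Set V) := by simp
  refine ⟨kswap f o κ {u, b}, h.kswap ?_, ?_, ?_, ?_, ?_, ?_⟩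
  · rintro x (rfl | rfl) <;> simp [*]
  · rw [kswap_right hu, ho]
  · rw [kswap_right hb', hb]
  · rw [kswap_left hu, hκ]
  · intro y h1 h2 a
    rw [kswap_of_notMem (by simp [h1, h2])]
  · intro a h1 h2 y
    rw [kswap_of_ne h1 h2]

/-- If `u` and `b` miss `o` and there is a path of arcs from `w` to `b` in `Z`, then colors can be
shifted along this path, so that the color of `u w` becomes missing at the center. -/
theorem exists_rotate [Finite V] (h : IsCol G u s f) {o κ : Fin D} (ho : f o u = u) {Z : Set V}
    (hZ : u ∉ Z) {w b : V} (hwZ : w ∈ Z) (hκ : f κ u = w) (hb : f o b = b)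
    (hp : ReflTransGen (ArcIn f u Z) w b) :
    ∃ f' : Fin D → V → V, IsCol G u s f' ∧ f' κ u = u ∧
      ∀ y, y ≠ u → (y ∉ Z ∨ ∀ a, f a y ≠ y) → ∀ a, f' a y = f a y := by
  have main : ∀ n : ℕ, ∀ (Z : Set V) (b : V) (o : Fin D) (f : Fin D → V → V), Z.ncard = n →
      IsCol G u s f → f o u = u → u ∉ Z → w ∈ Z → f κ u = w → f o b = b →
      ReflTransGen (ArcIn f u Z) w b → ∃ f' : Fin D → V → V, IsCol G u s f' ∧ f' κ u = u ∧
      ∀ y, y ≠ u → (y ∉ Z ∨ ∀ a, f a y ≠ y) → ∀ a, f' a y = f a y := by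
    intro n
    induction n using Nat.strong_induction_on with
    | _ n ih =>
    intro Z b o f hn h ho hZ hwZ hκ hb hp
    have hwu : w ≠ u := fun e => hZ (e ▸ hwZ)
    rcases rtg_first_hit hp (Set.mem_singleton b) with hwb | ⟨hwb, p, b', hb', hpb, hwp, hpb'⟩
    · obtain rfl : w = b := hwb
      obtain ⟨f', h1, h2, -, -, h3, -⟩ := h.rotate_one ho hb hκ hwu
      refine ⟨f', h1, h2, fun y hyu hy a => h3 y hyu ?_ a⟩
      rintro rfl
      exact hy.elim (fun hh => hh hwZ) (fun hh => hh o hb)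
    · obtain rfl : b' = b := hb'
      obtain ⟨⟨κ', hκp, hκu, hbu⟩, hbZ⟩ := hpb'
      have hpu : p ≠ u := by
        rintro rfl; exact hbu (hκu.symm.trans hκp)
      obtain ⟨f1, h1, h2, -, -, h3, h4⟩ := h.rotate_one ho hb hκu hbu
      have hlt : (Z \ {b'}).ncard < n := by
        rw [← hn]
        exact Set.ncard_lt_ncard ⟨Set.sdiff_subset, fun hh => (hh hbZ).2 rfl⟩ (Set.toFinite _)
      have key : ∀ e, f e u ≠ u → f e u ≠ b' → ∀ y, f1 e y = f e y := by
        intro e e1 e2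
        exact h4 e (by rintro rfl; exact e1 ho) (by rintro rfl; exact e2 hκu)
      have hwp1 : ReflTransGen (ArcIn f1 u (Z \ {b'})) w p := by
        refine rtg_mono ?_ hwp
        rintro x z ⟨⟨⟨e, he, hez, hzu⟩, hzZ⟩, hzb⟩
        have := key e (hez ▸ hzu) (hez ▸ hzb)
        exact ⟨⟨e, by rw [this, he], by rw [this, hez], hzu⟩, hzZ, hzb⟩
      obtain ⟨f', i1, i2, i3⟩ := ih _ hlt (Z \ {b'}) p κ' f1 rfl h1 h2 (fun hh => hZ hh.1)
        ⟨hwZ, hwb⟩ (by rw [key κ (hκ ▸ hwu) (hκ ▸ hwb), hκ]) (by rw [h3 p hpu hpb, hκp]) hwp1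
      refine ⟨f', i1, i2, fun y hyu hy a => ?_⟩
      have hyb : y ≠ b' := by
        rintro rfl
        exact hy.elim (fun hh => hh hbZ) (fun hh => hh o hb)
      have h5 : ∀ a, f1 a y = f a y := h3 y hyu hyb
      rw [i3 y hyu (hy.imp (fun hh hz => hh hz.1) (fun hh c => by rw [h5]; exact hh c)), h5]
  exact main _ Z b o f rfl h ho hZ hwZ hκ hb hp

end IsCol

section
variable [Finite V] (hno : ∀ f : Fin D → V → V, ¬ IsFull G f)
include hno

namespace IsCol

/-- A recoloring that is the identity at the vertices of the fan does not change the fan. -/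
theorem feq_of_eqOn (h : IsCol G u s f) (h' : IsCol G u s f')
    (e : ∀ y ∈ Fan f u s, ∀ a, f' a y = f a y) : FEq u s f f' := by
  constructor
  · intro y hy a
    rw [e y hy]
  · intro y hy a ha
    have hau : f a u ≠ u := fun hh => h.fan_not_center_miss hno hh hy ha
    have := e _ (fan_step hy ha rfl hau) a
    rw [h.inv] at this
    exact h'.eq_iff.1 this

/-- With `o` missing at the center, an exchange of `o` and `c` off the chain of the center does not
change the fan, since all ends in the fan are on the chain of the center. -/
theorem feq_kswap_comp (h : IsCol G u s f) {o c : Fin D} (ho : f o u = u) {b : V}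
    (hb : b ∉ comp f o c u) : FEq u s f (kswap f o c (comp f o c b)) := by
  have hu : u ∉ comp f o c b := fun hh => hb (h.comp_symm hh)
  refine feq_kswap hu fun y hy hyF => ⟨h.fan_not_center_miss hno ho hyF, fun hc => hb ?_⟩
  exact comp_trans (h.fan_linked hno ho hyF hc) (h.comp_symm hy)

/-- The chain of the center ends at the vertex `y` of the fan, hence not at `b`. -/
theorem notMem_comp (h : IsCol G u s f) {o c : Fin D} (ho : f o u = u) {y b : V}
    (hy : y ∈ Fan f u s) (hcy : f c y = y) (hby : b ≠ y) (hbu : b ≠ u)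
    (hb : f o b = b ∨ f c b = b) : b ∉ comp f o c u := fun hh =>
  hby (h.two_ends ho hh (h.fan_linked hno ho hy hcy) hb (.inr hcy) hbu (h.ne_of_mem_fan hy))

/-- An exchange makes the token `v` miss the color `o` that is missing at the center. -/
theorem exists_token_center (h : IsCol G u s f) {o c : Fin D} (ho : f o u = u)
    (hou : ∀ a, f a u = u → a = o) {v : V}
    (hvF : v ∉ Fan f u s) (hvu : v ≠ u) (hc : f c v = v) (hcA : ACol f u s c) :
    ∃ f' : Fin D → V → V, IsCol G u s f' ∧ FEq u s f f' ∧ (∀ a, f' a u = f a u) ∧ f' o v = v ∧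
      (∀ a, a ≠ o → a ≠ c → ∀ y, f' a y = f a y) ∧
      (∀ y, f o y = v → y ≠ v → f' c y = v) := by
  rcases eq_or_ne c o with rfl | hco
  · refine ⟨f, h, .refl _ _ _, fun _ => rfl, hc, fun _ _ _ _ => rfl, ?_⟩
    intro y hy hyv
    exact absurd (h.injective c (hy.trans hc.symm)) hyv
  rcases hcA with hcu | ⟨y0, hy0, hcy0⟩
  · exact absurd (hou c hcu) hco
  have hv : v ∉ comp f o c u := h.notMem_comp hno ho hy0 hcy0 (fun e => hvF (e ▸ hy0)) hvu (.inr hc)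
  have hu : u ∉ comp f o c v := fun hh => hv (h.comp_symm hh)
  have h1 := h.kswap (comp_closed f o c v)
  refine ⟨_, h1, h.feq_kswap_comp hno ho hv, fun a => kswap_of_notMem hu, ?_, ?_, ?_⟩
  · rw [kswap_left (mem_comp_self _ _ _ _), hc]
  · intro a h1 h2 y; rw [kswap_of_ne h1 h2]
  · intro y hy _
    rw [← h1.eq_iff, kswap_right (mem_comp_self _ _ _ _)]
    exact h.eq_iff.1 hy

end IsCol
end

end

/-! ### Recoloring an edge between the fan and a token -/

section

variable {V : Type*} {D : ℕ} {G : SimpleGraph V} {u s : V} {f f' f'' : Fin D → V → V}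
variable [Fintype V]

/-- The edge `x v` of color `σ` can be recolored so that `σ` becomes missing at the hole `x` and
at the vertex `v`, while a prescribed vertex `x'` of the fan stays in the fan. -/
theorem IsCol.exists_recolor_at {x x' v : V} (h : IsCol G u x f)
    (hno : ∀ f : Fin D → V → V, ¬ IsFull G f) {o σ : Fin D} (ho : f o u = u)
    (hvF : v ∉ Fan f u x) (hvu : v ≠ u) (hov : f o v = v) (hσ : f σ x = v)
    (hx2 : 2 ≤ (miss f x).card) (hx' : x' ∈ Fan f u x) :
    ∃ f' : Fin D → V → V, IsCol G u x f' ∧ (∀ a, f' a u = f a u) ∧ f' σ x = x ∧ f' σ v = v ∧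
      x' ∈ Fan f' u x ∧ (x' ≠ x → ∀ a, f a x' = x' → f' a x' = x') ∧
      (∀ a, a ≠ σ → ¬ ACol f u x a → ∀ y, f' a y = f a y) ∧
      (∀ y, y ≠ x → y ≠ v → f' σ y = f σ y) := by
  have hxF := self_mem_fan f u x
  have hvx : v ≠ x := fun e => hvF (e ▸ hxF)
  -- a missing color `c` of `x` that is not used by the first arc of a path from `x` to `x'`
  obtain ⟨c, hcx, hc⟩ : ∃ c, f c x = x ∧ (x' = x ∨ ∃ w' e, e ≠ c ∧ f e x = x ∧ f e u = w' ∧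
      w' ≠ u ∧ ReflTransGen (Arc f u) w' x') := by
    rcases ReflTransGen.cases_head hx' with e | ⟨w', ⟨e, he, hw', hwu⟩, hr⟩
    · obtain ⟨c, hc⟩ := Finset.card_pos.1 (by omega : 0 < (miss f x).card)
      exact ⟨c, mem_miss.1 hc, .inl e.symm⟩
    · obtain ⟨c, hc, hce⟩ := Finset.exists_mem_ne (by omega : 1 < (miss f x).card) e
      exact ⟨c, mem_miss.1 hc, .inr ⟨w', e, hce.symm, he, hw', hwu, hr⟩⟩
  have hσc : σ ≠ c := by rintro rfl; exact hvx (hσ.symm.trans hcx)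
  have hσo : σ ≠ o := by
    rintro rfl
    exact hvx (hov.symm.trans (h.eq_iff.1 hσ))
  have hco : c ≠ o := by rintro rfl; exact h.fan_not_center_miss hno ho hxF hcx
  have hvS : v ∉ comp f o c u := h.notMem_comp hno ho hxF hcx hvx hvu (.inl hov)
  have huS : u ∉ comp f o c v := fun hh => hvS (h.comp_symm hh)
  have hxS : x ∉ comp f o c v := fun hh =>
    hvS (comp_trans (h.fan_linked hno ho hxF hcx) (h.comp_symm hh))
  have h2 := h.kswap (comp_closed f o c v)
  have e2 := h.feq_kswap_comp hno ho hvS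
  set f2 := kswap f o c (comp f o c v) with hf2
  have hcv2 : f2 c v = v := by rw [hf2, kswap_right (mem_comp_self _ _ _ _), hov]
  have hcx2 : f2 c x = x := by rw [hf2, kswap_of_notMem hxS, hcx]
  have hσx2 : f2 σ x = v := by rw [hf2, kswap_of_ne hσo hσc, hσ]
  have hσv2 : f2 σ v = x := h2.eq_iff.1 hσx2
  have hux : u ≠ x := h.ne
  have hu3 : u ∉ ({x, v} : Set V) := by simp [hux, hvu.symm]
  have hx3 : x ∈ ({x, v} : Set V) := by simp
  have hv3 : v ∈ ({x, v} : Set V) := by simp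
  have h3 : IsCol G u x (kswap f2 c σ {x, v}) := h2.kswap_pair hcx2 hcv2 hσx2
  have hu' : ∀ a, kswap f2 c σ {x, v} a u = f a u := by
    intro a
    rw [kswap_of_notMem hu3, hf2, kswap_of_notMem huS]
  have hstay : ∀ y, y ≠ x → y ≠ v → ∀ a, kswap f2 c σ {x, v} a y = f2 a y := fun y h1 h2 a =>
    kswap_of_notMem (by simp [h1, h2])
  refine ⟨_, h3, hu', ?_, ?_, ?_, ?_, ?_, ?_⟩
  · rw [kswap_right hx3, hcx2]
  · rw [kswap_right hv3, hcv2]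
  · rcases hc with rfl | ⟨w', e, hec, hex, hew, hwu, hr⟩
    · exact self_mem_fan _ _ _
    have hw'x : w' ≠ x := hew ▸ h.hole e
    have hw'F : w' ∈ Fan f u x := fan_step hxF hex hew hwu
    have heσ : e ≠ σ := by rintro rfl; exact hvx (hσ.symm.trans hex)
    have hw'3 : w' ∈ Fan (kswap f2 c σ {x, v}) u x := by
      refine fan_step (a := e) (self_mem_fan _ _ _) ?_ (by rw [hu', hew]) hwu
      rw [kswap_of_ne hec heσ]
      exact (e2.miss x hxF e).2 hex
    have : ∀ y, ReflTransGen (Arc f u) w' y → y ∈ Fan f u x ∧ y ≠ x ∧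
        y ∈ Fan (kswap f2 c σ {x, v}) u x := by
      intro y hy
      induction hy with
      | refl => exact ⟨hw'F, hw'x, hw'3⟩
      | @tail p q _ hpq ih =>
        obtain ⟨i1, i2, i3⟩ := ih
        refine ⟨i1.tail hpq, h.arc_ne_hole hpq, ?_⟩
        obtain ⟨b, hb, hq, hqu⟩ := hpq
        refine fan_step i3 (a := b) ?_ (by rw [hu', hq]) hqu
        rw [hstay p i2 (fun e => hvF (e ▸ i1))]
        exact (e2.miss p i1 b).2 hb
    exact (this x' hr).2.2
  · intro hxx a ha
    rw [hstay x' hxx (fun e => hvF (e ▸ hx'))]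
    exact (e2.miss x' hx' a).2 ha
  · intro a ha haA y
    have hao : a ≠ o := by rintro rfl; exact haA (.inl ho)
    have hac : a ≠ c := by rintro rfl; exact haA (.inr ⟨x, hxF, hcx⟩)
    rw [kswap_of_ne hac ha, hf2, kswap_of_ne hao hac]
  · intro y h1 h2
    rw [hstay y h1 h2, hf2, kswap_of_ne hσo hσc]

variable [DecidableRel G.Adj]

namespace IsCol

theorem exists_center (h : IsCol G u s f) (hdu : G.degree u = D) :
    ∃ o, f o u = u ∧ ∀ a, f a u = u → a = o := by
  have h1 := h.card_miss_center
  have : (miss f u).card = 1 := by omega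
  obtain ⟨o, ho⟩ := Finset.card_eq_one.1 this
  refine ⟨o, ?_, fun a ha => ?_⟩
  · rw [← mem_miss, ho]; simp
  · simpa [ho] using mem_miss.2 ha

theorem center_unique (h : IsCol G u s f) (hdu : G.degree u = D) {o : Fin D} (ho : f o u = u) :
    ∀ a, f a u = u → a = o := by
  obtain ⟨o', -, h2⟩ := h.exists_center hdu
  intro a ha
  rw [h2 a ha, h2 o ho]

end IsCol

section
variable (hno : ∀ f : Fin D → V → V, ¬ IsFull G f)
include hno

namespace IsCol

/-- The hole can be moved to `x` while the token `v` is made to miss the color `o` that is missing at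
the center. The edge `x v` keeps its color `σ` unless `σ` is missing in the fan or at the center. -/
theorem exists_moveHole_token (h : IsCol G u s f) (hdu : G.degree u = D) {o c σ : Fin D}
    (ho : f o u = u) {x v : V} (hx : x ∈ Fan f u s) (hvF : v ∉ Fan f u s) (hvu : v ≠ u)
    (hc : f c v = v) (hcA : ACol f u s c) (hσ : f σ x = v) :
    ∃ (f1 : Fin D → V → V) (σ1 : Fin D), IsCol G u x f1 ∧ Fan f1 u x = Fan f u s ∧ f1 o u = u ∧
      f1 o v = v ∧ f1 σ1 x = v ∧ (ACol f u s σ → ACol f1 u x σ1) ∧ (¬ ACol f u s σ → σ1 = σ) ∧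
      (∀ a, ACol f1 u x a ↔ ACol f u s a) ∧
      (∀ a, ¬ ACol f u s a → ∀ y, y ∉ Fan f u s → y ≠ u → f1 a y = f a y) := by
  obtain ⟨f0, h0, hF0, hm0, hu0, -, hst0, -⟩ := h.exists_moveHole hx
  have hA0 : ∀ a, ACol f0 u x a ↔ ACol f u s a := by
    intro a
    unfold ACol
    rw [hF0]
    exact or_congr (hu0 a) (hm0 a)
  have ho0 : f0 o u = u := (hu0 o).2 ho
  have hv0 : ∀ a, f0 a v = f a v := hst0 v hvu hvF
  have hσ0 : f0 σ x = v := by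
    rw [h0.eq_iff, hv0]; exact h.eq_iff.1 hσ
  have hvx : v ≠ x := fun e => hvF (e ▸ hx)
  obtain ⟨f1, h1, e1, hu1, hov, hoth, hch⟩ := h0.exists_token_center hno ho0
    (h0.center_unique hdu ho0) (hF0 ▸ hvF) hvu ((hv0 c).trans hc) ((hA0 c).2 hcA)
  have hA1 : ∀ a, ACol f1 u x a ↔ ACol f u s a := fun a => (e1.acol hu1 a).trans (hA0 a)
  have hoA : ACol f u s o := .inl ho
  have hσc : σ ≠ c := by rintro rfl; exact hvx (hc.symm.trans (h.eq_iff.1 hσ))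
  by_cases hσo : σ = o
  · refine ⟨f1, c, h1, e1.fan_eq.trans hF0, (hu1 o).trans ho0, hov,
      hch x (hσo ▸ hσ0) hvx.symm, fun _ => (hA1 c).2 hcA, fun hh => absurd (hσo ▸ hoA) hh, hA1, ?_⟩
    intro a ha y hy hyu
    rw [hoth a (by rintro rfl; exact ha hoA) (by rintro rfl; exact ha hcA), hst0 y hyu hy]
  · refine ⟨f1, σ, h1, e1.fan_eq.trans hF0, (hu1 o).trans ho0, hov,
      (hoth σ hσo hσc x).trans hσ0, (hA1 σ).2, fun _ => rfl, hA1, ?_⟩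
    intro a ha y hy hyu
    rw [hoth a (by rintro rfl; exact ha hoA) (by rintro rfl; exact ha hcA), hst0 y hyu hy]

/-- An edge from a vertex of small degree of the fan to a token has a color which is missing
neither at the center nor in the fan. -/
theorem not_acol_of_token (h : IsCol G u s f) (hdu : G.degree u = D) {c σ : Fin D}
    {x v : V} (hx : x ∈ Fan f u s) (hxD : G.degree x < D) (hvF : v ∉ Fan f u s) (hvu : v ≠ u)
    (hc : f c v = v) (hcA : ACol f u s c) (hσ : f σ x = v) : ¬ ACol f u s σ := by
  intro hσA
  obtain ⟨o, ho, -⟩ := h.exists_center hdu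
  obtain ⟨f1, σ1, h1, hF1, ho1, hov1, hσ1, hA, -, -, -⟩ :=
    h.exists_moveHole_token hno hdu ho hx hvF hvu hc hcA hσ
  have hvx : v ≠ x := fun e => hvF (e ▸ hx)
  rcases hA hσA with hu | ⟨x', hx', hσx'⟩
  · obtain rfl := h1.center_unique hdu ho1 σ1 hu
    exact hvx (hov1.symm.trans (h1.eq_iff.1 hσ1))
  · have hxx : x' ≠ x := by rintro rfl; exact hvx (hσ1.symm.trans hσx')
    have hm := h1.card_miss_hole
    obtain ⟨f2, h2, hu2, hσ2, -, hx2, hst, -, -⟩ := h1.exists_recolor_at hno ho1 (hF1 ▸ hvF) hvu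
      hov1 hσ1 (by omega) hx'
    exact hxx (h2.fan_elementary hno ((hu2 o).trans ho1) hx2 (self_mem_fan _ _ _)
      (hst hxx _ hσx') hσ2)

end IsCol
end

end

/-! ### Extremal fans -/

section

variable {V : Type*} {D : ℕ} {G : SimpleGraph V} {u s : V} {f f' f'' : Fin D → V → V}
variable [Fintype V] [DecidableRel G.Adj] {B : ℕ}

/-- The fan as a finite set. -/
noncomputable def fanFinset (f : Fin D → V → V) (u s : V) : Finset V :=
  Finset.univ.filter (· ∈ Fan f u s)

@[simp] theorem mem_fanFinset {y : V} : y ∈ fanFinset f u s ↔ y ∈ Fan f u s := by simp [fanFinset]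

variable (G) in
/-- The vertices of degree `D` in the fan. -/
noncomputable def bigFan (f : Fin D → V → V) (u s : V) : Finset V :=
  (fanFinset f u s).filter fun y => G.degree y = D

variable (G) in
/-- Fans are compared lexicographically: first by the number of vertices of degree `D`, then by the
number of all vertices. -/
noncomputable def weight (f : Fin D → V → V) (u s : V) : ℕ :=
  (Fintype.card V + 1) * (bigFan G f u s).card + (fanFinset f u s).card

variable (G) in
/-- Some neighbor of the center outside the fan misses a color that is missing in the fan or at the
center. -/
def HasToken (f : Fin D → V → V) (u s : V) : Prop :=
  ∃ v c, v ∈ Out G f u s ∧ f c v = v ∧ ACol f u s c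

/-- The standing assumptions: `G` has no edge coloring with `D` colors, the center has the maximum
degree `D` and the hole a smaller one, and `B` bounds the weights of the fans that have a token. -/
structure Extremal (D : ℕ) (G : SimpleGraph V) [DecidableRel G.Adj] (u s : V) (B : ℕ) : Prop where
  hno : ∀ f : Fin D → V → V, ¬ IsFull G f
  center : G.degree u = D
  hole : G.degree s < D
  le : ∀ x, G.degree x ≤ D
  max : ∀ f : Fin D → V → V, IsCol G u s f → HasToken G f u s → weight G f u s ≤ B

/-- A coloring whose fan has the extremal weight, and for which one of the missing colors of the hole
leads to a vertex of degree `D`. The latter vertex is a leaf of the fan since it misses no color. -/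
structure Good (G : SimpleGraph V) [DecidableRel G.Adj] (u s : V) (B : ℕ) (f : Fin D → V → V) :
    Prop where
  col : IsCol G u s f
  le_weight : B ≤ weight G f u s
  leaf : ∃ α, f α s = s ∧ f α u ≠ u ∧ G.degree (f α u) = D

theorem FEq.weight_eq (e : FEq u s f f') : weight G f' u s = weight G f u s := by
  simp only [weight, bigFan, fanFinset, e.fan_eq]

theorem Good.feq (h : Good G u s B f) (h' : IsCol G u s f') (e : FEq u s f f') :
    Good G u s B f' := by
  obtain ⟨α, h1, h2, h3⟩ := h.leaf
  have hs := self_mem_fan f u s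
  have h4 : f' α u = f α u := e.arc s hs α h1
  exact ⟨h', (e.weight_eq (G := G)).symm ▸ h.le_weight, α, (e.miss s hs α).2 h1, h4 ▸ h2, h4 ▸ h3⟩

theorem IsCol.miss_eq_empty (h : IsCol G u s f) {x : V} (hu : x ≠ u) (hx : G.degree x = D)
    (hs : G.degree s < D) (a : Fin D) : f a x ≠ x := by
  intro ha
  have := h.card_miss hu (by rintro rfl; omega)
  have h2 : 0 < (miss f x).card := Finset.card_pos.2 ⟨a, mem_miss.2 ha⟩
  omega

theorem IsCol.card_miss_congr (h : IsCol G u s f) (h' : IsCol G u s f') {x : V} (hu : x ≠ u) :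
    (miss f' x).card = (miss f x).card := by
  rcases eq_or_ne x s with rfl | hs
  · have := h.card_miss_hole
    have := h'.card_miss_hole
    omega
  · have := h.card_miss hu hs
    have := h'.card_miss hu hs
    omega

variable (E : Extremal D G u s B)
include E

/-- Recoloring an edge from the hole to a token keeps all of the fan except one leaf, so, by the
choice of the fan, the vertex gained is a vertex of maximum degree. -/
theorem Extremal.big_of_token (h : Good G u s B f) {w : V} {c τ : Fin D} (hw : w ∈ Out G f u s)
    (hc : f c w = w) (hcA : ACol f u s c) (hτ : f τ s = w) :
    f τ u ∈ Out G f u s ∧ G.degree (f τ u) = D := by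
  have hsF := self_mem_fan f u s
  have h0 := h.col
  obtain ⟨o, ho, hou⟩ := h0.exists_center E.center
  have hτA := h0.not_acol_of_token E.hno E.center hsF E.hole hw.2 (ne_of_mem_out hw) hc hcA hτ
  have hws : w ≠ s := ne_fan_of_mem_out hw hsF
  obtain ⟨f1, h1, e1, hu1, hov, hoth, -⟩ := h0.exists_token_center E.hno ho hou hw.2 (ne_of_mem_out hw) hc hcA
  have hτo : τ ≠ o := by rintro rfl; exact hτA (.inl ho)
  have hτc : τ ≠ c := by rintro rfl; exact hτA hcA
  have g1 := h.feq h1 e1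
  obtain ⟨α, hαs, hαu, hd⟩ := g1.leaf
  have hsF1 := self_mem_fan f1 u s
  have ho1 : f1 o u = u := (hu1 o).trans ho
  have hwF1 : w ∉ Fan f1 u s := e1.fan_eq ▸ hw.2
  have hτA1 : ¬ ACol f1 u s τ := fun hh => hτA ((e1.acol hu1 τ).1 hh)
  have hατ : τ ≠ α := by rintro rfl; exact hτA1 (.inr ⟨s, hsF1, hαs⟩)
  have hwS : w ∉ comp f1 o α u :=
    h1.notMem_comp E.hno ho1 hsF1 hαs hws (ne_of_mem_out hw) (.inl hov)
  have huS : u ∉ comp f1 o α w := fun hh => hwS (h1.comp_symm hh)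
  have h2 := h1.kswap (comp_closed f1 o α w)
  have e2 := h1.feq_kswap_comp E.hno ho1 hwS
  set f2 := kswap f1 o α (comp f1 o α w) with hf2
  have hu2 : ∀ a, f2 a u = f1 a u := fun a => kswap_of_notMem huS
  have e : FEq u s f f2 := e1.trans e2
  have hu : ∀ a, f2 a u = f a u := fun a => (hu2 a).trans (hu1 a)
  have hαw : f2 α w = w := by rw [hf2, kswap_right (mem_comp_self _ _ _ _), hov]
  have hαs2 : f2 α s = s := (e2.miss s hsF1 α).2 hαs
  have hτs : f2 τ s = w := by rw [hf2, kswap_of_ne hτo hατ, hoth τ hτo hτc, hτ]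
  have h3 := h2.kswap_pair hαs2 hαw hτs
  have hus := h0.ne
  have hu3 : ∀ a, kswap f2 α τ {s, w} a u = f a u := by
    intro a
    rw [kswap_of_notMem (by simp [hus, (ne_of_mem_out hw).symm]), hu]
  have hst : ∀ y, y ≠ s → y ≠ w → ∀ a, kswap f2 α τ {s, w} a y = f2 a y := fun y h1 h2 a =>
    kswap_of_notMem (by simp [h1, h2])
  have hτs3 : kswap f2 α τ {s, w} τ s = s := by rw [kswap_right (by simp), hαs2]
  have hτw3 : kswap f2 α τ {s, w} τ w = w := by rw [kswap_right (by simp), hαw]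
  have hs3 : ∀ a, a ≠ α → f2 a s = s → kswap f2 α τ {s, w} a s = s := by
    intro a ha has
    rw [kswap_of_ne ha, has]
    rintro rfl
    exact hws (hτs.symm.trans has)
  set f3 := kswap f2 α τ {s, w} with hf3
  set z := f τ u with hz
  have hzu : z ≠ u := fun e => hτo (hou τ e)
  have hzF : z ∉ Fan f u s := fun hh => hτA (h0.acol_of_mem_fan hh)
  have hzadj : G.Adj u z := h0.adj τ u hzu
  refine ⟨⟨hzadj, hzF⟩, ?_⟩
  have hsF3 := self_mem_fan f3 u s
  have hzF3 : z ∈ Fan f3 u s := fan_step hsF3 hτs3 (hu3 τ) hzu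
  -- `d` misses no color, so nothing of the fan is reached through it
  set d := f α u with hdd
  have hαd : f1 α u = d := hu1 α
  rw [hαd] at hαu hd
  have hdF : d ∈ Fan f u s := e1.fan_eq ▸ fan_step hsF1 hαs hαd hαu
  have hsub : ∀ y ∈ Fan f u s, y = d ∨ y ∈ Fan f3 u s := by
    intro y hy
    induction hy with
    | refl => exact .inr hsF3
    | @tail p q hp hpq ih =>
      obtain ⟨b, hb, hq, hqu⟩ := hpq
      by_cases hbα : b = α
      · left; rw [← hq, hbα]
      rcases ih with rfl | ih
      · exact absurd hb (h0.miss_eq_empty hαu hd E.hole b)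
      right
      refine fan_step (a := b) ih ?_ ((hu3 b).trans hq) hqu
      have hb2 : f2 b p = p := (e.miss p hp b).2 hb
      rcases eq_or_ne p s with rfl | hps
      · exact hs3 b hbα hb2
      · rw [hst p hps (fun e => hw.2 (e ▸ hp)), hb2]
  have ho3 : f3 o u = u := (hu3 o).trans ho
  have hwF3 : w ∉ Fan f3 u s := fun hh =>
    hws (h3.fan_elementary E.hno ho3 hh hsF3 hτw3 hτs3)
  have htok : HasToken G f3 u s := ⟨w, τ, ⟨hw.1, hwF3⟩, hτw3, .inr ⟨s, hsF3, hτs3⟩⟩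
  have hle := (E.max f3 h3 htok).trans h.le_weight
  -- compare the two fans
  set F := fanFinset f u s with hF
  set F3 := fanFinset f3 u s with hF3
  have hcardF : F3.card ≤ Fintype.card V := Finset.card_le_univ _
  have hcardF' : F.card ≤ Fintype.card V := Finset.card_le_univ _
  replace hle : (Fintype.card V + 1) * (bigFan G f3 u s).card + F3.card ≤
    (Fintype.card V + 1) * (bigFan G f u s).card + F.card := hle
  have hbig : (bigFan G f3 u s).card ≤ (bigFan G f u s).card := by
    by_contra hlt
    have : (Fintype.card V + 1) * ((bigFan G f u s).card + 1) ≤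
        (Fintype.card V + 1) * (bigFan G f3 u s).card := Nat.mul_le_mul_left _ (by omega)
    rw [mul_add] at this
    omega
  have hcard : (bigFan G f3 u s).card = (bigFan G f u s).card → F3.card ≤ F.card := by
    intro e
    rw [e] at hle
    omega
  -- otherwise the new fan contains the old one and also `z`, so its weight is larger
  have hdF3 : d ∉ F3 := by
    intro hdF3
    have hss : insert z F ⊆ F3 := by
      intro y hy
      rcases Finset.mem_insert.1 hy with rfl | hy
      · simpa [hF3] using hzF3
      · rcases hsub y (by simpa [hF] using hy) with rfl | hy
        · exact hdF3
        · simpa [hF3] using hy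
    have h5 := Finset.card_le_card hss
    rw [Finset.card_insert_of_notMem (by simpa [hF] using hzF)] at h5
    have h6 : (bigFan G f u s).card ≤ (bigFan G f3 u s).card := by
      refine Finset.card_le_card (Finset.filter_subset_filter _ ?_)
      exact fun y hy => hss (Finset.mem_insert_of_mem hy)
    have := hcard (le_antisymm hbig h6)
    omega
  have hdF' : d ∈ F := by simpa [hF] using hdF
  have hss : F.erase d ⊆ F3 := by
    intro y hy
    obtain ⟨h5, h6⟩ := Finset.mem_erase.1 hy
    simpa [hF3, h5] using hsub y (by simpa [hF] using h6)
  have hsplit : F3 = F.erase d ∪ (F3 \ F) := by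
    ext y
    simp only [Finset.mem_union, Finset.mem_sdiff]
    constructor
    · intro hy
      by_cases hyF : y ∈ F
      · exact .inl (Finset.mem_erase.2 ⟨fun e => hdF3 (e ▸ hy), hyF⟩)
      · exact .inr ⟨hy, hyF⟩
    · rintro (hy | hy)
      · exact hss hy
      · exact hy.1
  have hdisj : Disjoint (F.erase d) (F3 \ F) := by
    rw [Finset.disjoint_left]
    intro y hy hy'
    exact (Finset.mem_sdiff.1 hy').2 (Finset.mem_of_mem_erase hy)
  -- counting missing colors in both fans shows that a vertex of degree `D` is gained; by the choice
  -- of the weight nothing else is gained, so this vertex is `z`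
  have c1 : ∑ y ∈ F, (miss f y).card + 1 = F.card := h0.card_fan E.hno ho
  have c3 : ∑ y ∈ F3, (miss f3 y).card + 1 = F3.card := h3.card_fan E.hno ho3
  have hdmiss : (miss f d).card = 0 := by
    rw [Finset.card_eq_zero, Finset.eq_empty_iff_forall_notMem]
    intro a ha
    exact h0.miss_eq_empty hαu hd E.hole a (mem_miss.1 ha)
  have c2 := Finset.sum_erase_add F (fun y => (miss f y).card) hdF'
  have c4 : ∑ y ∈ F3, (miss f3 y).card =
      ∑ y ∈ F.erase d, (miss f y).card + ∑ y ∈ F3 \ F, (miss f3 y).card := by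
    conv_lhs => rw [hsplit]
    rw [Finset.sum_union hdisj]
    congr 1
    refine Finset.sum_congr rfl fun y hy => h0.card_miss_congr h3 ?_
    exact h0.ne_of_mem_fan (by simpa [hF] using Finset.mem_of_mem_erase hy)
  have c5 : F3.card = (F.erase d).card + (F3 \ F).card := by
    conv_lhs => rw [hsplit]
    rw [Finset.card_union_of_disjoint hdisj]
  have c6 := Finset.card_erase_add_one hdF'
  have c7 : (bigFan G f3 u s).card =
      ((F.erase d).filter fun y => G.degree y = D).card +
        ((F3 \ F).filter fun y => G.degree y = D).card := by
    rw [bigFan, ← hF3]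
    conv_lhs => rw [hsplit]
    rw [Finset.filter_union,
      Finset.card_union_of_disjoint (Finset.disjoint_filter_filter hdisj)]
  have c8 : (bigFan G f u s).card = ((F.erase d).filter fun y => G.degree y = D).card + 1 := by
    rw [bigFan, ← hF, ← Finset.card_erase_add_one (s := F.filter _) (a := d)
      (Finset.mem_filter.2 ⟨hdF', hd⟩), Finset.filter_erase]
  have c9 : ((F3 \ F).filter fun y => ¬ G.degree y = D).card ≤
      ∑ y ∈ F3 \ F, (miss f3 y).card := by
    rw [Finset.card_eq_sum_ones, Finset.sum_filter]
    refine Finset.sum_le_sum fun y hy => ?_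
    have hy3 : y ∈ Fan f3 u s := by simpa [hF3] using (Finset.mem_sdiff.1 hy).1
    have hyF : y ∉ Fan f u s := by simpa [hF] using (Finset.mem_sdiff.1 hy).2
    have := h3.card_miss (h3.ne_of_mem_fan hy3) (fun e => hyF (e ▸ hsF))
    split_ifs <;> omega
  have c10 := Finset.card_filter_add_card_filter_not (s := F3 \ F) (fun y => G.degree y = D)
  have c11 : ((F3 \ F).filter fun y => G.degree y = D).card = 1 := by omega
  have c12 := hcard (by omega)
  have hzE : z ∈ F3 \ F := by simp [hF, hF3, hzF, hzF3]
  obtain ⟨y, hy⟩ := Finset.card_pos.1 (by omega : 0 < ((F3 \ F).filter fun y => G.degree y = D).card)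
  have hyE := Finset.mem_filter.1 hy
  have : z = y := Finset.card_le_one.1 (by omega : (F3 \ F).card ≤ 1) z hzE y hyE.1
  rw [this]
  exact hyE.2

end

/-! ### Robust vertices -/

section

variable {V : Type*} {D : ℕ} {G : SimpleGraph V} {u s : V} {f f' f'' : Fin D → V → V}

/-- The vertices outside the fan that can be made to miss the color `o` of the center by an exchange
along a chain off the center. -/
def Loose (G : SimpleGraph V) (f : Fin D → V → V) (u s : V) (o : Fin D) : Set V :=
  {b | b ∈ Out G f u s ∧ ∃ c, f c b = b ∧ (c = o ∨ b ∉ comp f o c u)}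

/-- The vertices from which a loose vertex is reached along arcs outside the fan. -/
def Leaky (G : SimpleGraph V) (f : Fin D → V → V) (u s : V) (o : Fin D) : Set V :=
  {y | y ∈ Out G f u s ∧ ∃ b ∈ Loose G f u s o, ReflTransGen (ArcIn f u (Out G f u s)) y b}

theorem mem_leaky_of_loose {o : Fin D} {b : V} (hb : b ∈ Loose G f u s o) :
    b ∈ Leaky G f u s o := ⟨hb.1, b, hb, .refl⟩

theorem mem_leaky_of_arc {o : Fin D} {y z : V} (hy : y ∈ Out G f u s) (h : Arc f u y z)
    (hz : z ∈ Leaky G f u s o) : y ∈ Leaky G f u s o := by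
  obtain ⟨hzO, b, hb, hr⟩ := hz
  exact ⟨hy, b, hb, hr.head ⟨h, hzO⟩⟩

variable [Fintype V] [DecidableRel G.Adj] {B : ℕ}

/-- The color of the edge from the hole to `x` is not the color of an edge from the center to a vertex
of degree `D` outside the fan. By `Extremal.big_of_token` such a vertex is not a token. -/
def WeaklyRobust (D : ℕ) (G : SimpleGraph V) [DecidableRel G.Adj] (f : Fin D → V → V)
    (u s x : V) : Prop :=
  x ∈ Out G f u s ∧ ∃ τ, f τ s = x ∧ ∀ d ∈ Out G f u s, G.degree d = D → f τ u ≠ d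

/-- A weakly robust vertex for which the color of the edge from the hole is present at the center. The
additional condition makes the property stable under exchanges that involve the missing color of
the center. -/
def Robust (D : ℕ) (G : SimpleGraph V) [DecidableRel G.Adj] (f : Fin D → V → V)
    (u s x : V) : Prop :=
  x ∈ Out G f u s ∧ ∃ τ, f τ s = x ∧ f τ u ≠ u ∧ ∀ d ∈ Out G f u s, G.degree d = D → f τ u ≠ d

theorem Robust.weakly {x : V} (h : Robust D G f u s x) : WeaklyRobust D G f u s x :=
  ⟨h.1, h.2.imp fun _ hτ => ⟨hτ.1, hτ.2.2⟩⟩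

theorem Robust.weaklyRobust_of_swap {x : V} (hx : Robust D G f u s x) {o c : Fin D}
    (ho : f o u = u) (e : FEq u s f f') (hu : ∀ a, f' a u = f a u)
    (hch : ∀ a y, a ≠ o → f' a y = f a y ∨ (a = c ∧ f' o y = f a y)) :
    WeaklyRobust D G f' u s x := by
  obtain ⟨hxO, τ, hτ, hτu, hd⟩ := hx
  have hτo : τ ≠ o := by rintro rfl; exact hτu ho
  refine ⟨e.out_eq.symm ▸ hxO, ?_⟩
  rw [e.out_eq]
  rcases hch τ s hτo with h1 | ⟨-, h1⟩
  · exact ⟨τ, h1.trans hτ, fun d hdO hdD => by rw [hu]; exact hd d hdO hdD⟩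
  · refine ⟨o, h1.trans hτ, fun d hdO hdD => ?_⟩
    rw [hu, ho]
    exact (ne_of_mem_out hdO).symm

theorem WeaklyRobust.of_big_fixed {x : V} (hx : WeaklyRobust D G f u s x) (h : IsCol G u s f)
    (h' : IsCol G u s f') (e : FEq u s f f') (hs : ∀ a, f' a s = f a s)
    (hb : ∀ d ∈ Out G f u s, G.degree d = D → ∀ a, f' a d = f a d) :
    WeaklyRobust D G f' u s x := by
  obtain ⟨hxO, τ, hτ, hd⟩ := hx
  refine ⟨e.out_eq.symm ▸ hxO, τ, (hs τ).trans hτ, ?_⟩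
  rw [e.out_eq]
  intro d hdO hdD hτd
  refine hd d hdO hdD ?_
  rw [h.eq_iff, ← hb d hdO hdD]
  exact h'.eq_iff.1 hτd

theorem IsCol.exists_miss (h : IsCol G u s f) {x : V} (hxu : x ≠ u) (hx : G.degree x < D) :
    ∃ a, f a x = x := by
  have : 0 < (miss f x).card := by
    rcases eq_or_ne x s with rfl | hxs
    · have := h.card_miss_hole; omega
    · have := h.card_miss hxu hxs; omega
  obtain ⟨a, ha⟩ := Finset.card_pos.1 this
  exact ⟨a, mem_miss.1 ha⟩

variable (E : Extremal D G u s B)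
include E

theorem Extremal.not_acol_of_weaklyRobust (h : Good G u s B f) {x : V}
    (hx : WeaklyRobust D G f u s x) {c : Fin D} (hc : f c x = x) : ¬ ACol f u s c := by
  intro hcA
  obtain ⟨hxO, τ, hτ, hd⟩ := hx
  obtain ⟨h1, h2⟩ := E.big_of_token h hxO hc hcA hτ
  exact hd _ h1 h2 rfl

/-- Otherwise an exchange along the chain of `x` would turn `x` into a token. -/
theorem Extremal.linked_of_robust (h : Good G u s B f) {o c : Fin D} (ho : f o u = u) {x : V}
    (hx : Robust D G f u s x) (hc : f c x = x) : x ∈ comp f o c u := by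
  by_contra hcon
  obtain ⟨hxO, τ, hτ, hτu, hd⟩ := hx
  have huS : u ∉ comp f o c x := fun hh => hcon (h.col.comp_symm hh)
  have h1 := h.col.kswap (comp_closed f o c x)
  have e1 := h.col.feq_kswap_comp E.hno ho hcon
  have hxs : x ≠ s := ne_fan_of_mem_out hxO (self_mem_fan _ _ _)
  have hτo : τ ≠ o := by rintro rfl; exact hτu ho
  have hτc : τ ≠ c := by
    rintro rfl
    exact hxs (hc.symm.trans (h.col.eq_iff.1 hτ))
  have hu : ∀ a, kswap f o c (comp f o c x) a u = f a u := fun a => kswap_of_notMem huS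
  refine E.not_acol_of_weaklyRobust (c := o) (x := x) (h.feq h1 e1) ⟨e1.out_eq.symm ▸ hxO, τ, ?_, ?_⟩ ?_ (.inl ?_)
  · rw [kswap_of_ne hτo hτc, hτ]
  · rw [e1.out_eq, hu]; exact hd
  · rw [kswap_left (mem_comp_self _ _ _ _), hc]
  · rw [hu, ho]

/-- A loose vertex can be made to miss the missing color of the center. -/
theorem Extremal.exists_of_loose (h : IsCol G u s f) {o : Fin D} (ho : f o u = u) {b : V}
    (hb : b ∈ Loose G f u s o) :
    ∃ (f1 : Fin D → V → V) (c : Fin D), IsCol G u s f1 ∧ FEq u s f f1 ∧ (∀ a, f1 a u = f a u) ∧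
      f1 o b = b ∧ (∀ y ∈ Out G f u s, y ∉ Loose G f u s o → ∀ a, f a y = y → f1 a y = y) ∧
      (∀ a, a ≠ o → a ≠ c → ∀ y, f1 a y = f a y) ∧
      (∀ a y, a ≠ o → f1 a y = f a y ∨ (a = c ∧ f1 o y = f a y)) := by
  obtain ⟨hbO, c, hc, hcb⟩ := hb
  rcases hcb with rfl | hbS
  · exact ⟨f, c, h, .refl _ _ _, fun _ => rfl, hc, fun _ _ _ _ => id, fun _ _ _ _ => rfl,
      fun _ _ _ => .inl rfl⟩
  have huS : u ∉ comp f o c b := fun hh => hbS (h.comp_symm hh)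
  refine ⟨_, c, h.kswap (comp_closed f o c b), h.feq_kswap_comp E.hno ho hbS,
    fun a => kswap_of_notMem huS, ?_, ?_, ?_, ?_⟩
  · rw [kswap_left (mem_comp_self _ _ _ _), hc]
  · intro y hyO hyL a ha
    have hao : a ≠ o := by rintro rfl; exact hyL ⟨hyO, a, ha, .inl rfl⟩
    rcases eq_or_ne a c with rfl | hac
    · rw [kswap_of_notMem, ha]
      intro hyS
      exact hyL ⟨hyO, a, ha, .inr fun hyu => hbS (IsCol.comp_trans hyu (h.comp_symm hyS))⟩
    · rw [kswap_of_ne hao hac, ha]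
  · intro a h1 h2 y
    rw [kswap_of_ne h1 h2]
  · intro a y hao
    rcases eq_or_ne a c with rfl | hac
    · by_cases hy : y ∈ comp f o a b
      · exact .inr ⟨rfl, kswap_left hy⟩
      · exact .inl (kswap_of_notMem hy)
    · exact .inl (kswap_of_ne hao hac)

/-- Rotating colors along a path of arcs outside the fan. -/
theorem Extremal.exists_rotate (h : Good G u s B f) {o κ : Fin D} (ho : f o u = u) {Z : Set V}
    (hZ : Z ⊆ Out G f u s) {w b : V} (hwZ : w ∈ Z) (hκ : f κ u = w) (hb : f o b = b)
    (hp : ReflTransGen (ArcIn f u Z) w b) :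
    ∃ f' : Fin D → V → V, Good G u s B f' ∧ FEq u s f f' ∧ f' κ u = u ∧
      (∀ y, y ≠ u → y ∉ Z → ∀ a, f' a y = f a y) ∧
      ∀ x, WeaklyRobust D G f u s x → WeaklyRobust D G f' u s x := by
  obtain ⟨f', h1, h2, h3⟩ := h.col.exists_rotate ho (fun hu => ne_of_mem_out (hZ hu) rfl) hwZ hκ hb hp
  have e := h.col.feq_of_eqOn E.hno h1 fun y hy a =>
    h3 y (h.col.ne_of_mem_fan hy) (.inl fun hyZ => (hZ hyZ).2 hy) a
  refine ⟨f', h.feq h1 e, e, h2, fun y hyu hyZ => h3 y hyu (.inl hyZ), fun x hx => ?_⟩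
  refine hx.of_big_fixed h.col h1 e ?_ ?_
  · exact h3 s h.col.ne.symm (.inl fun hs => (hZ hs).2 (self_mem_fan _ _ _))
  · intro d hdO hdD
    exact h3 d (ne_of_mem_out hdO) (.inr (h.col.miss_eq_empty (ne_of_mem_out hdO) hdD E.hole))

/-- If a loose vertex could be reached from the robust vertex `x`, then shifting colors along the path
would make one of the missing colors of `x` missing at the center, and `x` would be a token. -/
theorem Extremal.not_leaky_of_robust (h : Good G u s B f) {o : Fin D} (ho : f o u = u) {x : V}
    (hx : Robust D G f u s x) : x ∉ Leaky G f u s o := by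
  rintro ⟨hxO, b0, hb0, hr⟩
  rcases rtg_first_hit hr hb0 with hxL | ⟨hxL, p, b, hb, hp, hxp, hpb⟩
  · obtain ⟨-, c, hc, hcx⟩ := hxL
    rcases hcx with rfl | hcx
    · exact E.not_acol_of_weaklyRobust h hx.weakly hc (.inl ho)
    · exact hcx (E.linked_of_robust h ho hx hc)
  -- `b` is the first loose vertex of the path, so the path survives when `b` is made to miss `o`
  obtain ⟨f1, c, h1, e1, hu1, hob, hL, -, hch⟩ := E.exists_of_loose h.col ho hb
  have hx1 := hx.weaklyRobust_of_swap ho e1 hu1 hch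
  have hbx : b ≠ x := by rintro rfl; exact hxL hb
  have step : ∀ y z, y ∈ Out G f u s → y ∉ Loose G f u s o → ArcIn f u (Out G f u s) y z →
      ArcIn f1 u (Out G f u s) y z := by
    rintro y z hyO hyL ⟨⟨a, ha, haz, hzu⟩, hz⟩
    exact ⟨⟨a, hL y hyO hyL a ha, (hu1 a).trans haz, hzu⟩, hz⟩
  have hxb : ∀ y, ReflTransGen (fun y z => ArcIn f u (Out G f u s) y z ∧ z ∉ Loose G f u s o) x y →
      (y ∈ Out G f u s ∧ y ∉ Loose G f u s o) ∧ ReflTransGen (ArcIn f1 u (Out G f u s)) x y := by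
    intro y hy
    induction hy with
    | refl => exact ⟨⟨hxO, hxL⟩, .refl⟩
    | tail _ hyz ih => exact ⟨⟨hyz.1.2, hyz.2⟩, ih.2.tail (step _ _ ih.1.1 ih.1.2 hyz.1)⟩
  obtain ⟨⟨hpO, hpL⟩, hxp1⟩ := hxb p hxp
  have hxb1 := hxp1.tail (step _ _ hpO hpL hpb)
  rcases rtg_last_departure hxb1 hbx with ⟨hh, -⟩ | ⟨w, ⟨⟨κ, hκx, hκ, hwu⟩, hwO⟩, hwx, hwb⟩
  · exact hh rfl
  obtain ⟨f2, h2, e2, hκ2, hst, hR⟩ := E.exists_rotate (h.feq h1 e1) (Z := Out G f1 u s \ {x})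
    ((hu1 o).trans ho) Set.sdiff_subset (w := w) (b := b) ⟨e1.out_eq.symm ▸ hwO, hwx⟩ hκ hob
    (rtg_mono (fun p q hpq => ⟨hpq.1.1, e1.out_eq.symm ▸ hpq.1.2, hpq.2⟩) hwb)
  refine E.not_acol_of_weaklyRobust h2 (hR x hx1) (c := κ) ?_ (.inl hκ2)
  rw [hst x (ne_of_mem_out hxO) (fun hh => hh.2 rfl), hκx]

/-- The analogue of `IsCol.exists_recolor_at` for a robust vertex outside the fan. -/
theorem Extremal.exists_recolor_robust (h : Good G u s B f) {o δ σ : Fin D} (ho : f o u = u)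
    {x v : V} (hvO : v ∈ Out G f u s) (hov : f o v = v) (hx : Robust D G f u s x)
    (hδ : f δ x = x) (hσ : f σ x = v) :
    ∃ f' : Fin D → V → V, Good G u s B f' ∧ FEq u s f f' ∧ (∀ a, f' a u = f a u) ∧
      (∀ a, a ≠ o → a ≠ δ → a ≠ σ → ∀ y, f' a y = f a y) ∧ f' σ x = x ∧ f' σ v = v ∧
      (∀ y, y ≠ x → y ≠ v → f' σ y = f σ y) ∧
      (∀ y, y ≠ x → y ≠ v → f δ y = y → f' δ y = y ∨ f' o y = y) ∧ Robust D G f' u s x := by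
  have hvu := ne_of_mem_out hvO
  have hxu := ne_of_mem_out hx.1
  have hvx : v ≠ x := by
    rintro rfl
    exact E.not_acol_of_weaklyRobust h hx.weakly hov (.inl ho)
  have hxS := E.linked_of_robust h ho hx hδ
  have hvS : v ∉ comp f o δ u := fun hh =>
    hvx (h.col.two_ends ho hh hxS (.inl hov) (.inr hδ) hvu hxu)
  have huS : u ∉ comp f o δ v := fun hh => hvS (h.col.comp_symm hh)
  have hxS' : x ∉ comp f o δ v := fun hh => hvS (IsCol.comp_trans hxS (h.col.comp_symm hh))
  have hσδ : σ ≠ δ := by rintro rfl; exact hvx (hσ.symm.trans hδ)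
  have hσo : σ ≠ o := by rintro rfl; exact hvx (hov.symm.trans (h.col.eq_iff.1 hσ))
  have hδo : δ ≠ o := by
    rintro rfl
    exact E.not_acol_of_weaklyRobust h hx.weakly hδ (.inl ho)
  have h2 := h.col.kswap (comp_closed f o δ v)
  have e2 := h.col.feq_kswap_comp E.hno ho hvS
  set f2 := kswap f o δ (comp f o δ v) with hf2
  have hδv2 : f2 δ v = v := by rw [hf2, kswap_right (mem_comp_self _ _ _ _), hov]
  have hδx2 : f2 δ x = x := by rw [hf2, kswap_of_notMem hxS', hδ]
  have hσx2 : f2 σ x = v := by rw [hf2, kswap_of_ne hσo hσδ, hσ]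
  have h3 := h2.kswap_pair hδx2 hδv2 hσx2
  have e3 : FEq u s f2 (kswap f2 δ σ {x, v}) := by
    refine feq_kswap (by simp [hxu.symm, hvu.symm]) ?_
    rintro y (rfl | rfl) hy
    · rw [e2.fan_eq] at hy; exact absurd hy hx.1.2
    · rw [e2.fan_eq] at hy; exact absurd hy hvO.2
  have hu : ∀ a, kswap f2 δ σ {x, v} a u = f a u := by
    intro a
    rw [kswap_of_notMem (by simp [hxu.symm, hvu.symm]), hf2, kswap_of_notMem huS]
  have hoth : ∀ a, a ≠ o → a ≠ δ → a ≠ σ → ∀ y, kswap f2 δ σ {x, v} a y = f a y := by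
    intro a h1 h2 h3 y
    rw [kswap_of_ne h2 h3, hf2, kswap_of_ne h1 h2]
  have hst : ∀ y, y ≠ x → y ≠ v → ∀ a, kswap f2 δ σ {x, v} a y = f2 a y := fun y h1 h2 a =>
    kswap_of_notMem (by simp [h1, h2])
  have e := e2.trans e3
  refine ⟨_, h.feq h3 e, e, hu, hoth, ?_, ?_, ?_, ?_, ?_⟩
  · rw [kswap_right (by simp), hδx2]
  · rw [kswap_right (by simp), hδv2]
  · intro y h1 h2
    rw [hst y h1 h2, hf2, kswap_of_ne hσo hσδ]
  · intro y h1 h2 hy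
    rw [hst y h1 h2, hst y h1 h2, hf2]
    by_cases hyS : y ∈ comp f o δ v
    · right; rw [kswap_left hyS, hy]
    · left; rw [kswap_of_notMem hyS, hy]
  · obtain ⟨hxO, τ, hτ, hτu, hd⟩ := hx
    have hτx := h.col.eq_iff.1 hτ
    have hsF := self_mem_fan f u s
    have hxs := ne_fan_of_mem_out hxO hsF
    refine ⟨e.out_eq.symm ▸ hxO, τ, ?_, ?_, ?_⟩
    · rw [hoth, hτ]
      · rintro rfl; exact hτu ho
      · rintro rfl; exact hxs (hδ.symm.trans hτx)
      · rintro rfl; exact ne_fan_of_mem_out hvO hsF (hσ.symm.trans hτx)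
    · rw [hu]; exact hτu
    · rw [e.out_eq, hu]; exact hd

/-- An exchange makes a token that misses a color of the hole miss the color `o` of the center. Robust
vertices stay robust. -/
theorem Extremal.exists_center_of_hole (h : Good G u s B f) {o α : Fin D} (ho : f o u = u)
    {v : V} (hvO : v ∈ Out G f u s) (hαs : f α s = s) (hαv : f α v = v) :
    ∃ f1 : Fin D → V → V, Good G u s B f1 ∧ FEq u s f f1 ∧ (∀ a, f1 a u = f a u) ∧ f1 o v = v ∧
      (∀ a, a ≠ o → a ≠ α → ∀ y, f1 a y = f a y) ∧
      (∀ y, f o y = v → y ≠ v → f1 α y = v) ∧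
      (∀ x, Robust D G f u s x → Robust D G f1 u s x) := by
  have hsF := self_mem_fan f u s
  obtain ⟨f1, h1, e1, hu1, hov, hoth, hch⟩ := h.col.exists_token_center E.hno ho
    (h.col.center_unique E.center ho) hvO.2 (ne_of_mem_out hvO) hαv (.inr ⟨s, hsF, hαs⟩)
  refine ⟨f1, h.feq h1 e1, e1, hu1, hov, hoth, hch, ?_⟩
  rintro x ⟨hxO, τ, hτ, hτu, hd⟩
  refine ⟨e1.out_eq.symm ▸ hxO, τ, ?_, ?_, ?_⟩
  · rw [hoth, hτ]
    · rintro rfl; exact hτu ho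
    · rintro rfl; exact ne_fan_of_mem_out hxO hsF (hτ.symm.trans hαs)
  · rw [hu1]; exact hτu
  · rw [e1.out_eq, hu1]; exact hd

/-- The analogue of `IsCol.not_acol_of_token` for a robust vertex outside the fan. -/
theorem Extremal.not_acol_of_robust_adj (h : Good G u s B f) {α σ : Fin D} {x v : V}
    (hvO : v ∈ Out G f u s) (hαs : f α s = s) (hαv : f α v = v) (hx : Robust D G f u s x)
    (hxD : G.degree x < D) (hσ : f σ x = v) : ¬ ACol f u s σ := by
  intro hσA
  obtain ⟨o, ho, -⟩ := h.col.exists_center E.center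
  have hsF := self_mem_fan f u s
  obtain ⟨f1, h1, e1, hu1, hov, hoth, hch, hR⟩ := E.exists_center_of_hole h ho hvO hαs hαv
  have hx1 := hR x hx
  have hxv : x ≠ v := by
    rintro rfl
    exact E.not_acol_of_weaklyRobust h hx.weakly hαv (.inr ⟨s, hsF, hαs⟩)
  obtain ⟨σ1, hσ1, hσA1⟩ : ∃ σ1, f1 σ1 x = v ∧ ACol f1 u s σ1 := by
    rcases eq_or_ne σ o with rfl | hσo
    · exact ⟨α, hch x hσ hxv, (e1.acol hu1 α).2 (.inr ⟨s, hsF, hαs⟩)⟩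
    · refine ⟨σ, ?_, (e1.acol hu1 σ).2 hσA⟩
      rw [hoth σ hσo, hσ]
      rintro rfl
      exact hxv (h.col.injective σ (hσ.trans hαv.symm))
  obtain ⟨δ, hδ⟩ := h1.col.exists_miss (ne_of_mem_out hx.1) hxD
  obtain ⟨f2, h2, e2, hu2, -, hσx, -, -, -, hx2⟩ := E.exists_recolor_robust h1
    ((hu1 o).trans ho) (e1.out_eq.symm ▸ hvO) hov hx1 hδ hσ1
  exact E.not_acol_of_weaklyRobust h2 hx2.weakly hσx ((e2.acol hu2 σ1).2 hσA1)

end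

/-! ### Trees of arcs outside the fan -/

section

variable {V : Type*} {D : ℕ} {G : SimpleGraph V} {u s : V} {f f' f'' : Fin D → V → V}

/-- From every vertex of `P` the root `v` is reached along arcs in `P`, and `P` is outside the fan. -/
structure InTree (G : SimpleGraph V) (f : Fin D → V → V) (u s : V) (P : Set V) (v : V) : Prop where
  root : v ∈ P
  subset : P ⊆ Out G f u s
  path : ∀ y ∈ P, ReflTransGen (ArcIn f u P) y v

theorem InTree.congr {P : Set V} {v : V} (h : InTree G f u s P v) (e : FEq u s f f')
    (hP : ∀ a, f a u ∈ P → ∀ y, f' a y = f a y) : InTree G f' u s P v := by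
  refine ⟨h.root, e.out_eq.symm ▸ h.subset, fun y hy => rtg_mono ?_ (h.path y hy)⟩
  rintro p q ⟨⟨a, ha, hq, hqu⟩, hqP⟩
  have := hP a (hq.symm ▸ hqP)
  exact ⟨⟨a, (this p).trans ha, (this u).trans hq, hqu⟩, hqP⟩

theorem not_acol_of_mem_out {a : Fin D} (ha : f a u ∈ Out G f u s) : ¬ ACol f u s a := fun h =>
  ha.2 (mem_fan_of_acol h (ne_of_mem_out ha))

variable [Fintype V] [DecidableRel G.Adj] {B m : ℕ} {P : Set V} {v : V} {α : Fin D}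

/-- In addition to `Extremal`, no in-tree rooted at a token has more than `m` vertices, in any good
coloring. -/
structure Maximal (D : ℕ) (G : SimpleGraph V) [DecidableRel G.Adj] (u s : V) (B m : ℕ) : Prop
    extends Extremal D G u s B where
  grow : ∀ (f : Fin D → V → V) (P : Set V) (v : V) (c : Fin D), Good G u s B f → f c v = v →
    ACol f u s c → InTree G f u s P v → P.ncard ≤ m

/-- A good coloring together with an in-tree `P` of at least `m` vertices, whose root `v` is a token
missing the color `α` of the hole. -/
structure IsMaxTree (G : SimpleGraph V) [DecidableRel G.Adj] (u s : V) (B m : ℕ)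
    (f : Fin D → V → V) (P : Set V) (v : V) (α : Fin D) : Prop where
  good : Good G u s B f
  tree : InTree G f u s P v
  card : m ≤ P.ncard
  hole_miss : f α s = s
  root_miss : f α v = v

namespace IsMaxTree

theorem mem_out (T : IsMaxTree G u s B m f P v α) : v ∈ Out G f u s := T.tree.subset T.tree.root

theorem acol (T : IsMaxTree G u s B m f P v α) : ACol f u s α :=
  .inr ⟨s, self_mem_fan _ _ _, T.hole_miss⟩

end IsMaxTree

namespace Maximal

variable (E : Maximal D G u s B m)
include E

/-- If the root and a vertex `b` outside the tree both miss the missing color `o` of the center, then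
recoloring `u b` with `o` makes `b` the root of a larger tree. -/
theorem no_growth (h : Good G u s B f) (hP : InTree G f u s P v) (hm : m ≤ P.ncard) {o : Fin D}
    (ho : f o u = u) (hov : f o v = v) {b : V} (hb : b ∈ Out G f u s) (hbP : b ∉ P)
    (hob : f o b = b) : False := by
  have hbu := ne_of_mem_out hb
  obtain ⟨κ, hκ⟩ := h.col.surj u b hb.1 (fun e => ne_fan_of_mem_out hb (self_mem_fan _ _ _) e.2)
    (fun e => hbu e.2)
  obtain ⟨f', h', h1, h2, h3, h4, h5⟩ := h.col.rotate_one ho hob hκ hbu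
  have e : FEq u s f f' := h.col.feq_of_eqOn E.hno h' fun y hy a =>
    h4 y (h.col.ne_of_mem_fan hy) (ne_fan_of_mem_out hb hy).symm a
  have hvb : v ≠ b := fun hh => hbP (hh ▸ hP.root)
  have hvu := ne_of_mem_out (hP.subset hP.root)
  have key : ∀ a, f a u ∈ P → ∀ y, f' a y = f a y := by
    intro a ha
    refine h5 a ?_ ?_
    · rintro rfl; rw [ho] at ha; exact ne_of_mem_out (hP.subset ha) rfl
    · rintro rfl; rw [hκ] at ha; exact hbP ha
  have hP' := hP.congr e key
  have ht : InTree G f' u s (insert b P) b := by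
    refine ⟨Set.mem_insert _ _, Set.insert_subset (e.out_eq.symm ▸ hb) hP'.subset, ?_⟩
    rintro y (rfl | hy)
    · exact .refl
    · refine ReflTransGen.tail (b := v) (rtg_mono ?_ (hP'.path y hy)) ?_
      · exact fun p q hpq => ⟨hpq.1, Set.mem_insert_of_mem _ hpq.2⟩
      · exact ⟨⟨o, by rw [h4 v hvu hvb, hov], h3, hbu⟩, Set.mem_insert _ _⟩
  have := E.grow f' _ b κ (h.feq h' e) h2 (.inl h1) ht
  rw [Set.ncard_insert_of_notMem hbP] at this
  omega

theorem loose_root (T : IsMaxTree G u s B m f P v α) {o : Fin D} (ho : f o u = u) :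
    v ∈ Loose G f u s o := by
  have hv := T.mem_out
  have hsF := self_mem_fan f u s
  exact ⟨hv, α, T.root_miss, .inr (T.good.col.notMem_comp E.hno ho hsF T.hole_miss
    (ne_fan_of_mem_out hv hsF) (ne_of_mem_out hv) (.inr T.root_miss))⟩

theorem leaky_of_mem_tree (T : IsMaxTree G u s B m f P v α) {o : Fin D} (ho : f o u = u) {y : V}
    (hy : y ∈ P) : y ∈ Leaky G f u s o :=
  ⟨T.tree.subset hy, v, E.loose_root T ho, rtg_mono (fun _ _ h => ⟨h.1, T.tree.subset h.2⟩)
    (T.tree.path y hy)⟩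

/-- If the color `σ` of an edge `x v` leads to a leaky vertex from which `v` is not reached, then
the color of `x v` can be made missing at the center. -/
theorem exists_free_color (T : IsMaxTree G u s B m f P v α) {o σ : Fin D} (ho : f o u = u) {x : V}
    (hσ : f σ x = v) (hxL : x ∉ Leaky G f u s o) (hz : f σ u ∈ Leaky G f u s o)
    (hzv : ¬ ReflTransGen (ArcIn f u (Out G f u s)) (f σ u) v) :
    ∃ f' : Fin D → V → V, Good G u s B f' ∧ FEq u s f f' ∧ f' α v = v ∧ ∃ a, f' a x = v ∧
      f' a u = u ∧ (Robust D G f u s x → Robust D G f' u s x) := by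
  have hzO := hz.1
  have hzu := ne_of_mem_out hzO
  obtain ⟨-, b0, hb0, hr0⟩ := hz
  obtain ⟨b, hb, hr⟩ := rtg_exists_first hr0 hb0
  have hvO := T.mem_out
  have hσo : σ ≠ o := by rintro rfl; exact hzu ho
  have hαo : α ≠ o := by
    rintro rfl
    exact T.good.col.fan_not_center_miss E.hno ho (self_mem_fan _ _ _) T.hole_miss
  obtain ⟨f1, c, h1, e1, hu1, hob, hL, hoth, hch⟩ := E.exists_of_loose T.good.col ho hb
  have g1 := T.good.feq h1 e1
  have ho1 := (hu1 o).trans ho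
  have hαv : f1 α v = v := by
    rcases hch α v hαo with hh | ⟨rfl, hh⟩
    · rw [hh, T.root_miss]
    exfalso
    have hbP : b ∉ P := fun hbP => hzv <|
      (rtg_mono (fun _ _ h => h.1) hr).trans (rtg_mono (fun _ _ h => ⟨h.1, T.tree.subset h.2⟩)
        (T.tree.path b hbP))
    refine E.no_growth g1 (T.tree.congr e1 fun a ha => ?_) T.card ho1
      (hh.trans T.root_miss) (e1.out_eq.symm ▸ hb.1) hbP hob
    have haA := not_acol_of_mem_out (T.tree.subset ha)
    exact hoth a (by rintro rfl; exact haA (.inl ho)) (by rintro rfl; exact haA T.acol)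
  have hR1 : Robust D G f u s x → WeaklyRobust D G f1 u s x := fun hR =>
    hR.weaklyRobust_of_swap ho e1 hu1 hch
  have hvs := ne_fan_of_mem_out hvO (self_mem_fan _ _ _)
  have last : ∀ (f2 : Fin D → V → V) (a : Fin D), IsCol G u s f2 → FEq u s f f2 → f2 a u = u →
      f2 a x = v → WeaklyRobust D G f2 u s x → Robust D G f2 u s x := by
    rintro f2 a h2 e2 ha hax ⟨hxO, τ, hτ, hd⟩
    refine ⟨hxO, τ, hτ, fun hτu => hvs ?_, hd⟩
    obtain rfl := h2.center_unique E.center ha τ hτu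
    exact hax.symm.trans (h2.eq_iff.1 hτ)
  -- either the exchange gives `x v` the color `o`, or the colors are shifted from `f σ u` to `b`
  rcases hch σ x hσo with hσ1 | ⟨-, hσ1⟩
  swap
  · exact ⟨f1, g1, e1, hαv, o, hσ1.trans hσ, ho1, fun hR => last f1 o h1 e1 ho1 (hσ1.trans hσ) (hR1 hR)⟩
  have hxu : x ≠ u := by rintro rfl; exact hzv (hσ ▸ .refl)
  have hxz : f σ u ≠ x := by
    intro hh
    exact hxL (hh ▸ ⟨hzO, b0, hb0, hr0⟩)
  have hzv' : f σ u ≠ v := fun hh => hzv (hh ▸ .refl)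
  obtain ⟨f2, g2, e2, hσ2, hst, hR2⟩ := E.exists_rotate g1 ho1
    (Z := Out G f1 u s \ {x, v}) Set.sdiff_subset (w := f σ u) (b := b) (κ := σ)
    ⟨e1.out_eq.symm ▸ hzO, by simp [hxz, hzv']⟩ (hu1 σ) hob (by
      refine (ReflTransGen.head_induction_on
        (motive := fun y _ => y ∈ Out G f u s ∧ ReflTransGen (ArcIn f u (Out G f u s)) (f σ u) y →
          ReflTransGen (ArcIn f1 u (Out G f1 u s \ {x, v})) y b) hr ?_ ?_) ⟨hzO, .refl⟩
      · exact fun _ => .refl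
      · rintro p q ⟨hpq, hpL⟩ hqb ih ⟨hpO, hzp⟩
        have hzq := hzp.tail hpq
        refine ReflTransGen.head ?_ (ih ⟨hpq.2, hzq⟩)
        have hqL : q ∈ Leaky G f u s o := ⟨hpq.2, b, hb, rtg_mono (fun _ _ h => h.1) hqb⟩
        obtain ⟨⟨a, ha, haq, hqu⟩, hqO⟩ := hpq
        refine ⟨⟨a, hL p hpO hpL a ha, (hu1 a).trans haq, hqu⟩, e1.out_eq.symm ▸ hqO, ?_⟩
        rintro (rfl | rfl)
        · exact hxL hqL
        · exact hzv hzq)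
  have e := e1.trans e2
  have hx2 : f2 σ x = v := by rw [hst x hxu (by simp), hσ1, hσ]
  refine ⟨f2, g2, e, ?_, σ, hx2, hσ2, fun hR => last f2 σ g2.col e hσ2 hx2 (hR2 x (hR1 hR))⟩
  rw [hst v (ne_of_mem_out hvO) (by simp), hαv]

/-- The color of an edge from the root to a robust vertex of small degree leads to a vertex that is
not leaky, and no vertex that is not leaky misses this color. -/
theorem robust_adj_root (T : IsMaxTree G u s B m f P v α) {o σ : Fin D} (ho : f o u = u) {x : V}
    (hx : Robust D G f u s x) (hxD : G.degree x < D) (hσ : f σ x = v) :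
    f σ u ∈ Out G f u s ∧ f σ u ∉ Leaky G f u s o ∧
      ∀ t ∈ Out G f u s, t ∉ Leaky G f u s o → f σ t ≠ t := by
  have hvO := T.mem_out
  have hxL := E.not_leaky_of_robust T.good ho hx
  have hσA := E.not_acol_of_robust_adj T.good hvO T.hole_miss T.root_miss hx hxD hσ
  have hzu : f σ u ≠ u := fun hh => hσA (.inl hh)
  have hzO : f σ u ∈ Out G f u s :=
    ⟨T.good.col.adj σ u hzu, fun hh => hσA (T.good.col.acol_of_mem_fan hh)⟩
  obtain ⟨g, hg, e1, hu1, hov, hoth1, -, hR⟩ :=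
    E.exists_center_of_hole T.good ho hvO T.hole_miss T.root_miss
  have hxg := hR x hx
  have ho1 := (hu1 o).trans ho
  have hnA : ∀ a, ¬ ACol f u s a → ∀ y, g a y = f a y := fun a ha =>
    hoth1 a (by rintro rfl; exact ha (.inl ho)) (by rintro rfl; exact ha T.acol)
  obtain ⟨δ, hδ⟩ := hg.col.exists_miss (ne_of_mem_out hx.1) hxD
  have hδA : ¬ ACol f u s δ := fun hh =>
    E.not_acol_of_weaklyRobust hg hxg.weakly hδ ((e1.acol hu1 δ).2 hh)
  have hvO1 : v ∈ Out G g u s := e1.out_eq.symm ▸ hvO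
  obtain ⟨f2, h2, e2, hu2, hoth2, hσx, hσv, hσy, hδy, hx2⟩ := E.exists_recolor_robust hg ho1 hvO1
    hov hxg hδ ((hnA σ hσA x).trans hσ)
  have e := e1.trans e2
  have hu : ∀ a, f2 a u = f a u := fun a => (hu2 a).trans (hu1 a)
  have ho2 : f2 o u = u := (hu o).trans ho
  have hxL2 := E.not_leaky_of_robust h2 ho2 hx2
  have hxlink := E.linked_of_robust h2 ho2 hx2 hσx
  have hvu := ne_of_mem_out hvO
  have hvL := E.loose_root T ho
  have hvx : v ≠ x := fun hh => hxL (hh ▸ mem_leaky_of_loose hvL)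
  have hnot : ∀ t, t ≠ x → t ≠ u → f2 σ t = t → t ∉ comp f2 o σ u := fun t htx htu ht hh =>
    htx (h2.col.two_ends ho2 hh hxlink (.inr ht) (.inr hσx) htu (ne_of_mem_out hx.1))
  have hzL : f σ u ∉ Leaky G f u s o := by
    intro hzL
    -- if `v` is reached from `f σ u`, then after the recoloring the arc of color `σ` makes `x` leaky
    by_cases hzv : ReflTransGen (ArcIn f u (Out G f u s)) (f σ u) v
    · have hvL1 : v ∈ Loose G g u s o := ⟨hvO1, o, hov, .inl rfl⟩
      have hvL2 : v ∈ Leaky G f2 u s o := mem_leaky_of_loose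
        ⟨e.out_eq.symm ▸ hvO, σ, hσv, .inr (hnot v hvx hvu hσv)⟩
      have key : f σ u ∈ Out G f u s → f σ u ∈ Leaky G f2 u s o := by
        have hzv1 : ReflTransGen (ArcIn g u (Out G f u s)) (f σ u) v := by
          refine rtg_mono ?_ hzv
          rintro p q ⟨⟨a, ha, haq, hqu⟩, hqO⟩
          have haA := not_acol_of_mem_out (haq.symm ▸ hqO)
          exact ⟨⟨a, by rw [hnA a haA, ha], (hu1 a).trans haq, hqu⟩, hqO⟩
        refine ReflTransGen.head_induction_on
          (motive := fun y _ => y ∈ Out G f u s → y ∈ Leaky G f2 u s o) hzv1 (fun _ => hvL2) ?_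
        intro p q hpq hqv ih hpO
        have hqL := ih hpq.2
        rcases eq_or_ne p v with rfl | hpv
        · exact hvL2
        have hpx : p ≠ x := by
          rintro rfl
          refine E.not_leaky_of_robust hg ho1 hxg ⟨hxg.1, v, hvL1, ?_⟩
          rw [e1.out_eq]
          exact hqv.head hpq
        obtain ⟨⟨a, ha, haq, hqu⟩, hqO⟩ := hpq
        have haq' : f a u = q := (hu1 a).symm.trans haq
        have haA := not_acol_of_mem_out (haq'.symm ▸ hqO)
        have hao : a ≠ o := by rintro rfl; exact haA (.inl ho)
        have hpO2 : p ∈ Out G f2 u s := e.out_eq.symm ▸ hpO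
        have fin : f2 a p = p → p ∈ Leaky G f2 u s o := fun hh =>
          mem_leaky_of_arc hpO2 ⟨a, hh, (hu a).trans haq', hqu⟩ hqL
        rcases eq_or_ne a δ with rfl | haδ
        · rcases hδy p hpx hpv ha with hh | hh
          · exact fin hh
          · exact mem_leaky_of_loose ⟨hpO2, o, hh, .inl rfl⟩
        rcases eq_or_ne a σ with rfl | haσ
        · exact fin (by rw [hσy p hpx hpv, ha])
        · exact fin (by rw [hoth2 a hao haδ haσ, ha])
      exact hxL2 (mem_leaky_of_arc hx2.1 ⟨σ, hσx, hu σ, hzu⟩ (key hzO))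
    · obtain ⟨f3, h3, e3, hα3, a, hax, hau, hR3⟩ := E.exists_free_color T ho hσ hxL hzL hzv
      exact E.not_acol_of_robust_adj h3 (e3.out_eq.symm ▸ hvO)
        ((e3.miss s (self_mem_fan _ _ _) α).2 T.hole_miss) hα3 (hR3 hx) hxD hax (.inl hau)
  -- if `t` misses `σ`, then one exchange makes both `v` and `t` miss `o`
  refine ⟨hzO, hzL, fun t htO htL hσt => ?_⟩
  have htv : t ≠ v := by rintro rfl; exact htL (mem_leaky_of_loose hvL)
  have htx : t ≠ x := by rintro rfl; exact hvx (hσ.symm.trans hσt)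
  have htu := ne_of_mem_out htO
  have hσt2 : f2 σ t = t := by rw [hσy t htx htv, hnA σ hσA, hσt]
  set S := comp f2 o σ v ∪ comp f2 o σ t with hS
  have huS : u ∉ S := by
    rintro (hh | hh)
    · exact hnot v hvx hvu hσv (h2.col.comp_symm hh)
    · exact hnot t htx htu hσt2 (h2.col.comp_symm hh)
  have h3 : IsCol G u s (kswap f2 o σ S) := by
    refine h2.col.kswap ?_
    rintro y (hy | hy)
    · exact ⟨.inl (comp_closed _ _ _ _ y hy).1, .inl (comp_closed _ _ _ _ y hy).2⟩
    · exact ⟨.inr (comp_closed _ _ _ _ y hy).1, .inr (comp_closed _ _ _ _ y hy).2⟩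
  have e3 : FEq u s f2 (kswap f2 o σ S) := by
    refine feq_kswap huS fun y _ hyF => ⟨h2.col.fan_not_center_miss E.hno ho2 hyF, fun hh => ?_⟩
    exact hσA ((e.acol hu σ).1 (.inr ⟨y, hyF, hh⟩))
  have htP : t ∉ P := fun hh => htL (E.leaky_of_mem_tree T ho hh)
  have e4 := e.trans e3
  refine E.no_growth (h2.feq h3 e3) (T.tree.congr e4 fun a ha y => ?_) T.card (o := o) ?_ ?_
    (e4.out_eq.symm ▸ htO) htP ?_
  · have haA := not_acol_of_mem_out (T.tree.subset ha)
    have hao : a ≠ o := by rintro rfl; exact haA (.inl ho)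
    have haσ : a ≠ σ := by rintro rfl; exact hzL (E.leaky_of_mem_tree T ho ha)
    have haδ : a ≠ δ := by
      rintro rfl
      refine hxL (mem_leaky_of_arc hx.1 ⟨a, ?_, rfl, ?_⟩ (E.leaky_of_mem_tree T ho ha))
      · rw [← hnA a haA, hδ]
      · exact fun hh => haA (.inl hh)
    rw [kswap_of_ne hao haσ, hoth2 a hao haδ haσ, hnA a haA]
  · rw [kswap_of_notMem huS, ho2]
  · rw [kswap_left (.inl (mem_comp_self _ _ _ _)), hσv]
  · rw [kswap_left (.inr (mem_comp_self _ _ _ _)), hσt2]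

end Maximal

/-- The edge `x v` from a vertex `x` of the fan to a token can be recolored such that its color
`σ` becomes missing at `x`; the fan then absorbs everything reached from `f σ u`. -/
theorem Extremal.exists_absorb (E : Extremal D G u s B) (h : IsCol G u s f) {o c σ : Fin D}
    (ho : f o u = u) {x x' : V} (hx : x ∈ Fan f u s) (hxD : G.degree x < D)
    (hv : v ∈ Out G f u s) (hc : f c v = v) (hcA : ACol f u s c) (hσ : f σ x = v)
    (hx' : x' ∈ Fan f u s) :
    ∃ f' : Fin D → V → V, IsCol G u x f' ∧ f' o u = u ∧ f' σ x = x ∧ f' σ v = v ∧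
      x' ∈ Fan f' u x ∧
      (∀ a, a ≠ σ → ¬ ACol f u s a → ∀ y, y ∉ Fan f u s → y ≠ u → f' a y = f a y) ∧
      ∀ t, ReflTransGen (ArcIn f u (Out G f u s)) (f σ u) t →
        t ∈ Out G f u s ∧ t ∈ Fan f' u x ∧ t ≠ v ∧ f σ t ≠ t := by
  have hσA := h.not_acol_of_token E.hno E.center hx hxD hv.2 (ne_of_mem_out hv) hc hcA hσ
  obtain ⟨f1, σ1, h1, hF1, ho1, hov, hσ1, -, hσσ, hA1, hst1⟩ :=
    h.exists_moveHole_token E.hno E.center ho hx hv.2 (ne_of_mem_out hv) hc hcA hσ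
  obtain rfl := hσσ hσA
  have hm := h1.card_miss_hole
  obtain ⟨f2, h2, hu2, hσx, hσv, hx2, -, hst2, hσy⟩ := h1.exists_recolor_at E.hno ho1
    (hF1.symm ▸ hv.2) (ne_of_mem_out hv) hov hσ1 (by omega) (x' := x') (hF1.symm ▸ hx')
  have ho2 := (hu2 o).trans ho1
  have hst : ∀ a, a ≠ σ1 → ¬ ACol f u s a → ∀ y, y ∉ Fan f u s → y ≠ u → f2 a y = f a y := by
    intro a ha haA y hy hyu
    rw [hst2 a ha (fun hh => haA ((hA1 a).1 hh)), hst1 a haA y hy hyu]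
  refine ⟨f2, h2, ho2, hσx, hσv, hx2, hst, ?_⟩
  have key : ∀ t ∈ Out G f u s, t ∈ Fan f2 u x → t ≠ v ∧ f σ1 t ≠ t := by
    intro t htO htF
    have htx := ne_fan_of_mem_out htO hx
    have : f2 σ1 t ≠ t := fun hh =>
      htx (h2.fan_elementary E.hno ho2 htF (self_mem_fan _ _ _) hh hσx)
    have htv : t ≠ v := by rintro rfl; exact this hσv
    refine ⟨htv, fun hh => this ?_⟩
    rw [hσy t htx htv, hst1 σ1 hσA t htO.2 (ne_of_mem_out htO), hh]
  have hzu : f σ1 u ≠ u := fun hh => hσA (.inl hh)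
  have hzO : f σ1 u ∈ Out G f u s := ⟨h.adj σ1 u hzu, fun hh => hσA (h.acol_of_mem_fan hh)⟩
  have hz1 : f1 σ1 u = f σ1 u := by
    rw [h1.eq_iff, hst1 σ1 hσA _ hzO.2 hzu, h.inv]
  intro t ht
  induction ht with
  | refl =>
    have hzF : f σ1 u ∈ Fan f2 u x := fan_step (self_mem_fan _ _ _) hσx ((hu2 σ1).trans hz1) hzu
    exact ⟨hzO, hzF, key _ hzO hzF⟩
  | @tail p q _ hpq ih =>
    obtain ⟨hpO, hpF, hpv, hpσ⟩ := ih
    obtain ⟨⟨a, ha, rfl, hqu⟩, hqO⟩ := hpq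
    have haA := not_acol_of_mem_out hqO
    have haσ : a ≠ σ1 := by rintro rfl; exact hpσ ha
    have hqF : f a u ∈ Fan f2 u x := by
      refine fan_step (a := a) hpF ?_ ?_ hqu
      · rw [hst a haσ haA p hpO.2 (ne_of_mem_out hpO), ha]
      · rw [h2.eq_iff, hst a haσ haA _ hqO.2 hqu, h.inv]
    exact ⟨hqO, hqF, key _ hqO hqF⟩

namespace Maximal

variable (E : Maximal D G u s B m)
include E

/-- The analogue of `Maximal.robust_adj_root` for a vertex of the fan. -/
theorem fan_adj_root (T : IsMaxTree G u s B m f P v α) {o σ : Fin D} (ho : f o u = u) {x : V}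
    (hx : x ∈ Fan f u s) (hxD : G.degree x < D) (hσ : f σ x = v) :
    f σ u ∈ Out G f u s ∧ f σ u ∉ Leaky G f u s o ∧
      ∀ t, ReflTransGen (ArcIn f u (Out G f u s)) (f σ u) t → f σ t ≠ t := by
  have hvO := T.mem_out
  obtain ⟨_, -, -, -, -, -, -, habs⟩ := E.exists_absorb T.good.col ho hx hxD hvO T.root_miss T.acol
    hσ hx
  refine ⟨(habs _ .refl).1, fun hzL => ?_, fun t ht => (habs t ht).2.2.2⟩
  obtain ⟨f3, h3, e3, hα3, a, hax, hau, -⟩ := E.exists_free_color T ho hσ (fun hh => hh.1.2 hx) hzL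
    (fun hh => (habs v hh).2.2.1 rfl)
  have hsF := self_mem_fan f3 u s
  exact h3.col.not_acol_of_token E.hno E.center (e3.fan_eq.symm ▸ hx) hxD (e3.fan_eq.symm ▸ hvO.2)
    (ne_of_mem_out hvO) hα3
    (.inr ⟨s, hsF, (e3.miss s (self_mem_fan _ _ _) α).2 T.hole_miss⟩) hax (.inl hau)

/-- Recolor `x v`, so that `t` is absorbed by the fan. If `t` missed `σ'`, then the edge `x' v` would
contradict `IsCol.not_acol_of_token`. -/
theorem fan_adj_root_disjoint (T : IsMaxTree G u s B m f P v α) {σ σ' : Fin D} {x x' : V}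
    (hx : x ∈ Fan f u s) (hxD : G.degree x < D) (hσ : f σ x = v)
    (hx' : x' ∈ Fan f u s) (hxD' : G.degree x' < D) (hσ' : f σ' x' = v) (hxx : x ≠ x')
    {t : V} (ht : ReflTransGen (ArcIn f u (Out G f u s)) (f σ u) t) : f σ' t ≠ t := by
  intro hσt
  have hvO := T.mem_out
  obtain ⟨o, ho, -⟩ := T.good.col.exists_center E.center
  have hσσ : σ' ≠ σ := by
    rintro rfl
    exact hxx (T.good.col.injective _ (hσ.trans hσ'.symm))
  have hσA' := T.good.col.not_acol_of_token E.hno E.center hx' hxD' hvO.2 (ne_of_mem_out hvO)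
    T.root_miss T.acol hσ'
  obtain ⟨f2, h2, ho2, hσx, hσv, hx2, hst, habs⟩ := E.exists_absorb T.good.col ho hx hxD hvO
    T.root_miss T.acol hσ hx'
  obtain ⟨htO, htF, -, -⟩ := habs t ht
  have hvF : v ∉ Fan f2 u x := fun hh => ne_fan_of_mem_out hvO hx
    (h2.fan_elementary E.hno ho2 hh (self_mem_fan _ _ _) hσv hσx)
  refine h2.not_acol_of_token E.hno E.center hx2 hxD' hvF (ne_of_mem_out hvO) hσv
    (.inr ⟨x, self_mem_fan _ _ _, hσx⟩) (σ := σ') ?_ (.inr ⟨t, htF, ?_⟩)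
  · rw [h2.eq_iff, hst σ' hσσ hσA' v hvO.2 (ne_of_mem_out hvO)]
    exact T.good.col.eq_iff.1 hσ'
  · rw [hst σ' hσσ hσA' t htO.2 (ne_of_mem_out htO), hσt]

end Maximal

end

/-! ### Counting common neighbors -/

section

variable {V : Type*} {D : ℕ} {G : SimpleGraph V} {u s : V} {f : Fin D → V → V}
variable [Fintype V] [DecidableRel G.Adj] {B m : ℕ} {P : Set V} {v : V} {α : Fin D}

/-- The neighbors of the center outside the fan that are not leaky. -/
def Tight (G : SimpleGraph V) (f : Fin D → V → V) (u s : V) (o : Fin D) : Set V :=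
  Out G f u s \ Leaky G f u s o

namespace Extremal

variable (E : Extremal D G u s B)
include E

/-- Tight vertices behave like vertices of a fan: their missing colors are linked to the center, and
their arcs lead to tight vertices. -/
theorem tight_miss (h : IsCol G u s f) {o c : Fin D} (ho : f o u = u) {z : V}
    (hz : z ∈ Tight G f u s o) (hc : f c z = z) :
    ¬ ACol f u s c ∧ z ∈ comp f o c u ∧ f c u ∈ Tight G f u s o := by
  have hzL : z ∉ Loose G f u s o := fun hh => hz.2 (mem_leaky_of_loose hh)
  have hcA : ¬ ACol f u s c := by
    rintro (hh | ⟨y, hy, hcy⟩)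
    · exact hzL ⟨hz.1, c, hc, .inl (h.center_unique E.center ho c hh)⟩
    · exact hzL ⟨hz.1, c, hc, .inr (h.notMem_comp E.hno ho hy hcy (ne_fan_of_mem_out hz.1 hy)
        (ne_of_mem_out hz.1) (.inr hc))⟩
  have hcu : f c u ≠ u := fun hh => hcA (.inl hh)
  refine ⟨hcA, ?_, ⟨h.adj c u hcu, fun hh => hcA (h.acol_of_mem_fan hh)⟩, fun hh => hz.2 ?_⟩
  · by_contra hcon
    exact hzL ⟨hz.1, c, hc, .inr hcon⟩
  · exact mem_leaky_of_arc hz.1 ⟨c, hc, rfl, hcu⟩ hh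

theorem tight_elementary (h : IsCol G u s f) {o c : Fin D} (ho : f o u = u) {y z : V}
    (hy : y ∈ Tight G f u s o) (hz : z ∈ Tight G f u s o) (hcy : f c y = y) (hcz : f c z = z) :
    y = z :=
  h.two_ends ho (E.tight_miss h ho hy hcy).2.1 (E.tight_miss h ho hz hcz).2.1 (.inr hcy) (.inr hcz)
    (ne_of_mem_out hy.1) (ne_of_mem_out hz.1)

theorem tight_reach (h : IsCol G u s f) {o : Fin D} (ho : f o u = u) {z t : V}
    (hz : z ∈ Tight G f u s o) (ht : ReflTransGen (ArcIn f u (Out G f u s)) z t) :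
    t ∈ Tight G f u s o := by
  induction ht with
  | refl => exact hz
  | tail _ hpq ih =>
    obtain ⟨⟨a, ha, rfl, -⟩, -⟩ := hpq
    exact (E.tight_miss h ho ih ha).2.2

/-- In a set of tight vertices which is closed under arcs, the number of vertices without incoming
arc is at most the number of vertices of maximum degree. -/
theorem card_sources_le (h : IsCol G u s f) {o : Fin D} (ho : f o u = u) (S : Finset V)
    (hS : ∀ y ∈ S, y ∈ Tight G f u s o) (hS' : ∀ y ∈ S, ∀ c, f c y = y → f c u ∈ S) :
    (S.filter fun z => ∀ c, f c u = z → ∀ y ∈ S, f c y ≠ y).card ≤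
      (S.filter fun y => G.degree y = D).card := by
  have h1 := Finset.card_filter_add_card_filter_not (s := S)
    (fun z => ∀ c, f c u = z → ∀ y ∈ S, f c y ≠ y)
  have h2 := Finset.card_filter_add_card_filter_not (s := S) (fun y => G.degree y = D)
  have h3 : (S.filter fun y => ¬ G.degree y = D).card ≤ ∑ y ∈ S, (miss f y).card := by
    rw [Finset.card_eq_sum_ones, Finset.sum_filter]
    refine Finset.sum_le_sum fun y hy => ?_
    have hyO := (hS y hy).1
    have := h.card_miss (ne_of_mem_out hyO) (ne_fan_of_mem_out hyO (self_mem_fan _ _ _))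
    split_ifs <;> omega
  have h4 : ∑ y ∈ S, (miss f y).card ≤
      (S.filter fun z => ¬ ∀ c, f c u = z → ∀ y ∈ S, f c y ≠ y).card := by
    rw [← Finset.card_sigma]
    refine Finset.card_le_card_of_injOn (fun p => f p.2 u) ?_ ?_
    · rintro ⟨y, a⟩ hp
      simp only [Finset.coe_sigma, Set.mem_sigma_iff, Finset.mem_coe, mem_miss] at hp
      simp only [Finset.coe_filter, Set.mem_ofPred_eq]
      exact ⟨hS' y hp.1 a hp.2, fun hh => hh a rfl y hp.1 hp.2⟩
    · rintro ⟨y, a⟩ hp ⟨z, b⟩ hq e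
      simp only [Finset.coe_sigma, Set.mem_sigma_iff, Finset.mem_coe, mem_miss] at hp hq e
      have hau := ne_of_mem_out (hS _ (hS' y hp.1 a hp.2)).1
      obtain rfl := h.inj a b u e hau
      obtain rfl := E.tight_elementary h ho (hS y hp.1) (hS z hq.1) hp.2 hq.2
      rfl
  omega

/-- Reachable sets from two tight vertices are disjoint, since arcs between tight vertices are
determined by their targets. -/
theorem tight_disjoint (h : IsCol G u s f) {o σ σ' : Fin D} (ho : f o u = u)
    (hz : f σ u ∈ Tight G f u s o) (hz' : f σ' u ∈ Tight G f u s o) (hne : σ ≠ σ')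
    (h1 : ∀ t, ReflTransGen (ArcIn f u (Out G f u s)) (f σ u) t → f σ' t ≠ t)
    (h2 : ∀ t, ReflTransGen (ArcIn f u (Out G f u s)) (f σ' u) t → f σ t ≠ t) {t : V}
    (ht : ReflTransGen (ArcIn f u (Out G f u s)) (f σ u) t) :
    ¬ ReflTransGen (ArcIn f u (Out G f u s)) (f σ' u) t := by
  induction ht with
  | refl =>
    intro ht'
    rcases ReflTransGen.cases_tail ht' with e | ⟨p, hp, ⟨a, ha, haq, -⟩, -⟩
    · exact hne (h.inj σ σ' u e (ne_of_mem_out hz.1))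
    · obtain rfl := h.inj σ a u haq.symm (ne_of_mem_out hz.1)
      exact h2 p hp ha
  | @tail p q hp hpq ih =>
    intro ht'
    obtain ⟨⟨a, ha, haq, hqu⟩, hqO⟩ := hpq
    rcases ReflTransGen.cases_tail ht' with e | ⟨y, hy, ⟨b, hb, hbq, -⟩, -⟩
    · obtain rfl := h.inj a σ' u (haq.trans e) (haq ▸ hqu)
      exact h1 p hp ha
    · obtain rfl := h.inj a b u (haq.trans hbq.symm) (haq ▸ hqu)
      obtain rfl := E.tight_elementary h ho (E.tight_reach h ho hz hp) (E.tight_reach h ho hz' hy)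
        ha hb
      exact ih hy

theorem exists_big_reach (h : IsCol G u s f) {o σ : Fin D} (ho : f o u = u)
    (hz : f σ u ∈ Tight G f u s o)
    (h1 : ∀ t, ReflTransGen (ArcIn f u (Out G f u s)) (f σ u) t → f σ t ≠ t) :
    ∃ t, ReflTransGen (ArcIn f u (Out G f u s)) (f σ u) t ∧ t ∈ Tight G f u s o ∧
      G.degree t = D := by
  set S : Finset V := Finset.univ.filter
    fun t => ReflTransGen (ArcIn f u (Out G f u s)) (f σ u) t with hS
  have h2 := E.card_sources_le h ho S
    (fun y hy => E.tight_reach h ho hz (by simpa [hS] using hy)) (by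
      intro y hy c hc
      have hy' : ReflTransGen (ArcIn f u (Out G f u s)) (f σ u) y := by simpa [hS] using hy
      have := (E.tight_miss h ho (E.tight_reach h ho hz hy') hc).2.2.1
      simp only [hS, Finset.mem_filter, Finset.mem_univ, true_and]
      exact hy'.tail ⟨⟨c, hc, rfl, ne_of_mem_out this⟩, this⟩)
  have h3 : 0 < (S.filter fun z => ∀ c, f c u = z → ∀ y ∈ S, f c y ≠ y).card := by
    refine Finset.card_pos.2 ⟨f σ u, ?_⟩
    simp only [hS, Finset.mem_filter, Finset.mem_univ, true_and]
    refine ⟨.refl, fun c hc y hy => ?_⟩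
    obtain rfl := h.inj σ c u hc.symm (ne_of_mem_out hz.1)
    exact h1 y hy
  obtain ⟨t, ht⟩ := Finset.card_pos.1 (h3.trans_le h2)
  simp only [hS, Finset.mem_filter, Finset.mem_univ, true_and] at ht
  exact ⟨t, ht.1, E.tight_reach h ho hz ht.1, ht.2⟩

end Extremal

/-- The neighbors of the center of degree `D` outside the fan. -/
noncomputable def bigOut (D : ℕ) (G : SimpleGraph V) [DecidableRel G.Adj] (f : Fin D → V → V)
    (u s : V) : Finset V :=
  Finset.univ.filter fun y => y ∈ Out G f u s ∧ G.degree y = D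

namespace Maximal

variable (E : Maximal D G u s B m)
include E

/-- The colors `σ` of the edges `x v` lead to distinct tight vertices without incoming arc from a tight
vertex, and `Extremal.card_sources_le` bounds their number. -/
theorem card_robust_le (T : IsMaxTree G u s B m f P v α) :
    (Finset.univ.filter fun x => Robust D G f u s x ∧ G.degree x < D ∧ ∃ σ, f σ x = v).card ≤
      (bigOut D G f u s).card := by
  obtain ⟨o, ho, -⟩ := T.good.col.exists_center E.center
  set Q : Finset V := Finset.univ.filter (· ∈ Tight G f u s o) with hQ
  have h1 := E.card_sources_le T.good.col ho Q (fun y hy => by simpa [hQ] using hy) (by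
    intro y hy c hc
    simpa [hQ] using (E.tight_miss T.good.col ho (by simpa [hQ] using hy) hc).2.2)
  refine (le_trans ?_ h1).trans (Finset.card_le_card ?_)
  · refine Finset.card_le_card_of_forall_subsingleton
      (fun x z => ∃ σ, f σ x = v ∧ f σ u = z ∧ z ≠ u) ?_ ?_
    · intro x hx
      simp only [Finset.mem_filter, Finset.mem_univ, true_and] at hx
      obtain ⟨hxR, hxD, σ, hσ⟩ := hx
      obtain ⟨i1, i2, i3⟩ := E.robust_adj_root T ho hxR hxD hσ
      refine ⟨f σ u, ?_, σ, hσ, rfl, ne_of_mem_out i1⟩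
      simp only [hQ, Finset.mem_filter, Finset.mem_univ, true_and]
      refine ⟨⟨i1, i2⟩, fun c hc y hy => ?_⟩
      obtain rfl := T.good.col.inj σ c u hc.symm (ne_of_mem_out i1)
      exact i3 y hy.1 hy.2
    · rintro z - x ⟨-, σ, hσ, hz, hzu⟩ y ⟨-, σ', hσ', hz', -⟩
      obtain rfl := T.good.col.inj σ σ' u (hz.trans hz'.symm) (hz ▸ hzu)
      exact T.good.col.injective σ (hσ.trans hσ'.symm)
  · intro y hy
    simp only [hQ, Finset.mem_filter, Finset.mem_univ, true_and] at hy
    simpa [bigOut] using ⟨hy.1.1, hy.2⟩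

/-- The sets reached from the vertices `f σ u` are disjoint, and each contains a vertex of degree
`D`. -/
theorem card_fan_adj_le (T : IsMaxTree G u s B m f P v α) :
    (Finset.univ.filter fun x => x ∈ Fan f u s ∧ G.degree x < D ∧ ∃ σ, f σ x = v).card ≤
      (bigOut D G f u s).card := by
  obtain ⟨o, ho, -⟩ := T.good.col.exists_center E.center
  refine Finset.card_le_card_of_forall_subsingleton
    (fun x t => ∃ σ, f σ x = v ∧ ReflTransGen (ArcIn f u (Out G f u s)) (f σ u) t) ?_ ?_
  · intro x hx
    simp only [Finset.mem_filter, Finset.mem_univ, true_and] at hx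
    obtain ⟨hxF, hxD, σ, hσ⟩ := hx
    obtain ⟨i1, i2, i3⟩ := E.fan_adj_root T ho hxF hxD hσ
    obtain ⟨t, h1, h2, h3⟩ := E.exists_big_reach T.good.col ho ⟨i1, i2⟩ i3
    exact ⟨t, by simpa [bigOut] using ⟨h2.1, h3⟩, σ, hσ, h1⟩
  · rintro t - x ⟨hx, σ, hσ, hxt⟩ y ⟨hy, σ', hσ', hyt⟩
    simp only [Finset.mem_filter, Finset.mem_univ, true_and] at hx hy
    by_contra hne
    have hyx : y ≠ x := fun e => hne e.symm
    obtain ⟨i1, i2, -⟩ := E.fan_adj_root T ho hx.1 hx.2.1 hσ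
    obtain ⟨j1, j2, -⟩ := E.fan_adj_root T ho hy.1 hy.2.1 hσ'
    refine E.tight_disjoint T.good.col ho ⟨i1, i2⟩ ⟨j1, j2⟩ ?_ ?_ ?_ hxt hyt
    · rintro rfl
      exact hne (T.good.col.injective _ (hσ.trans hσ'.symm))
    · intro t ht
      exact E.fan_adj_root_disjoint T hx.1 hx.2.1 hσ hy.1 hy.2.1 hσ' hne ht
    · intro t ht
      exact E.fan_adj_root_disjoint T hy.1 hy.2.1 hσ' hx.1 hx.2.1 hσ hyx ht

/-- The common neighbors of the center, the hole and the root are few. -/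
theorem card_common_le (T : IsMaxTree G u s B m f P v α) :
    (Finset.univ.filter fun x => G.Adj u x ∧ G.Adj s x ∧ G.Adj v x).card ≤
      (bigFan G f u s).card + 4 * (bigOut D G f u s).card + 1 := by
  have h := T.good.col
  have hvu := ne_of_mem_out T.mem_out
  obtain ⟨o, ho, -⟩ := h.exists_center E.center
  -- the neighbors of the hole that are not robust, as far as their edges to the hole are concerned
  set NR : Finset V := Finset.univ.filter fun x =>
    ∃ τ, f τ s = x ∧ (f τ u = u ∨ f τ u ∈ bigOut D G f u s) with hNR
  have c1 : NR.card ≤ (bigOut D G f u s).card + 1 := by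
    refine le_trans ?_ (Finset.card_insert_le u _)
    refine Finset.card_le_card_of_forall_subsingleton (fun x w => ∃ τ, f τ s = x ∧ f τ u = w) ?_ ?_
    · intro x hx
      simp only [hNR, Finset.mem_filter, Finset.mem_univ, true_and] at hx
      obtain ⟨τ, hτ, hx⟩ := hx
      exact ⟨f τ u, Finset.mem_insert.2 hx, τ, hτ, rfl⟩
    · rintro w - x ⟨-, τ, hτ, hw⟩ y ⟨-, τ', hτ', hw'⟩
      have : τ = τ' := by
        rcases eq_or_ne w u with rfl | hwu
        · exact h.center_unique E.center hw' τ hw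
        · exact h.inj τ τ' u (hw.trans hw'.symm) (hw ▸ hwu)
      rw [← hτ, ← hτ', this]
  have c2 := E.card_robust_le T
  have c3 := E.card_fan_adj_le T
  set X1 := Finset.univ.filter fun x => Robust D G f u s x ∧ G.degree x < D ∧ ∃ σ, f σ x = v
  set X2 := Finset.univ.filter fun x => x ∈ Fan f u s ∧ G.degree x < D ∧ ∃ σ, f σ x = v
  have hsub : (Finset.univ.filter fun x => G.Adj u x ∧ G.Adj s x ∧ G.Adj v x) ⊆
      (((bigFan G f u s ∪ bigOut D G f u s) ∪ X1) ∪ X2) ∪ NR := by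
    intro y hy
    simp only [Finset.mem_filter, Finset.mem_univ, true_and] at hy
    obtain ⟨hyu, hys, hyv⟩ := hy
    simp only [Finset.mem_union, X1, X2, hNR, Finset.mem_filter, Finset.mem_univ, true_and, bigFan,
      bigOut, mem_fanFinset]
    obtain ⟨σ, hσ⟩ := h.surj y v hyv.symm (fun e => hyu.ne e.1.symm) (fun e => hvu e.2)
    obtain ⟨τ, hτ⟩ := h.surj s y hys (fun e => h.ne e.1.symm) (fun e => hyu.ne e.2.symm)
    rcases (E.le y).eq_or_lt with hyD | hyD
    · by_cases hyF : y ∈ Fan f u s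
      · exact .inl (.inl (.inl (.inl ⟨hyF, hyD⟩)))
      · exact .inl (.inl (.inl (.inr ⟨⟨hyu, hyF⟩, hyD⟩)))
    by_cases hyF : y ∈ Fan f u s
    · exact .inl (.inr ⟨hyF, hyD, σ, hσ⟩)
    by_cases hyN : f τ u = u ∨ f τ u ∈ Out G f u s ∧ G.degree (f τ u) = D
    · exact .inr ⟨τ, hτ, hyN⟩
    · push Not at hyN
      refine .inl (.inl (.inr ⟨⟨⟨hyu, hyF⟩, τ, hτ, hyN.1, ?_⟩, hyD, σ, hσ⟩))
      rintro d hd hdD rfl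
      exact hyN.2 hd hdD
  have c4 := Finset.card_le_card hsub
  have c5 := Finset.card_union_le (((bigFan G f u s ∪ bigOut D G f u s) ∪ X1) ∪ X2) NR
  have c6 := Finset.card_union_le ((bigFan G f u s ∪ bigOut D G f u s) ∪ X1) X2
  have c7 := Finset.card_union_le (bigFan G f u s ∪ bigOut D G f u s) X1
  have c8 := Finset.card_union_le (bigFan G f u s) (bigOut D G f u s)
  omega

end Maximal

end

/-! ### Existence of an extremal configuration -/

section

variable {V : Type*} {D : ℕ} {G : SimpleGraph V} {u s : V} {f : Fin D → V → V}
variable [Fintype V] [DecidableRel G.Adj] {B m : ℕ} {P : Set V} {v : V} {α : Fin D}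

theorem card_bigFan_le_of_weight_le {f' : Fin D → V → V} {s' : V}
    (h : weight G f u s ≤ weight G f' u s') :
    (bigFan G f u s).card ≤ (bigFan G f' u s').card := by
  by_contra hlt
  have h1 : (fanFinset f' u s').card ≤ Fintype.card V := Finset.card_le_univ _
  have h2 : (Fintype.card V + 1) * ((bigFan G f' u s').card + 1) ≤
      (Fintype.card V + 1) * (bigFan G f u s).card := Nat.mul_le_mul_left _ (by omega)
  rw [mul_add] at h2
  simp only [weight] at h
  omega

/-- The hole can be moved so that one of the missing colors of the hole leads to a vertex of
maximum degree. -/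
theorem exists_good (hno : ∀ f : Fin D → V → V, ¬ IsFull G f) (hdu : G.degree u = D)
    (h : IsCol G u s f) (hs : G.degree s < D) (ht : HasToken G f u s) :
    ∃ (s' : V) (f' : Fin D → V → V), G.degree s' < D ∧ HasToken G f' u s' ∧
      Good G u s' (weight G f u s) f' := by
  obtain ⟨o, ho, -⟩ := h.exists_center hdu
  have h1 := h.fan_big hno ho
  obtain ⟨d, hd⟩ := Finset.card_pos.1
    (by omega : 0 < (Finset.univ.filter fun y => y ∈ Fan f u s ∧ y ≠ s ∧ G.degree y = D).card)
  simp only [Finset.mem_filter, Finset.mem_univ, true_and] at hd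
  obtain ⟨hdF, hds, hdD⟩ := hd
  obtain ⟨p, hp, a, ha, had, hdu'⟩ := exists_arc_of_mem_fan hdF hds
  have hdm := h.miss_eq_empty hdu' hdD hs
  have hdp : d ≠ p := by rintro rfl; exact hdm a ha
  obtain ⟨f', h', hF, hm, hu, hp', hst, hst'⟩ := h.exists_moveHole hp
  have hpD : G.degree p < D := by
    rcases eq_or_ne p s with rfl | hps
    · exact hs
    · have := h.card_miss (h.ne_of_mem_fan hp) hps
      have : 0 < (miss f p).card := Finset.card_pos.2 ⟨a, mem_miss.2 ha⟩
      omega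
  have hau : f' a u = d := by
    rw [h'.eq_iff, hst' d hdu' hdp hdm]
    exact h.eq_iff.1 had
  obtain ⟨v, c, hv, hc, hcA⟩ := ht
  refine ⟨p, f', hpD, ⟨v, c, ⟨hv.1, hF.symm ▸ hv.2⟩, ?_, ?_⟩, h', ?_, a, hp' a ha,
    hau.symm ▸ hdu', hau.symm ▸ hdD⟩
  · rw [hst v (ne_of_mem_out hv) hv.2, hc]
  · unfold ACol at hcA ⊢
    rw [hF, hm, hu]
    exact hcA
  · simp only [weight, bigFan, fanFinset, hF, le_refl]

/-- Take a largest in-tree rooted at a token, and change the missing color of the root in two exchanges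
to a color of the hole. The tree is not affected, since its arcs use colors that are not missing in
the fan or at the center. -/
theorem Extremal.exists_maxTree (E : Extremal D G u s B) (h : Good G u s B f)
    (ht : HasToken G f u s) :
    ∃ (m : ℕ) (f : Fin D → V → V) (P : Set V) (v : V) (α : Fin D), Maximal D G u s B m ∧
      IsMaxTree G u s B m f P v α := by
  let C : Set ((Fin D → V → V) × Set V × V × Fin D) := {q | Good G u s B q.1 ∧
    q.1 q.2.2.2 q.2.2.1 = q.2.2.1 ∧ ACol q.1 u s q.2.2.2 ∧ InTree G q.1 u s q.2.1 q.2.2.1}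
  have hne : C.Nonempty := by
    obtain ⟨v, c, hv, hc, hcA⟩ := ht
    refine ⟨(f, {v}, v, c), h, hc, hcA, rfl, by simpa using hv, ?_⟩
    rintro y rfl
    exact .refl
  obtain ⟨⟨f, P, v, c⟩, ⟨hg, hc, hcA, hP⟩, hmax⟩ :=
    Set.exists_max_image C (fun q => q.2.1.ncard) (Set.toFinite _) hne
  simp only at hg hc hcA hP hmax
  obtain ⟨o, ho, hou⟩ := hg.col.exists_center E.center
  have hvO := hP.subset hP.root
  have hvu := ne_of_mem_out hvO
  obtain ⟨f1, h1, e1, hu1, hov, hoth, -⟩ :=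
    hg.col.exists_token_center E.hno ho hou hvO.2 hvu hc hcA
  have g1 := hg.feq h1 e1
  have hP1 : InTree G f1 u s P v := hP.congr e1 fun a ha => by
    have haA := not_acol_of_mem_out (hP.subset ha)
    exact hoth a (by rintro rfl; exact haA (.inl ho)) (by rintro rfl; exact haA hcA)
  have ho1 := (hu1 o).trans ho
  obtain ⟨α, hα, -⟩ := g1.leaf
  have hsF := self_mem_fan f1 u s
  have hvO1 := hP1.subset hP1.root
  have hvS := h1.notMem_comp E.hno ho1 hsF hα (ne_fan_of_mem_out hvO1 hsF) hvu (.inl hov)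
  have e2 := h1.feq_kswap_comp E.hno ho1 hvS
  refine ⟨P.ncard, kswap f1 o α (comp f1 o α v), P, v, α, ⟨E, ?_⟩,
    g1.feq (h1.kswap (comp_closed f1 o α v)) e2, hP1.congr e2 fun a ha => ?_, le_rfl, ?_, ?_⟩
  · intro f' P' v' c' i1 i2 i3 i4
    exact hmax (f', P', v', c') ⟨i1, i2, i3, i4⟩
  · have haA := not_acol_of_mem_out (hP1.subset ha)
    intro y
    rw [kswap_of_ne]
    · rintro rfl; exact haA (.inl ho1)
    · rintro rfl; exact haA (.inr ⟨s, hsF, hα⟩)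
  · exact (e2.miss s hsF α).2 hα
  · rw [kswap_right (mem_comp_self _ _ _ _), hov]

/-- If for every edge from `u` to a vertex of small degree there is a coloring of the other edges that
has a token, then the maximum degree is bounded in terms of the number of neighbors of `u` of maximum
degree. -/
theorem three_mul_degree_le (hno : ∀ f : Fin D → V → V, ¬ IsFull G f) (hdu : G.degree u = D)
    (hle : ∀ x, G.degree x ≤ D)
    (hex : ∃ s, G.Adj u s ∧ G.degree s < D)
    (H : ∀ s, G.Adj u s → G.degree s < D → ∃ f : Fin D → V → V, IsCol G u s f ∧ HasToken G f u s) :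
    3 * D + 1 ≤ 2 * Fintype.card V +
      4 * (Finset.univ.filter fun y => G.Adj u y ∧ G.degree y = D).card := by
  let C : Set (V × (Fin D → V → V)) := {q | G.degree q.1 < D ∧ IsCol G u q.1 q.2 ∧
    HasToken G q.2 u q.1}
  have hne : C.Nonempty := by
    obtain ⟨s, h1, h2⟩ := hex
    obtain ⟨f, h3, h4⟩ := H s h1 h2
    exact ⟨(s, f), h2, h3, h4⟩
  obtain ⟨⟨s0, f0⟩, ⟨hs0, h0, ht0⟩, hmax⟩ :=
    Set.exists_max_image C (fun q => weight G q.2 u q.1) (Set.toFinite _) hne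
  simp only at hs0 h0 ht0 hmax
  obtain ⟨s, f1, hs, ht1, hg1⟩ := exists_good hno hdu h0 hs0 ht0
  have E : Extremal D G u s (weight G f0 u s0) := ⟨hno, hdu, hs, hle, fun f h ht =>
    hmax (s, f) ⟨hs, h, ht⟩⟩
  obtain ⟨m, f, P, v, α, M, T⟩ := E.exists_maxTree hg1 ht1
  have h := T.good.col
  have hvO := T.mem_out
  have hvD : G.degree v < D := by
    have := h.card_miss (ne_of_mem_out hvO) (ne_fan_of_mem_out hvO (self_mem_fan _ _ _))
    have : 0 < (miss f v).card := Finset.card_pos.2 ⟨α, mem_miss.2 T.root_miss⟩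
    omega
  have key : ∀ x, G.Adj u x → G.degree x < D → D + 1 ≤ G.degree x + (bigFan G f u s).card := by
    intro x hx hxD
    obtain ⟨fx, h1, h2⟩ := H x hx hxD
    obtain ⟨o, ho, -⟩ := h1.exists_center hdu
    have h3 : (bigFan G fx u x).card ≤ (bigFan G f u s).card :=
      card_bigFan_le_of_weight_le ((hmax (x, fx) ⟨hxD, h1, h2⟩).trans T.good.le_weight)
    have h4 := h1.fan_big hno ho
    have h5 : (Finset.univ.filter fun y => y ∈ Fan fx u x ∧ y ≠ x ∧ G.degree y = D).card ≤
        (bigFan G fx u x).card := by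
      refine Finset.card_le_card fun y hy => ?_
      simp only [Finset.mem_filter, Finset.mem_univ, true_and] at hy
      simpa [bigFan] using ⟨hy.1, hy.2.2⟩
    omega
  have k1 := key s h.hadj hs
  have k2 := key v hvO.1 hvD
  have c1 := M.card_common_le T
  have c2 : (bigFan G f u s).card + (bigOut D G f u s).card ≤
      (Finset.univ.filter fun y => G.Adj u y ∧ G.degree y = D).card := by
    rw [← Finset.card_union_of_disjoint]
    · refine Finset.card_le_card fun y hy => ?_
      simp only [Finset.mem_union, bigFan, bigOut, Finset.mem_filter, Finset.mem_univ, true_and,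
        mem_fanFinset] at hy ⊢
      rcases hy with hy | hy
      · exact ⟨h.adj_of_mem_fan hy.1, hy.2⟩
      · exact ⟨hy.1.1, hy.2⟩
    · rw [Finset.disjoint_left]
      intro y hy hy'
      simp only [bigFan, bigOut, Finset.mem_filter, Finset.mem_univ, true_and,
        mem_fanFinset] at hy hy'
      exact hy'.1.2 hy.1
  have c3 : (Finset.univ.filter fun x => G.Adj u x ∧ G.Adj s x ∧ G.Adj v x) =
      (G.neighborFinset u ∩ G.neighborFinset s) ∩ G.neighborFinset v := by
    ext x; simp
  have c4 := Finset.card_union_add_card_inter (G.neighborFinset u) (G.neighborFinset s)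
  have c5 := Finset.card_union_add_card_inter (G.neighborFinset u ∩ G.neighborFinset s)
    (G.neighborFinset v)
  have c6 := Finset.card_le_univ (G.neighborFinset u ∪ G.neighborFinset s)
  have c7 := Finset.card_le_univ
    (G.neighborFinset u ∩ G.neighborFinset s ∪ G.neighborFinset v)
  simp only [SimpleGraph.card_neighborFinset_eq_degree] at c4 c5
  rw [c3] at c1
  omega

end

/-! ### Elementary neighborhoods of the center -/

section

variable {V : Type*} {D : ℕ} {G : SimpleGraph V} {u s : V} {f : Fin D → V → V}

/-- The closed neighborhood of `u`. -/
def Near (G : SimpleGraph V) (u : V) : Set V := {y | y = u ∨ G.Adj u y}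

/-- No two vertices of the closed neighborhood of `u` miss the same color. -/
def NearElementary (G : SimpleGraph V) (u : V) (f : Fin D → V → V) : Prop :=
  ∀ y ∈ Near G u, ∀ z ∈ Near G u, ∀ a, f a y = y → f a z = z → y = z

variable [Fintype V] [DecidableRel G.Adj]

/-- If the closed neighborhood of the center is not elementary, then there is a token. -/
theorem exists_hasToken (hno : ∀ f : Fin D → V → V, ¬ IsFull G f) (hdu : G.degree u = D)
    (h : IsCol G u s f) (hf : ¬ NearElementary G u f) :
    ∃ f : Fin D → V → V, IsCol G u s f ∧ HasToken G f u s := by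
  obtain ⟨o, ho, hou⟩ := h.exists_center hdu
  have center : ∀ z, G.Adj u z → f o z = z → ∃ f : Fin D → V → V, IsCol G u s f ∧ HasToken G f u s :=
    fun z hz hoz => ⟨f, h, z, o, ⟨hz, fun hh => h.fan_not_center_miss hno ho hh hoz⟩, hoz, .inl ho⟩
  simp only [NearElementary] at hf
  push Not at hf
  obtain ⟨y, hy, z, hz, a, hay, haz, hyz⟩ := hf
  rcases hy with rfl | hy
  · rcases hz with rfl | hz
    · exact absurd rfl hyz
    · obtain rfl := hou a hay
      exact center z hz haz
  rcases hz with rfl | hz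
  · obtain rfl := hou a haz
    exact center y hy hay
  by_cases hyF : y ∈ Fan f u s
  · have hzF : z ∉ Fan f u s := fun hh => hyz (h.fan_elementary hno ho hyF hh hay haz)
    exact ⟨f, h, z, a, ⟨hz, hzF⟩, haz, .inr ⟨y, hyF, hay⟩⟩
  by_cases hzF : z ∈ Fan f u s
  · exact ⟨f, h, y, a, ⟨hy, hyF⟩, hay, .inr ⟨z, hzF, haz⟩⟩
  have key : ∀ w, G.Adj u w → f a w = w → w ∉ Fan f u s → w ∉ comp f o a u →
      ∃ f : Fin D → V → V, IsCol G u s f ∧ HasToken G f u s := by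
    intro w hw haw hwF hwS
    have huS : u ∉ comp f o a w := fun hh => hwS (h.comp_symm hh)
    have e := h.feq_kswap_comp hno ho hwS
    refine ⟨_, h.kswap (comp_closed f o a w), w, o, ⟨hw, e.fan_eq.symm ▸ hwF⟩, ?_, .inl ?_⟩
    · rw [kswap_left (mem_comp_self _ _ _ _), haw]
    · rw [kswap_of_notMem huS, ho]
  by_cases hyS : y ∈ comp f o a u
  · exact key z hz haz hzF fun hh =>
      hyz (h.two_ends ho hyS hh (.inr hay) (.inr haz) hy.ne' hz.ne')
  · exact key y hy hay hyF hyS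

section
variable (hH : ∀ f : Fin D → V → V, IsCol G u s f → NearElementary G u f) (hdu : G.degree u = D)
include hH hdu

/-- A vertex outside the closed neighborhood of the center can exchange a missing color, within the
colors missing in that neighborhood, without any effect on the missing colors there. -/
theorem exists_swap_far (h : IsCol G u s f) {o c : Fin D} (ho : f o u = u) (hco : c ≠ o)
    {y z : V} (hy : y ∈ Near G u) (hcy : f c y = y) (hz : z ∉ Near G u)
    (hz' : f o z = z ∨ f c z = z) :
    ∃ f' : Fin D → V → V, IsCol G u s f' ∧ f' o z = f c z ∧ f' c z = f o z ∧
      (∀ a, a ≠ o → a ≠ c → ∀ w, f' a w = f a w) ∧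
      (∀ w ∈ Near G u, ∀ a, f' a w = w ↔ f a w = w) := by
  have huN : u ∈ Near G u := .inl rfl
  have hyu : y ≠ u := by
    rintro rfl
    exact hco (h.center_unique hdu ho c hcy)
  have hyS : y ∈ comp f o c u := by
    by_contra hcon
    have huS : u ∉ comp f o c y := fun hh => hcon (h.comp_symm hh)
    refine hyu (hH _ (h.kswap (comp_closed f o c y)) y hy u huN o ?_ ?_)
    · rw [kswap_left (mem_comp_self _ _ _ _), hcy]
    · rw [kswap_of_notMem huS, ho]
  have hzS : z ∉ comp f o c u := fun hh => hz <|
    h.two_ends ho hyS hh (.inr hcy) hz' hyu (fun e => hz (.inl e)) ▸ hy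
  have huS : u ∉ comp f o c z := fun hh => hzS (h.comp_symm hh)
  have hyS' : y ∉ comp f o c z := fun hh => hzS (IsCol.comp_trans hyS (h.comp_symm hh))
  refine ⟨_, h.kswap (comp_closed f o c z), kswap_left (mem_comp_self _ _ _ _),
    kswap_right (mem_comp_self _ _ _ _), fun a h1 h2 w => kswap_of_ne h1 h2, fun w hw a => ?_⟩
  by_cases hwS : w ∈ comp f o c z
  · have how : f o w ≠ w := fun hh => huS (hH f h w hw u huN o hh ho ▸ hwS)
    have hcw : f c w ≠ w := fun hh => hyS' (hH f h w hw y hy c hh hcy ▸ hwS)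
    rcases eq_or_ne a o with rfl | hao
    · rw [kswap_left hwS]; exact ⟨fun e => absurd e hcw, fun e => absurd e how⟩
    rcases eq_or_ne a c with rfl | hac
    · rw [kswap_right hwS]; exact ⟨fun e => absurd e how, fun e => absurd e hcw⟩
    rw [kswap_of_ne hao hac]
  · rw [kswap_of_notMem hwS]

/-- The colors of the edges from `z` to the common neighbors with `u` of small degree are too many to
avoid all colors missing in the closed neighborhood of `u`. -/
theorem exists_missing_color (h : IsCol G u s f) (hs : G.degree s < D) {z : V}
    (hz : z ∉ Near G u)
    (hX : (Finset.univ.filter fun x => G.Adj u x ∧ G.degree x = D).card ≤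
      (Finset.univ.filter fun x => G.Adj u x ∧ G.Adj z x ∧ G.degree x < D).card + 1) :
    ∃ κ, G.Adj u (f κ z) ∧ G.degree (f κ z) < D ∧ ∃ y ∈ Near G u, f κ y = y := by
  set X := Finset.univ.filter fun x => G.Adj u x ∧ G.Adj z x ∧ G.degree x < D with hXdef
  set AN : Finset (Fin D) := Finset.univ.filter fun a => ∃ y ∈ Near G u, f a y = y with hAN
  set KX : Finset (Fin D) := Finset.univ.filter fun a => f a z ∈ X with hKX
  have c1 : X.card ≤ KX.card := by
    refine Finset.card_le_card_of_surjOn (fun a => f a z) ?_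
    intro x hx
    have hx' : x ∈ X := hx
    have hxx := hx'
    simp only [hXdef, Finset.mem_filter, Finset.mem_univ, true_and] at hxx
    obtain ⟨a, ha⟩ := h.surj z x hxx.2.1 (fun e => hz (.inl e.1))
      (fun e => hxx.1.ne e.2.symm)
    exact ⟨a, by simpa [hKX, ha] using hx', ha⟩
  have c2 : D + 2 ≤
      AN.card + (Finset.univ.filter fun x => G.Adj u x ∧ G.degree x = D).card := by
    have i1 : (insert u (G.neighborFinset u)).biUnion (miss f) ⊆ AN := by
      intro a ha
      obtain ⟨y, hy, hay⟩ := Finset.mem_biUnion.1 ha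
      simp only [hAN, Finset.mem_filter, Finset.mem_univ, true_and]
      refine ⟨y, ?_, mem_miss.1 hay⟩
      simpa [Near] using hy
    have i2 := Finset.card_le_card i1
    have hdis : ∀ x ∈ insert u (G.neighborFinset u), ∀ y ∈ insert u (G.neighborFinset u), x ≠ y →
        Disjoint (miss f x) (miss f y) := by
      intro x hx y hy hxy
      rw [Finset.disjoint_left]
      intro a hax hay
      exact hxy (hH f h x (by simpa [Near] using hx) y (by simpa [Near] using hy) a
        (mem_miss.1 hax) (mem_miss.1 hay))
    rw [Finset.card_biUnion hdis, Finset.sum_insert (by simp)] at i2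
    have i3 := h.card_miss_center
    have i4 : ∑ x ∈ G.neighborFinset u, ((if G.degree x = D then 0 else 1) +
        if x = s then 1 else 0) ≤ ∑ x ∈ G.neighborFinset u, (miss f x).card := by
      refine Finset.sum_le_sum fun x hx => ?_
      have hxu : x ≠ u := by
        rintro rfl; simp at hx
      rcases eq_or_ne x s with rfl | hxs
      · have := h.card_miss_hole
        rw [if_neg (by omega), if_pos rfl]
        omega
      · have := h.card_miss hxu hxs
        rw [if_neg hxs]
        split_ifs <;> omega
    have i5 : ∑ x ∈ G.neighborFinset u, (if x = s then 1 else 0) = 1 := by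
      rw [Finset.sum_ite_eq', if_pos (by simpa using h.hadj)]
    have i6 : ∑ x ∈ G.neighborFinset u, (if G.degree x = D then 0 else 1) +
        (Finset.univ.filter fun x => G.Adj u x ∧ G.degree x = D).card = D := by
      have j1 : (Finset.univ.filter fun x => G.Adj u x ∧ G.degree x = D) =
          (G.neighborFinset u).filter fun x => G.degree x = D := by ext; simp
      have j2 : ∑ x ∈ G.neighborFinset u, (if G.degree x = D then 0 else 1) =
          ((G.neighborFinset u).filter fun x => ¬ G.degree x = D).card := by
        rw [Finset.card_eq_sum_ones, Finset.sum_filter]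
        refine Finset.sum_congr rfl fun x _ => ?_
        split_ifs <;> simp_all
      have j3 := Finset.card_filter_add_card_filter_not (s := G.neighborFinset u)
        (fun x => G.degree x = D)
      rw [G.card_neighborFinset_eq_degree, hdu] at j3
      rw [j1, j2]
      omega
    rw [Finset.sum_add_distrib] at i4
    omega
  by_contra hcon
  push Not at hcon
  have hdisj : Disjoint KX AN := by
    rw [Finset.disjoint_left]
    intro a ha ha'
    simp only [hKX, hAN, hXdef, Finset.mem_filter, Finset.mem_univ, true_and] at ha ha'
    obtain ⟨y, hy, hay⟩ := ha'
    exact hcon a ha.1 ha.2.2 y hy hay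
  have c3 := Finset.card_le_univ (KX ∪ AN)
  rw [Finset.card_union_of_disjoint hdisj, Fintype.card_fin] at c3
  omega

/-- If `z` missed a color `c` that is missing near the center, then after two exchanges `z` and a
neighbor `x` as in `exists_missing_color` would miss a common color `σ`. Recoloring `x z` with `σ`
frees the color `κ` at `x`, which is missing at another vertex near the center. -/
theorem far_ne (h : IsCol G u s f) (hs : G.degree s < D) {z : V}
    (hz : z ∉ Near G u)
    (hX : (Finset.univ.filter fun x => G.Adj u x ∧ G.degree x = D).card ≤
      (Finset.univ.filter fun x => G.Adj u x ∧ G.Adj z x ∧ G.degree x < D).card + 1)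
    {y : V} (hy : y ∈ Near G u) {c : Fin D} (hcy : f c y = y) : f c z ≠ z := by
  intro hcz
  obtain ⟨o, ho, -⟩ := h.exists_center hdu
  have huN : u ∈ Near G u := .inl rfl
  obtain ⟨f1, h1, ho1, hoz1⟩ : ∃ f1 : Fin D → V → V, IsCol G u s f1 ∧ f1 o u = u ∧ f1 o z = z := by
    rcases eq_or_ne c o with rfl | hco
    · exact ⟨f, h, ho, hcz⟩
    · obtain ⟨f1, h1, h2, -, -, h3⟩ := exists_swap_far hH hdu h ho hco hy hcy hz (.inr hcz)
      exact ⟨f1, h1, (h3 u huN o).2 ho, h2.trans hcz⟩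
  obtain ⟨κ, hx, hxD, y', hy', hκy⟩ := exists_missing_color hH hdu h1 hs hz hX
  set x := f1 κ z with hκ
  have hxN : x ∈ Near G u := .inr hx
  have hxz : x ≠ z := fun e => hz (e ▸ hxN)
  have hκx : f1 κ x = z := h1.inv _ _
  obtain ⟨σ, hσ⟩ := h1.exists_miss hx.ne' hxD
  have hσo : σ ≠ o := by
    rintro rfl
    exact hx.ne' (hH f1 h1 x hxN u huN σ hσ ho1)
  have hκo : κ ≠ o := by rintro rfl; exact hxz (hκ.trans hoz1)
  have hκσ : κ ≠ σ := by rintro rfl; exact hxz (hσ.symm.trans hκx)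
  obtain ⟨f2, h2, -, hσz, hoth, hmiss⟩ := exists_swap_far hH hdu h1 ho1 hσo hxN hσ hz (.inl hoz1)
  have hσx2 := (hmiss x hxN σ).2 hσ
  have hκx2 : f2 κ x = z := by rw [hoth κ hκo hκσ, hκx]
  have hκy2 := (hmiss y' hy' κ).2 hκy
  have hyx : y' ≠ x := by
    intro e
    rw [e] at hκy2
    exact hxz (hκy2.symm.trans hκx2)
  have hyz : y' ≠ z := fun e => hz (e ▸ hy')
  refine hyx (hH _ (h2.kswap_pair hσx2 (hσz.trans hoz1) hκx2) y' hy' x hxN κ ?_ ?_)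
  · rw [kswap_of_notMem (by simp [hyx, hyz]), hκy2]
  · rw [kswap_right (by simp), hσx2]

/-- If the closed neighborhood of the center is elementary in all colorings, then the whole vertex
set is. -/
theorem elementary_of_near (h : IsCol G u s f) (hs : G.degree s < D)
    (hX : ∀ z, z ∉ Near G u → (Finset.univ.filter fun x => G.Adj u x ∧ G.degree x = D).card ≤
      (Finset.univ.filter fun x => G.Adj u x ∧ G.Adj z x ∧ G.degree x < D).card + 1)
    {y z : V} {c : Fin D} (hcy : f c y = y) (hcz : f c z = z) : y = z := by
  obtain ⟨o, ho, -⟩ := h.exists_center hdu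
  have huN : u ∈ Near G u := .inl rfl
  by_cases hy : y ∈ Near G u
  · by_cases hz : z ∈ Near G u
    · exact hH f h y hy z hz c hcy hcz
    · exact absurd hcz (far_ne hH hdu h hs hz (hX z hz) hy hcy)
  by_cases hz : z ∈ Near G u
  · exact absurd hcy (far_ne hH hdu h hs hy (hX y hy) hz hcz)
  by_contra hyz
  have key : ∀ w, w ∉ Near G u → f c w = w → w ∈ comp f o c u := by
    intro w hw hcw
    by_contra hwS
    have huS : u ∉ comp f o c w := fun hh => hwS (h.comp_symm hh)
    refine far_ne hH hdu (h.kswap (comp_closed f o c w)) hs hw (hX w hw) huN (c := o) ?_ ?_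
    · rw [kswap_of_notMem huS, ho]
    · rw [kswap_left (mem_comp_self _ _ _ _), hcw]
  exact hyz (h.two_ends ho (key y hy hcy) (key z hz hcz) (.inr hcy) (.inr hcz)
    (fun e => hy (.inl e)) (fun e => hz (.inl e)))

end

/-- An elementary coloring of all edges but one forces the graph to be overfull. -/
theorem overfull_of_elementary (h : IsCol G u s f) (hdu : G.degree u = D)
    (hf : ∀ y z c, f c y = y → f c z = z → y = z) :
    D * (Fintype.card V / 2) < G.edgeFinset.card := by
  obtain ⟨o, ho, -⟩ := h.exists_center hdu
  -- the only fixed point of the involution `f o` is `u`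
  have hodd : Fintype.card V % 2 = 1 := by
    let p : Function.End V := f o
    have hp : p ^ 2 ^ 1 = 1 := by
      rw [pow_one, pow_two]
      exact funext (h.inv o)
    have : Fact (Nat.Prime 2) := ⟨Nat.prime_two⟩
    have h1 := Equiv.Perm.card_fixedPoints_modEq (p := 2) (n := 1) hp
    have h2 : Fintype.card (Function.fixedPoints p) = 1 := by
      rw [Fintype.card_eq_one_iff]
      exact ⟨⟨u, ho⟩, fun x => Subtype.ext (hf _ _ o x.2 ho)⟩
    rw [h2] at h1
    exact h1
  have c1 : ∑ x, (miss f x).card ≤ D := by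
    rw [← Finset.card_biUnion]
    · exact (Finset.card_le_univ _).trans (by simp)
    · intro x _ y _ hxy
      refine Finset.disjoint_left.2 fun a hax hay => ?_
      exact hxy (hf x y a (mem_miss.1 hax) (mem_miss.1 hay))
  have c2 : ∑ x, ((miss f x).card + G.degree x) =
      ∑ x, (D + ((if x = u then 1 else 0) + if x = s then 1 else 0)) := by
    refine Finset.sum_congr rfl fun x _ => ?_
    have hus := h.ne
    rcases eq_or_ne x u with rfl | hxu
    · rw [if_pos rfl, if_neg hus, h.card_miss_center]
    rcases eq_or_ne x s with rfl | hxs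
    · rw [if_neg hxu, if_pos rfl, h.card_miss_hole]
    · rw [if_neg hxu, if_neg hxs, h.card_miss hxu hxs]
      rfl
  rw [Finset.sum_add_distrib, G.sum_degrees_eq_twice_card_edges, Finset.sum_add_distrib,
    Finset.sum_add_distrib, Finset.sum_ite_eq', Finset.sum_ite_eq', if_pos (Finset.mem_univ _),
    if_pos (Finset.mem_univ _), Finset.sum_const, Finset.card_univ, smul_eq_mul] at c2
  obtain ⟨q, hq⟩ : ∃ q, Fintype.card V = 2 * q + 1 := ⟨Fintype.card V / 2, by omega⟩
  have hq2 : Fintype.card V / 2 = q := by omega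
  rw [hq2]
  rw [hq] at c2
  have : (2 * q + 1) * D = 2 * (D * q) + D := by ring
  omega

/-- A vertex that is not adjacent to `u` has many neighbors of small degree in common with `u`. -/
theorem card_common_far (hno : ∀ f : Fin D → V → V, ¬ IsFull G f)
    (hcrit : ∀ x y, G.Adj x y → ∃ f : Fin D → V → V, IsCol G x y f)
    (hiso : ∀ z, ∃ x, G.Adj z x) (hle : ∀ x, G.degree x ≤ D) (hdu : G.degree u = D)
    (hn : 2 * Fintype.card V +
      3 * (Finset.univ.filter fun x => G.Adj u x ∧ G.degree x = D).card ≤ 3 * D)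
    {z : V} (hz : z ∉ Near G u) :
    (Finset.univ.filter fun x => G.Adj u x ∧ G.degree x = D).card ≤
      (Finset.univ.filter fun x => G.Adj u x ∧ G.Adj z x ∧ G.degree x < D).card + 1 := by
  set K := Finset.univ.filter fun x => G.Adj u x ∧ G.degree x = D with hK
  have hzu : z ≠ u := fun e => hz (.inl e)
  have hzadj : ¬ G.Adj u z := fun e => hz (.inr e)
  have huz : u ≠ z := hzu.symm
  -- the vertices outside the closed neighborhood of `u`, other than `z`
  set R := Finset.univ \ (insert u (insert z (G.neighborFinset u))) with hR
  have cR : R.card + (D + 2) = Fintype.card V := by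
    have h1 := Finset.card_sdiff_add_card_eq_card
      (Finset.subset_univ (insert u (insert z (G.neighborFinset u))))
    rw [Finset.card_insert_of_notMem (by simp [huz]),
      Finset.card_insert_of_notMem (by simpa using hzadj), G.card_neighborFinset_eq_degree, hdu,
      Finset.card_univ] at h1
    omega
  have hdz : 2 * D + 2 ≤ G.degree z + Fintype.card V + K.card := by
    rcases (hle z).eq_or_lt with e | hzD
    · omega
    obtain ⟨x, hzx⟩ := hiso z
    obtain ⟨f, h⟩ := hcrit x z hzx.symm
    have hm := h.card_miss_center
    have hxD := hle x
    obtain ⟨o, ho⟩ := Finset.card_pos.1 (by omega : 0 < (miss f x).card)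
    have hfan := h.fan_big hno (mem_miss.1 ho)
    have hsub : (Finset.univ.filter fun y => y ∈ Fan f x z ∧ y ≠ z ∧ G.degree y = D) ⊆
        insert u (K ∪ R) := by
      intro y hy
      simp only [Finset.mem_filter, Finset.mem_univ, true_and] at hy
      simp only [hK, hR, Finset.mem_insert, Finset.mem_union, Finset.mem_filter, Finset.mem_univ,
        true_and, Finset.mem_sdiff, SimpleGraph.mem_neighborFinset, not_or]
      tauto
    have h2 := Finset.card_le_card hsub
    have h3 := Finset.card_insert_le u (K ∪ R)
    have h4 := Finset.card_union_le K R
    omega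
  have c1 := Finset.card_union_add_card_inter (G.neighborFinset u) (G.neighborFinset z)
  have c2 : (G.neighborFinset u ∪ G.neighborFinset z).card + 2 ≤ Fintype.card V := by
    have h1 : G.neighborFinset u ∪ G.neighborFinset z ⊆ Finset.univ \ {u, z} := by
      intro y hy
      simp only [Finset.mem_union, SimpleGraph.mem_neighborFinset] at hy
      simp only [Finset.mem_sdiff, Finset.mem_univ, true_and, Finset.mem_insert,
        Finset.mem_singleton, not_or]
      constructor
      · rintro rfl
        rcases hy with hy | hy
        · exact hy.ne rfl
        · exact hzadj hy.symm
      · rintro rfl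
        rcases hy with hy | hy
        · exact hzadj hy
        · exact hy.ne rfl
    have h2 := Finset.card_le_card h1
    have h3 := Finset.card_sdiff_add_card_eq_card (Finset.subset_univ ({u, z} : Finset V))
    rw [Finset.card_pair huz, Finset.card_univ] at h3
    omega
  have c3 : (G.neighborFinset u ∩ G.neighborFinset z).card ≤
      (Finset.univ.filter fun x => G.Adj u x ∧ G.Adj z x ∧ G.degree x < D).card + K.card := by
    refine le_trans (Finset.card_le_card ?_) (Finset.card_union_le _ _)
    intro y hy
    simp only [Finset.mem_inter, SimpleGraph.mem_neighborFinset] at hy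
    simp only [hK, Finset.mem_union, Finset.mem_filter, Finset.mem_univ, true_and]
    rcases (hle y).eq_or_lt with e | e
    · exact .inr ⟨hy.1, e⟩
    · exact .inl ⟨hy.1, hy.2, e⟩
  simp only [SimpleGraph.card_neighborFinset_eq_degree, hdu] at c1
  omega

end

/-! ### Critical graphs -/

section

variable {V : Type*} {D : ℕ} {G : SimpleGraph V}

theorem IsFull.chromaticIndex_le {f : Fin D → V → V} (h : IsFull G f) :
    G.chromaticIndex ≤ D := by
  have hex : ∀ e : G.edgeSet, ∃ a, ∀ w ∈ e.1, e.1 = s(w, f a w) := by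
    rintro ⟨e, he⟩
    induction e with
    | _ x y =>
      obtain ⟨a, ha⟩ := h.surj x y he
      refine ⟨a, fun w hw => ?_⟩
      rcases Sym2.mem_iff.1 hw with rfl | rfl
      · change s(w, y) = _
        rw [ha]
      · change s(x, w) = _
        rw [← ha, h.inv, Sym2.eq_swap]
  choose c hc using hex
  refine SimpleGraph.chromaticNumber_le_iff_colorable.2 ⟨SimpleGraph.Coloring.mk c ?_⟩
  rintro e₁ e₂ ⟨hne, w, hw₁, hw₂⟩ he
  refine hne (Subtype.ext ?_)
  rw [hc e₁ w hw₁, hc e₂ w hw₂, he]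

/-- A coloring of the line graph of a subgraph yields a family of involutions. -/
theorem exists_isFull_of_chromaticIndex_le (H : G.Subgraph) (hH : H.coe.chromaticIndex ≤ D) :
    ∃ f : Fin D → V → V, IsFull H.spanningCoe f := by
  obtain ⟨C⟩ := SimpleGraph.chromaticNumber_le_iff_colorable.1 hH
  let c : ∀ {w z : V}, H.Adj w z → Fin D := fun {w z} h =>
    C ⟨s(⟨w, h.fst_mem⟩, ⟨z, h.snd_mem⟩), h⟩
  have hsymm : ∀ {w z : V} (h : H.Adj w z), c h.symm = c h := by
    intro w z h
    exact congrArg C (Subtype.ext Sym2.eq_swap)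
  have hproper : ∀ {w z z' : V} (h : H.Adj w z) (h' : H.Adj w z'), c h = c h' → z = z' := by
    intro w z z' h h' e
    by_contra hne
    refine C.valid (v := ⟨s(⟨w, h.fst_mem⟩, ⟨z, h.snd_mem⟩), h⟩)
      (w := ⟨s(⟨w, h'.fst_mem⟩, ⟨z', h'.snd_mem⟩), h'⟩) ⟨?_, ⟨w, h.fst_mem⟩, ?_, ?_⟩ e
    · intro e'
      have e'' := congrArg Subtype.val e'
      rcases Sym2.eq_iff.1 e'' with ⟨-, e3⟩ | ⟨e3, e4⟩
      · exact hne (congrArg Subtype.val e3)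
      · have e5 : w = z' := congrArg Subtype.val e3
        exact h'.adj_sub.ne e5
    · exact Sym2.mem_mk_left _ _
    · exact Sym2.mem_mk_left _ _
  let f : Fin D → V → V := fun a w =>
    if h : ∃ z, ∃ hz : H.Adj w z, c hz = a then h.choose else w
  have f_of : ∀ {w z : V} (h : H.Adj w z), f (c h) w = z := by
    intro w z h
    have hex : ∃ z', ∃ hz : H.Adj w z', c hz = c h := ⟨z, h, rfl⟩
    obtain ⟨h1, h2⟩ := hex.choose_spec
    simp only [f, dif_pos hex]
    exact hproper h1 h h2
  have f_ne : ∀ {a : Fin D} {w : V}, f a w ≠ w → ∃ h : H.Adj w (f a w), c h = a := by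
    intro a w hw
    by_cases hex : ∃ z, ∃ hz : H.Adj w z, c hz = a
    · obtain ⟨z, hz, rfl⟩ := hex
      have := f_of hz
      exact ⟨by rw [this]; exact hz, by congr 1⟩
    · exact absurd (by simp only [f, dif_neg hex]) hw
  refine ⟨f, ?_, ?_, ?_, ?_⟩
  · intro a w
    by_cases hw : f a w = w
    · rw [hw, hw]
    obtain ⟨h, h2⟩ := f_ne hw
    have := f_of h.symm
    rwa [hsymm h, h2] at this
  · intro a w hw
    exact (f_ne hw).1
  · intro a b w e hw
    obtain ⟨h1, h2⟩ := f_ne hw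
    obtain ⟨h3, h4⟩ := f_ne (e ▸ hw : f b w ≠ w)
    rw [← h2, ← h4]
    congr 1
  · intro w z h
    exact ⟨c h, f_of h⟩

section
variable (hcrit : ∀ H : G.Subgraph, H ≠ ⊤ → H.coe.chromaticIndex ≤ D)
include hcrit

/-- Criticality for the subgraph without the edge `x y`. -/
theorem exists_isCol {x y : V} (hxy : G.Adj x y) : ∃ f : Fin D → V → V, IsCol G x y f := by
  obtain ⟨f, hf⟩ := exists_isFull_of_chromaticIndex_le
    ((⊤ : G.Subgraph).deleteEdges {s(x, y)}) (hcrit _ fun e => by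
      have h1 : (⊤ : G.Subgraph).Adj x y := hxy
      rw [← e] at h1
      simp at h1)
  have hadj : ∀ w z, ((⊤ : G.Subgraph).deleteEdges {s(x, y)}).spanningCoe.Adj w z ↔
      G.Adj w z ∧ ¬ s(w, z) = s(x, y) := by
    intro w z
    simp
  refine ⟨f, hxy, hf.inv, fun a w hw => ((hadj _ _).1 (hf.adj a w hw)).1, hf.inj, fun a ha => ?_,
    fun w z hwz h1 h2 => hf.surj w z ((hadj _ _).2 ⟨hwz, fun e => ?_⟩)⟩
  · have := ((hadj _ _).1 (hf.adj a x (by rw [ha]; exact hxy.ne'))).2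
    rw [ha] at this
    exact this rfl
  · rcases Sym2.eq_iff.1 e with e | e
    · exact h1 e
    · exact h2 e

/-- A critical graph has no isolated vertices: deleting one would not change the chromatic index. -/
theorem exists_adj (hno : ∀ f : Fin D → V → V, ¬ IsFull G f) (z : V) : ∃ x, G.Adj z x := by
  by_contra hcon
  push Not at hcon
  obtain ⟨f, hf⟩ := exists_isFull_of_chromaticIndex_le
    ((⊤ : G.Subgraph).deleteVerts {z}) (hcrit _ fun e => by
      have h1 : z ∈ (⊤ : G.Subgraph).verts := trivial
      rw [← e] at h1
      simp at h1)
  have hadj : ((⊤ : G.Subgraph).deleteVerts {z}).spanningCoe = G := by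
    ext w w'
    simp only [SimpleGraph.Subgraph.spanningCoe_adj, SimpleGraph.Subgraph.deleteVerts_adj,
      SimpleGraph.Subgraph.verts_top, Set.mem_univ, Set.mem_singleton_iff,
      SimpleGraph.Subgraph.top_adj, true_and]
    refine ⟨fun h => h.2.2, fun h => ⟨?_, ?_, h⟩⟩
    · rintro rfl; exact hcon _ h
    · rintro rfl; exact hcon _ h.symm
  rw [hadj] at hf
  exact hno f hf

end

theorem isOverfull_of_critical [Fintype V] [DecidableRel G.Adj]
    (hno : ∀ f : Fin D → V → V, ¬ IsFull G f)
    (hcrit : ∀ H : G.Subgraph, H ≠ ⊤ → H.coe.chromaticIndex ≤ D)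
    (hle : ∀ x, G.degree x ≤ D) {u : V} (hdu : G.degree u = D) {k : ℕ} (hk : 0 < k)
    (hku : (Finset.univ.filter fun x => G.Adj u x ∧ G.degree x = D).card ≤ k)
    (hD : 4 * Fintype.card V + 9 * k ≤ 6 * D) :
    D * (Fintype.card V / 2) < G.edgeFinset.card := by
  by_contra hcon
  have hcol : ∀ x y, G.Adj x y → ∃ f : Fin D → V → V, IsCol G x y f :=
    fun x y => exists_isCol hcrit
  have hex : ∃ s, G.Adj u s ∧ G.degree s < D := by
    by_contra hall
    push Not at hall
    have h1 : G.neighborFinset u ⊆ Finset.univ.filter fun x => G.Adj u x ∧ G.degree x = D := by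
      intro x hx
      have hx' : G.Adj u x := by simpa using hx
      simpa using ⟨hx', (hle x).antisymm (hall x hx')⟩
    have h2 := Finset.card_le_card h1
    rw [G.card_neighborFinset_eq_degree, hdu] at h2
    omega
  have key := three_mul_degree_le hno hdu hle hex fun s hus hs => by
    by_contra hT
    have hH : ∀ f : Fin D → V → V, IsCol G u s f → NearElementary G u f := by
      intro f hf
      by_contra hf'
      exact hT (exists_hasToken hno hdu hf hf')
    obtain ⟨f, hf⟩ := hcol u s hus
    refine hcon (overfull_of_elementary hf hdu fun y z c hy hz =>
      elementary_of_near hH hdu hf hs (fun z hz => ?_) hy hz)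
    exact card_common_far hno hcol (exists_adj hcrit hno) hle hdu (by omega) hz
  omega

end

end OverfullCore

theorem theorem1 {V : Type*} [Fintype V] (G : SimpleGraph V)
    [DecidableRel G.Adj] (k n D : ℕ) (hk : 2 ≤ k) (hn : Fintype.card V = n)
    (hG : G.IsDeltaCritical D)
    (hD : (2 / 3 : ℝ) * (n : ℝ) + 3 * (k : ℝ) / 2 ≤ (D : ℝ))
    (hcore : G.core.minDegree ≤ k) :
    G.IsOverfull := by
  classical
  obtain ⟨hcr, h2, hmax⟩ := hG
  have hχ : G.chromaticIndex = (D : ℕ∞) + 1 := by rw [← hmax]; exact h2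
  have hno : ∀ f : Fin D → V → V, ¬ OverfullCore.IsFull G f := by
    intro f hf
    have h := hf.chromaticIndex_le
    rw [hχ] at h
    have h' : ((D + 1 : ℕ) : ℕ∞) ≤ (D : ℕ∞) := by exact_mod_cast h
    have := Nat.cast_le.1 h'
    omega
  have hcrit : ∀ H : G.Subgraph, H ≠ ⊤ → H.coe.chromaticIndex ≤ D := by
    intro H hH
    have := hcr H hH
    rw [hχ] at this
    exact (ENat.lt_add_one_iff (ENat.natCast_ne_top D)).1 this
  have hne : Nonempty V := by
    by_contra hV
    rw [not_nonempty_iff] at hV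
    exact hno (fun _ x => x) ⟨fun _ x => isEmptyElim x, fun _ x => isEmptyElim x,
      fun _ _ x => isEmptyElim x, fun x => isEmptyElim x⟩
  obtain ⟨w, hw⟩ := G.exists_maximal_degree_vertex
  have hne' : Nonempty {v : V | G.degree v = G.maxDegree} := ⟨⟨w, hw.symm⟩⟩
  obtain ⟨⟨u, hu⟩, hmin⟩ := G.core.exists_minimal_degree_vertex
  have hdu : G.degree u = D := by rw [← hmax]; exact hu
  have hle : ∀ x, G.degree x ≤ D := fun x => hmax ▸ G.degree_le_maxDegree x
  have hku : (Finset.univ.filter fun x => G.Adj u x ∧ G.degree x = D).card ≤ k := by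
    rw [hmin, ← SimpleGraph.card_neighborFinset_eq_degree] at hcore
    refine le_trans (Finset.card_le_card_of_surjOn Subtype.val fun x hx => ?_) hcore
    obtain ⟨hux, hxD⟩ : G.Adj u x ∧ G.degree x = D := by simpa using hx
    exact ⟨⟨x, by rw [Set.mem_ofPred_eq, hxD, hmax]⟩, by simpa using hux, rfl⟩
  have hD' : 4 * Fintype.card V + 9 * k ≤ 6 * D := by
    have h : (4 * n + 9 * k : ℝ) ≤ 6 * D := by linarith
    rw [hn]
    exact_mod_cast h
  rw [SimpleGraph.IsOverfull, hmax]
  convert OverfullCore.isOverfull_of_critical hno hcrit hle hdu (by omega) hku hD'
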